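/- **Setting.** Let $M$ be a compact smooth $n$-dimensional manifold without boundary with a smooth positive density $\mu$, and let $V\to M$ be a smooth real vector bundle of finite rank with a smooth fibre metric. Let $L^2(V)$ be the completion of the smooth sections under $(u,v)=\int_M\langle u,v\rangle\,d\mu$. An operator $H$ on smooth sections is *of Laplace type* if it is a second-order differential operator with leading symbol $|\xi|^2 I$ for some Riemannian metric, i.e. $[[H,f],f]=-2|df|^2$ for all smooth $f$. An operator $A$ is *of Dirac type* if it is a first-order differential operator and $A^2$ is of Laplace type. *Self-adjoint* means that the closure in $L^2(V)$ of the operator on smooth sections is self-adjoint; operators are identified with their closures, and functions of operators are defined by the spectral calculus. **Kernels.** For $t>0$ let $$h_f(t)=(4\pi)^{-1/2}t^{-3/2}\sum_{k\ge1}(-1)^{k+1}k\,e^{-k^2/4t},\qquad h_b(t)=(4\pi)^{-1/2}t^{-3/2}\sum_{k\ge1}k\,e^{-k^2/4t},$$ $$h_0(t)=(4\pi)^{-1/2}t^{-3/2}\sum_{k\ge0}(2k+1)\,e^{-(2k+1)^2/4t}.$$ These are the inverse Laplace transforms of the Fermi and Bose functions and of their mean: for all $x>0$ the following integrals converge absolutely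 and $$\frac1{e^x+1}=\int_0^\infty h_f(t)e^{-tx^2}dt,\qquad \frac1{e^x-1}=\int_0^\infty h_b(t)e^{-tx^2}dt,\qquad \frac12\Big(\frac1{e^x-1}+\frac1{e^x+1}\Big)=\int_0^\infty h_0(t)e^{-tx^2}dt.$$ **Bosonic case.** Let $H_\pm$ be self-adjoint operators of Laplace type on $V$, let $m>0$ be such that $H_\pm+m^2$ are positive, and put $\omega_\pm=(H_\pm+m^2)^{1/2}$, $f(x)=\tanh(x/2)$. Then for all $t,s>0$ the operator whose trace is $$\Psi(t,s)=\mathrm{Tr}\,\{e^{-tH_+}-e^{-tH_-}\}\{e^{-sH_+}-e^{-sH_-}\}$$ is trace class, and for every $\beta>0$ the operator whose trace defines $$B_b(\beta)=\tfrac14\mathrm{Tr}\,\{f(\beta\omega_-)-f(\beta\omega_+)\}\Big\{\frac1{f(\beta\omega_+)}-\frac1{f(\beta\omega_-)}\Big\}$$ is trace class, the following integral converges absolutely, and $$B_b(\beta)=\int_0^\infty dt\int_0^\infty ds\;h_f(t)h_b(s)\,e^{-m^2\beta^2(s+t)}\,\Psi(\beta^2t,\beta^2s).$$ **Fermionic case.**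 Let $A_\pm$ be self-adjoint operators of Dirac type on $V$, $m>0$, $H_\pm=A_\pm^2$, and let $\Psi$ be defined by these $H_\pm$ as above. On $L^2(V)\oplus L^2(V)$ consider $$D_\pm=\begin{pmatrix}A_\pm&m\\ m&-A_\pm\end{pmatrix},\qquad \omega_\pm=|D_\pm|,\qquad F_\pm=D_\pm\,\omega_\pm^{-1},\qquad g(x)=\frac{x}{\sinh x}.$$ Then for all $t,s>0$ the operators whose traces are $\Psi(t,s)$ and $$\Phi(t,s)=\mathrm{Tr}\,[A_+e^{-tH_+}-A_-e^{-tH_-}][A_+e^{-sH_+}-A_-e^{-sH_-}]$$ are trace class, and for every $\beta>0$ the operator whose trace defines $$B_f(\beta)=\tfrac18\mathrm{Tr}\,\{F_+g(\beta\omega_+)-F_-g(\beta\omega_-)\}^2$$ is trace class, the following integral converges absolutely, and $$B_f(\beta)=\int_0^\infty dt\int_0^\infty ds\;h_0(s)h_0(t)\,e^{-m^2\beta^2(s+t)}\,\beta^2\big\{\Phi(\beta^2t,\beta^2s)+m^2\Psi(\beta^2t,\beta^2s)\big\}.$$ -/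

import Mathlib

open MeasureTheory Bundle Set
open scoped Manifold ContDiff InnerProductSpace

noncomputable section

namespace Bogolyubov

/-! ### Functions of self-adjoint operators and traces on a real Hilbert space -/

section Hilbert

variable {E : Type*} [NormedAddCommGroup E] [InnerProductSpace ℝ E] [CompleteSpace E]

/-- The eigenspace `{u ∈ dom T | T u = l u}` of a partially defined operator `T`. -/
def eigenspace (T : E →ₗ.[ℝ] E) (l : ℝ) : Submodule ℝ E :=
  T.graph.comap (LinearMap.id.prod (l • LinearMap.id))

/-- The orthogonal projection to the eigenspace (for closed `T` the eigenspace is closed, so that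
the closure changes nothing). -/
def spectralProj (T : E →ₗ.[ℝ] E) (l : ℝ) : E →L[ℝ] E :=
  (eigenspace T l).topologicalClosure.starProjection

/-- `φ(T) = ∑ φ(l) P_l`, the sum running over the eigenvalues `l` of `T` (the terms with `l` not
an eigenvalue vanish) and converging strongly. This is the spectral calculus for self-adjoint
operators with discrete spectrum; it is used with functions bounded on the spectrum. -/
def opFun (T : E →ₗ.[ℝ] E) (φ : ℝ → ℝ) : E → E :=
  fun u => ∑' l : ℝ, φ l • spectralProj T l u

/-- The trace class (nuclear) operators. -/
def IsTraceClass (T : E → E) : Prop :=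
  ∃ x y : ℕ → E, Summable (fun k => ‖x k‖ * ‖y k‖) ∧
    ∀ u, T u = ∑' k, ⟪x k, u⟫_ℝ • y k

/-- The Hilbert space trace, computed in an orthonormal basis (for trace class operators it does
not depend on the basis). -/
def opTrace (T : E → E) : ℝ :=
  ∑' i, ⟪(exists_hilbertBasis ℝ E).choose_spec.choose i,
    T ((exists_hilbertBasis ℝ E).choose_spec.choose i)⟫_ℝ

/-- The square `A²` of an operator `A`, on its natural domain `{u ∈ dom A | A u ∈ dom A}`. -/
def sqOp (A : E →ₗ.[ℝ] E) : E →ₗ.[ℝ] E where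
  domain :=
    { carrier := {u | ∃ h : u ∈ A.domain, A ⟨u, h⟩ ∈ A.domain}
      add_mem' := by
        rintro a b ⟨ha, ha'⟩ ⟨hb, hb'⟩
        refine ⟨A.domain.add_mem ha hb, ?_⟩
        have := A.map_add ⟨a, ha⟩ ⟨b, hb⟩
        rw [show (⟨a + b, A.domain.add_mem ha hb⟩ : A.domain) = ⟨a, ha⟩ + ⟨b, hb⟩ from rfl, this]
        exact A.domain.add_mem ha' hb'
      zero_mem' := by
        refine ⟨A.domain.zero_mem, ?_⟩
        rw [show (⟨0, A.domain.zero_mem⟩ : A.domain) = 0 from rfl, A.map_zero]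
        exact A.domain.zero_mem
      smul_mem' := by
        rintro c a ⟨ha, ha'⟩
        refine ⟨A.domain.smul_mem c ha, ?_⟩
        have := A.map_smul c ⟨a, ha⟩
        rw [show (⟨c • a, A.domain.smul_mem c ha⟩ : A.domain) = c • ⟨a, ha⟩ from rfl, this]
        exact A.domain.smul_mem c ha' }
  toFun :=
    { toFun := fun u => A ⟨A ⟨u.1, u.2.fst⟩, u.2.snd⟩
      map_add' := by
        rintro ⟨a, ha, ha'⟩ ⟨b, hb, hb'⟩
        rw [← A.map_add]
        congr 1
        apply Subtype.ext
        exact A.map_add ⟨a, ha⟩ ⟨b, hb⟩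
      map_smul' := by
        rintro c ⟨a, ha, ha'⟩
        rw [RingHom.id_apply, ← A.map_smul]
        congr 1
        apply Subtype.ext
        exact A.map_smul c ⟨a, ha⟩ }

/-- The operator `K + m η = ((A, m), (m, -A))` on the Hilbert sum of two copies of the space. -/
def massiveDirac (A : E →ₗ.[ℝ] E) (m : ℝ) : WithLp 2 (E × E) →ₗ.[ℝ] WithLp 2 (E × E) where
  domain :=
    (A.domain.prod A.domain).comap (WithLp.linearEquiv 2 ℝ (E × E)).toLinearMap
  toFun :=
    { toFun := fun z => WithLp.toLp 2
        (A ⟨z.1.fst, z.2.1⟩ + m • z.1.snd, m • z.1.fst - A ⟨z.1.snd, z.2.2⟩)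
      map_add' := by
        rintro ⟨a, ha⟩ ⟨b, hb⟩
        have h1 := A.map_add ⟨a.fst, ha.1⟩ ⟨b.fst, hb.1⟩
        have h2 := A.map_add ⟨a.snd, ha.2⟩ ⟨b.snd, hb.2⟩
        rw [← WithLp.toLp_add, Prod.mk_add_mk]
        congr 2
        · refine (congrArg₂ (· + ·) h1 (smul_add m a.snd b.snd)).trans ?_
          abel
        · refine (congrArg₂ (· - ·) (smul_add m a.fst b.fst) h2).trans ?_
          abel
      map_smul' := by
        rintro c ⟨a, ha⟩
        have h1 := A.map_smul c ⟨a.fst, ha.1⟩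
        have h2 := A.map_smul c ⟨a.snd, ha.2⟩
        rw [RingHom.id_apply, ← WithLp.toLp_smul, Prod.smul_mk, smul_add, smul_sub]
        congr 2
        · exact congrArg₂ (· + ·) h1 (smul_comm m c a.snd)
        · exact congrArg₂ (· - ·) (smul_comm m c a.fst) h2 }

/-! ### Heat traces -/

/-- The heat operator `exp(-tH)`. -/
def heatOp (H : E →ₗ.[ℝ] E) (t : ℝ) : E → E := opFun H fun l => Real.exp (-t * l)

/-- The operator `A exp(-tA²)`. -/
def diracHeatOp (A : E →ₗ.[ℝ] E) (t : ℝ) : E → E := opFun A fun l => l * Real.exp (-t * l ^ 2)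

/-- `{exp(-tH₊) - exp(-tH₋)}{exp(-sH₊) - exp(-sH₋)}` -/
def relHeatOp (Hp Hm : E →ₗ.[ℝ] E) (t s : ℝ) : E → E :=
  (heatOp Hp t - heatOp Hm t) ∘ (heatOp Hp s - heatOp Hm s)

/-- The relative heat trace `Ψ(t,s)`. -/
def relHeatTrace (Hp Hm : E →ₗ.[ℝ] E) (t s : ℝ) : ℝ := opTrace (relHeatOp Hp Hm t s)

/-- `[A₊ exp(-tA₊²) - A₋ exp(-tA₋²)][A₊ exp(-sA₊²) - A₋ exp(-sA₋²)]` -/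
def relDiracHeatOp (Ap Am : E →ₗ.[ℝ] E) (t s : ℝ) : E → E :=
  (diracHeatOp Ap t - diracHeatOp Am t) ∘ (diracHeatOp Ap s - diracHeatOp Am s)

/-- The relative heat trace for Dirac operators `Φ(t,s)`. -/
def relDiracHeatTrace (Ap Am : E →ₗ.[ℝ] E) (t s : ℝ) : ℝ := opTrace (relDiracHeatOp Ap Am t s)

/-! ### Bogolyubov invariants -/

/-- `φ(βω)` with `ω = (H + m²)^{1/2}` -/
def omegaFun (H : E →ₗ.[ℝ] E) (m β : ℝ) (φ : ℝ → ℝ) : E → E :=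
  opFun H fun l => φ (β * √(l + m ^ 2))

/-- `{f(βω₋) - f(βω₊)}{1/f(βω₊) - 1/f(βω₋)}` with `f(x) = tanh(x/2)` -/
def bosonicOp (Hp Hm : E →ₗ.[ℝ] E) (m β : ℝ) : E → E :=
  (omegaFun Hm m β (fun x => Real.tanh (x / 2)) - omegaFun Hp m β (fun x => Real.tanh (x / 2))) ∘
    (omegaFun Hp m β (fun x => 1 / Real.tanh (x / 2)) -
      omegaFun Hm m β (fun x => 1 / Real.tanh (x / 2)))

/-- The bosonic Bogolyubov invariant `B_b(β)`. -/
def bosonicInvariant (Hp Hm : E →ₗ.[ℝ] E) (m β : ℝ) : ℝ :=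
  1 / 4 * opTrace (bosonicOp Hp Hm m β)

/-- `F g(βω)` with `ω = |K + mη|`, `F = (K + mη) ω⁻¹` and `g(x) = x / sinh x` -/
def regularizedSign (A : E →ₗ.[ℝ] E) (m β : ℝ) : WithLp 2 (E × E) → WithLp 2 (E × E) :=
  opFun (massiveDirac A m) fun l => l / |l| * (β * |l| / Real.sinh (β * |l|))

/-- `{F₊ g(βω₊) - F₋ g(βω₋)}²` -/
def fermionicOp (Ap Am : E →ₗ.[ℝ] E) (m β : ℝ) : WithLp 2 (E × E) → WithLp 2 (E × E) :=
  (regularizedSign Ap m β - regularizedSign Am m β) ∘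
    (regularizedSign Ap m β - regularizedSign Am m β)

/-- The fermionic Bogolyubov invariant `B_f(β)`. -/
def fermionicInvariant (Ap Am : E →ₗ.[ℝ] E) (m β : ℝ) : ℝ :=
  1 / 8 * opTrace (fermionicOp Ap Am m β)

end Hilbert

/-! ### The Fermi and Bose functions and their kernels -/

def fermi (x : ℝ) : ℝ := 1 / (Real.exp x + 1)

def bose (x : ℝ) : ℝ := 1 / (Real.exp x - 1)

def fermiBoseMean (x : ℝ) : ℝ := (bose x + fermi x) / 2

/-- `h_f(t) = (4π)^{-1/2} t^{-3/2} ∑_{k ≥ 1} (-1)^{k+1} k exp(-k²/(4t))` -/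
def hf (t : ℝ) : ℝ :=
  (4 * Real.pi) ^ (-1 / 2 : ℝ) * t ^ (-3 / 2 : ℝ) *
    ∑' k : ℕ, (-1) ^ k * ((k : ℝ) + 1) * Real.exp (-((k : ℝ) + 1) ^ 2 / (4 * t))

/-- `h_b(t) = (4π)^{-1/2} t^{-3/2} ∑_{k ≥ 1} k exp(-k²/(4t))` -/
def hb (t : ℝ) : ℝ :=
  (4 * Real.pi) ^ (-1 / 2 : ℝ) * t ^ (-3 / 2 : ℝ) *
    ∑' k : ℕ, ((k : ℝ) + 1) * Real.exp (-((k : ℝ) + 1) ^ 2 / (4 * t))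

/-- `h_0(t) = (4π)^{-1/2} t^{-3/2} ∑_{k ≥ 0} (2k+1) exp(-(2k+1)²/(4t))` -/
def h0 (t : ℝ) : ℝ :=
  (4 * Real.pi) ^ (-1 / 2 : ℝ) * t ^ (-3 / 2 : ℝ) *
    ∑' k : ℕ, (2 * (k : ℝ) + 1) * Real.exp (-(2 * (k : ℝ) + 1) ^ 2 / (4 * t))

/-- `φ(x) = ∫₀^∞ h(t) exp(-t x²) dt` for all `x > 0`, that is, `h` is the inverse Laplace transform
of `z ↦ φ(√z)`. -/
def IsLaplaceKernel (h φ : ℝ → ℝ) : Prop :=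
  ∀ x : ℝ, 0 < x → IntegrableOn (fun t => h t * Real.exp (-t * x ^ 2)) (Ioi 0) ∧
    φ x = ∫ t in Ioi (0 : ℝ), h t * Real.exp (-t * x ^ 2)

/-! ### Smooth sections and their `L²` space -/

/-- A smooth positive density on an `n`-manifold: in every chart of the atlas it is `ρ(y) dy` with a
smooth positive function `ρ`. -/
def IsSmoothDensity (n : ℕ) {M : Type*} [TopologicalSpace M]
    [ChartedSpace (EuclideanSpace ℝ (Fin n)) M] [MeasurableSpace M] (μ : Measure M) : Prop :=
  ∀ e ∈ atlas (EuclideanSpace ℝ (Fin n)) M, ∃ ρ : EuclideanSpace ℝ (Fin n) → ℝ,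
    ContDiffOn ℝ ∞ ρ e.target ∧ (∀ y ∈ e.target, 0 < ρ y) ∧
    (μ.restrict e.source).map e =
      (volume.restrict e.target).withDensity fun y => ENNReal.ofReal (ρ y)

section Bundle

variable {n : ℕ} {M : Type*} [TopologicalSpace M] [ChartedSpace (EuclideanSpace ℝ (Fin n)) M]
  {F : Type*} [NormedAddCommGroup F] [NormedSpace ℝ F]
  {V : M → Type*} [TopologicalSpace (TotalSpace F V)] [∀ x, NormedAddCommGroup (V x)]
  [∀ x, InnerProductSpace ℝ (V x)] [FiberBundle F V] [VectorBundle ℝ F V]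

/-- The product `f u` of a smooth function and a smooth section. -/
def mulSection (f : C^∞⟮𝓡 n, M; ℝ⟯) (u : Cₛ^∞⟮𝓡 n; F, V⟯) : Cₛ^∞⟮𝓡 n; F, V⟯ :=
  ⟨fun x => f x • u x, f.contMDiff.smul_section u.contMDiff⟩

/-- The differential `df(x)`, a cotangent vector. -/
def differential (f : C^∞⟮𝓡 n, M; ℝ⟯) (x : M) : TangentSpace (𝓡 n) x →L[ℝ] ℝ :=
  mfderiv (𝓡 n) 𝓘(ℝ, ℝ) f x

/-- Operators of Laplace type: `[[H,f],f] = -2 |df|²` for all smooth functions `f`, where `|·|` is a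
Riemannian (co)metric. This says that `H` is a second-order differential operator with
leading symbol `|ξ|² I`; smoothness of the metric is then automatic. -/
def IsLaplaceType (H : Cₛ^∞⟮𝓡 n; F, V⟯ →ₗ[ℝ] Cₛ^∞⟮𝓡 n; F, V⟯) : Prop :=
  ∃ G : ∀ x : M, QuadraticForm ℝ (TangentSpace (𝓡 n) x →L[ℝ] ℝ), (∀ x, (G x).PosDef) ∧
    ∀ (f : C^∞⟮𝓡 n, M; ℝ⟯) (u : Cₛ^∞⟮𝓡 n; F, V⟯) (x : M),
      H (mulSection f (mulSection f u)) x - (2 * f x) • H (mulSection f u) x + (f x) ^ 2 • H u x =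
        (-2 * G x (differential f x)) • u x

/-- Operators of Dirac type: first-order differential operators (that is, `[[A,f],h] = 0` for all
smooth functions `f`, `h`) whose square is of Laplace type. -/
def IsDiracType (A : Cₛ^∞⟮𝓡 n; F, V⟯ →ₗ[ℝ] Cₛ^∞⟮𝓡 n; F, V⟯) : Prop :=
  (∀ (f h : C^∞⟮𝓡 n, M; ℝ⟯) (u : Cₛ^∞⟮𝓡 n; F, V⟯) (x : M),
      A (mulSection f (mulSection h u)) x - f x • A (mulSection h u) x
        - h x • A (mulSection f u) x + (f x * h x) • A u x = 0) ∧
    IsLaplaceType (A ∘ₗ A)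

theorem continuous_inner_section [IsContMDiffRiemannianBundle (𝓡 n) ∞ F V]
    (u v : Cₛ^∞⟮𝓡 n; F, V⟯) : Continuous fun x => ⟪u x, v x⟫_ℝ :=
  (ContMDiff.inner_bundle (IB := 𝓡 n) (n := ∞) (F := F) u.contMDiff v.contMDiff).continuous

variable [CompactSpace M] [MeasurableSpace M] [BorelSpace M]
  [IsContMDiffRiemannianBundle (𝓡 n) ∞ F V]

theorem integrable_inner_section (μ : Measure M) [IsFiniteMeasure μ]
    (u v : Cₛ^∞⟮𝓡 n; F, V⟯) : Integrable (fun x => ⟪u x, v x⟫_ℝ) μ :=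
  (continuous_inner_section u v).integrable_of_hasCompactSupport
    (HasCompactSupport.of_compactSpace _)

variable (n F V) in
/-- The smooth sections of `V`, to be equipped with the inner product of `L²(V, μ)`. -/
def PreL2 (_μ : Measure M) : Type _ := Cₛ^∞⟮𝓡 n; F, V⟯

instance (μ : Measure M) : AddCommGroup (PreL2 n F V μ) :=
  inferInstanceAs (AddCommGroup Cₛ^∞⟮𝓡 n; F, V⟯)

instance (μ : Measure M) : Module ℝ (PreL2 n F V μ) :=
  inferInstanceAs (Module ℝ Cₛ^∞⟮𝓡 n; F, V⟯)

/-- The inner product `(u, v) = ∫ ⟨u, v⟩ dμ` on smooth sections. -/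
@[reducible] def sectionCore (μ : Measure M) [IsFiniteMeasure μ] :
    PreInnerProductSpace.Core ℝ (PreL2 n F V μ) where
  inner u v := ∫ x, ⟪ContMDiffSection.toFun u x, ContMDiffSection.toFun v x⟫_ℝ ∂μ
  conj_inner_symm u v := by
    simp [real_inner_comm]
  re_inner_nonneg u := by
    exact integral_nonneg fun x => real_inner_self_nonneg
  add_left u v w := by
    refine Eq.trans (integral_congr_ae (Filter.Eventually.of_forall fun x => ?_))
      (integral_add (integrable_inner_section μ u w) (integrable_inner_section μ v w))
    exact inner_add_left _ _ _
  smul_left u v r := by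
    refine Eq.trans (integral_congr_ae (Filter.Eventually.of_forall fun x => ?_))
      (integral_const_mul _ _)
    exact real_inner_smul_left _ _ _

instance (μ : Measure M) [IsFiniteMeasure μ] : SeminormedAddCommGroup (PreL2 n F V μ) :=
  @InnerProductSpace.Core.toSeminormedAddCommGroup ℝ _ _ _ _ (sectionCore μ)

instance (μ : Measure M) [IsFiniteMeasure μ] : InnerProductSpace ℝ (PreL2 n F V μ) :=
  InnerProductSpace.ofCore (sectionCore μ)

variable (n F V) in
/-- The Hilbert space `L²(V, μ)`: the completion of the smooth sections. -/
abbrev L2Sections (μ : Measure M) [IsFiniteMeasure μ] : Type _ :=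
  UniformSpace.Completion (PreL2 n F V μ)

/-- The inclusion of the smooth sections into `L²(V, μ)`. -/
def toL2 (μ : Measure M) [IsFiniteMeasure μ] : Cₛ^∞⟮𝓡 n; F, V⟯ →ₗ[ℝ] L2Sections n F V μ :=
  (UniformSpace.Completion.toComplₗᵢ (𝕜 := ℝ) (E := PreL2 n F V μ)).toLinearMap

/-- The closure in `L²(V, μ)` of an operator `H` on smooth sections: the graph
`{(u, H u) | u smooth}`, as a partially defined operator on `L²(V, μ)`, and its closure. -/
def l2Closure (μ : Measure M) [IsFiniteMeasure μ]
    (H : Cₛ^∞⟮𝓡 n; F, V⟯ →ₗ[ℝ] Cₛ^∞⟮𝓡 n; F, V⟯) :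
    L2Sections n F V μ →ₗ.[ℝ] L2Sections n F V μ :=
  (LinearMap.range ((toL2 μ).prod (toL2 μ ∘ₗ H))).toLinearPMap.closure

theorem inner_toL2 (μ : Measure M) [IsFiniteMeasure μ] (u v : Cₛ^∞⟮𝓡 n; F, V⟯) :
    ⟪toL2 μ u, toL2 μ v⟫_ℝ = ∫ x, ⟪u x, v x⟫_ℝ ∂μ :=
  UniformSpace.Completion.inner_coe (𝕜 := ℝ) (E := PreL2 n F V μ) u v

end Bundle

end Bogolyubov
end

open MeasureTheory Bundle Set
open scoped Manifold ContDiff InnerProductSpace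
set_option linter.unusedSectionVars false

noncomputable section

namespace Bogolyubov

/-! ### Integrals of series -/

/-! Everything reduces to one trace formula: if `S = ∑ a_k ⟨v_k, ·⟩ v_k` and `T = ∑ c_k ⟨v_k, ·⟩
v_k` with summable coefficients and vectors of norm at most one, then `Tr S T = ∑ a_k c_l ⟨v_k,
v_l⟩²` (`opTrace_rankOneSum_comp`). A difference of functions of two operators has this form, the
`v_k` running through both eigenbases and a sign marking the operator.

Bosons: `tanh (x/2) = 1 - 2/(e^x + 1)` and `coth (x/2) = 1 + 2/(e^x - 1)`. The constants cancel in
the differences, so `B_b` is a double sum of Fermi times Bose functions of the frequencies, with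
weights `± ⟨v_k, v_l⟩²` independent of `β`. Inserting the Laplace representations and interchanging
sum and integral (`double_laplace_tsum`) leaves the heat trace `Ψ`, times the exponential of the
mass.

Fermions: the massive operator splits into blocks `((a, m), (m, -a))` with eigenvalues `±ω`. Summing
over the two signs of a pair of blocks gives `2 (a a' + m²) / (ω ω')`
(`sum_boolSign_mul_inner_diracVec`). The frequencies cancel against the numerators of `x / sinh x`,
and `1 / (2 sinh)` is the mean of the Fermi and Bose functions. The term `a a'` yields `Φ` and the
term `m²` yields `m² Ψ`.

The kernels come from the subordination formula for `exp (-k x)` (`levyDensity_laplace`), summed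
over a geometric series.

The analytic input is a complete eigenbasis with eigenvalues growing at least polynomially. It rests
on `IsDiscretizable`: for every `N`, `O(N^n)` bounded functionals control the `L²` norm up to
`O(1/N²)` times the squared graph norm. This yields a compact `(1 + T²)⁻¹`
(`isCompactOperator_of_inverse`) and a bound on the number of eigenvalues
(`card_le_of_isEigenbasis`). The estimate is proved for smooth sections by Gårding's inequality in
small charts (`exists_garding`), derived from commutators with functions and the symmetry of the
operator, and by Fourier series on a unit cube (`integral_sq_le_fourier`). A partition of unity
globalizes it, and it passes to the closure because the inequality is a closed condition. -/

theorem integrable_tsum_of_summable_integral_norm {α ι : Type*} [MeasurableSpace α]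
    {μ : Measure α} [Countable ι] {f : ι → α → ℝ} (hf : ∀ i, Integrable (f i) μ)
    (hs : Summable fun i => ∫ a, ‖f i a‖ ∂μ) : Integrable (fun a => ∑' i, f i a) μ := by
  have hfin : ∑' i, ∫⁻ a, ‖f i a‖ₑ ∂μ ≠ ⊤ := by
    have (i : ι) : ∫⁻ a, ‖f i a‖ₑ ∂μ = ENNReal.ofReal (∫ a, ‖f i a‖ ∂μ) := by
      rw [ofReal_integral_norm_eq_lintegral_enorm (hf i)]
    simp_rw [this]
    exact hs.tsum_ofReal_ne_top
  have hlt : ∫⁻ a, ∑' i, ‖f i a‖ₑ ∂μ < ⊤ := by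
    rw [lintegral_tsum fun i => (hf i).1.enorm]
    exact hfin.lt_top
  -- A finite integral of `∑ |f i|` forces absolute convergence almost everywhere.
  have hae : ∀ᵐ a ∂μ, Summable fun i => f i a := by
    have h := ae_lt_top' (AEMeasurable.tsum fun i => (hf i).1.enorm) hlt.ne
    filter_upwards [h] with a ha
    refine Summable.of_norm ?_
    have h2 := ENNReal.summable_toReal ha.ne
    simpa using h2
  refine ⟨?_, ?_⟩
  · refine aestronglyMeasurable_of_tendsto_ae (Filter.atTop : Filter (Finset ι))
      (f := fun s a => ∑ i ∈ s, f i a) (fun s => ?_) ?_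
    · exact (integrable_finsetSum s fun i _ => hf i).1
    · filter_upwards [hae] with a ha using ha.hasSum
  · refine lt_of_le_of_lt (lintegral_mono_ae ?_) hlt
    filter_upwards [hae] with a ha
    have : ‖∑' i, f i a‖ ≤ ∑' i, ‖f i a‖ := norm_tsum_le_tsum_norm ha.norm
    rw [← ofReal_norm]
    calc ENNReal.ofReal ‖∑' i, f i a‖ ≤ ENNReal.ofReal (∑' i, ‖f i a‖) := ENNReal.ofReal_le_ofReal this
      _ = ∑' i, ‖f i a‖ₑ := by
        rw [ENNReal.ofReal_tsum_of_nonneg (fun _ => norm_nonneg _) ha.norm]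
        exact tsum_congr fun _ => ofReal_norm _

/-! ### The subordination formula -/

/-- The one-sided stable density of index `1 / 2`, whose Laplace transform is `exp (-k √·)`. -/
def levyDensity (k t : ℝ) : ℝ :=
  (4 * Real.pi) ^ (-1 / 2 : ℝ) * t ^ (-3 / 2 : ℝ) * (k * Real.exp (-k ^ 2 / (4 * t)))

/-- An unnormalized error function; the factor `-1` matches the Gaussian `exp (-b s²)` at `b = 1`.
-/
def gaussPrimitive (z : ℝ) : ℝ := ∫ s in (0 : ℝ)..z, Real.exp (-1 * s ^ 2)

theorem hasDerivAt_gaussPrimitive (z : ℝ) :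
    HasDerivAt gaussPrimitive (Real.exp (-z ^ 2)) z := by
  have hc : Continuous fun s : ℝ => Real.exp (-1 * s ^ 2) := by fun_prop
  have := intervalIntegral.integral_hasDerivAt_right (hc.intervalIntegrable 0 z)
    (hc.stronglyMeasurableAtFilter _ _) hc.continuousAt
  rw [neg_one_mul] at this
  exact this

theorem gaussPrimitive_tendsto_atTop :
    Filter.Tendsto gaussPrimitive Filter.atTop (nhds (√Real.pi / 2)) := by
  have h := intervalIntegral_tendsto_integral_Ioi (0 : ℝ)
    ((integrable_exp_neg_mul_sq one_pos).integrableOn) Filter.tendsto_id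
  rw [integral_gaussian_Ioi, div_one] at h
  exact h

theorem gaussPrimitive_neg (z : ℝ) : gaussPrimitive (-z) = -gaussPrimitive z := by
  have := intervalIntegral.integral_comp_neg (a := 0) (b := z) (fun s => Real.exp (-1 * s ^ 2))
  simp only [neg_zero, neg_sq] at this
  rw [gaussPrimitive, gaussPrimitive, this, intervalIntegral.integral_symm]

theorem gaussPrimitive_tendsto_atBot :
    Filter.Tendsto gaussPrimitive Filter.atBot (nhds (-(√Real.pi / 2))) := by
  have h := (gaussPrimitive_tendsto_atTop.comp Filter.tendsto_neg_atBot_atTop).neg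
  refine h.congr fun z => ?_
  simp [gaussPrimitive_neg]

/-- The primitive of `t ↦ levyDensity k t * exp (-t x²)`. -/
def levyPrimitive (k x t : ℝ) : ℝ :=
  (√Real.pi)⁻¹ * (Real.exp (-k * x) * gaussPrimitive (x * √t - k / 2 * (√t)⁻¹)
    - Real.exp (k * x) * gaussPrimitive (x * √t + k / 2 * (√t)⁻¹))

theorem hasDerivAt_levyPrimitive (k x : ℝ) {t : ℝ} (ht : 0 < t) :
    HasDerivAt (levyPrimitive k x) (levyDensity k t * Real.exp (-t * x ^ 2)) t := by
  have hs : 0 < √t := Real.sqrt_pos.2 ht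
  have h1 := Real.hasDerivAt_sqrt ht.ne'
  have h2 := h1.inv hs.ne'
  have hm := (h1.const_mul x).sub (h2.const_mul (k / 2))
  have hp := (h1.const_mul x).add (h2.const_mul (k / 2))
  have h3 := (((hasDerivAt_gaussPrimitive _).comp t hm).const_mul (Real.exp (-k * x))).sub
    (((hasDerivAt_gaussPrimitive _).comp t hp).const_mul (Real.exp (k * x)))
  have h4 := h3.const_mul (√Real.pi)⁻¹
  convert! h4 using 1
  -- Completing the square: the prefactors `exp (∓k x)` cancel the cross terms, so both summands
  -- carry the same exponential. The derivatives of the two arguments then differ by `k / (2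
  -- t^{3/2})`.
  have e1 : Real.exp (-k * x) * (Real.exp (-(x * √t - k / 2 * (√t)⁻¹) ^ 2))
      = Real.exp (-k ^ 2 / (4 * t)) * Real.exp (-t * x ^ 2) := by
    rw [← Real.exp_add, ← Real.exp_add]
    congr 1
    have : t = √t ^ 2 := (Real.sq_sqrt ht.le).symm
    field_simp
    rw [← this]; field_simp; ring
  have e2 : Real.exp (k * x) * (Real.exp (-(x * √t + k / 2 * (√t)⁻¹) ^ 2))
      = Real.exp (-k ^ 2 / (4 * t)) * Real.exp (-t * x ^ 2) := by
    rw [← Real.exp_add, ← Real.exp_add]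
    congr 1
    have : t = √t ^ 2 := (Real.sq_sqrt ht.le).symm
    field_simp
    rw [← this]; field_simp; ring
  simp only [Pi.sub_apply, Pi.add_apply, Pi.inv_apply]
  rw [← mul_assoc, ← mul_assoc, e1, e2]
  have e3 : (4 * Real.pi) ^ (-1 / 2 : ℝ) = (2 * √Real.pi)⁻¹ := by
    rw [show (-1 / 2 : ℝ) = -(1 / 2) by norm_num, Real.rpow_neg (by positivity),
      ← Real.sqrt_eq_rpow, Real.sqrt_mul (by norm_num), show (4 : ℝ) = 2 ^ 2 by norm_num,
      Real.sqrt_sq (by norm_num)]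
  have e4 : t ^ (-3 / 2 : ℝ) = (√t ^ 3)⁻¹ := by
    rw [show (-3 / 2 : ℝ) = -(1 / 2 * 3) by norm_num, Real.rpow_neg ht.le, Real.rpow_mul ht.le,
      ← Real.sqrt_eq_rpow]
    norm_cast
  rw [levyDensity, e3, e4]
  have : 0 < √Real.pi := Real.sqrt_pos.2 Real.pi_pos
  field_simp
  ring

theorem levyPrimitive_tendsto_nhdsGT {k x : ℝ} (hk : 0 < k) :
    Filter.Tendsto (levyPrimitive k x) (nhdsWithin 0 (Ioi 0))
      (nhds ((√Real.pi)⁻¹ * (Real.exp (-k * x) * (-(√Real.pi / 2))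
        - Real.exp (k * x) * (√Real.pi / 2)))) := by
  have hs : Filter.Tendsto (fun t : ℝ => √t) (nhdsWithin 0 (Ioi 0)) (nhdsWithin 0 (Ioi 0)) := by
    refine tendsto_nhdsWithin_iff.2 ⟨?_, ?_⟩
    · have := (Real.continuous_sqrt.tendsto 0).mono_left (nhdsWithin_le_nhds (s := Ioi 0))
      simpa using this
    · filter_upwards [self_mem_nhdsWithin] with t ht using Real.sqrt_pos.2 ht
  have hi := (tendsto_inv_nhdsGT_zero.comp hs).const_mul_atTop (half_pos hk)
  have h0 : Filter.Tendsto (fun t : ℝ => x * √t) (nhdsWithin 0 (Ioi 0)) (nhds 0) := by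
    simpa using (hs.mono_right nhdsWithin_le_nhds).const_mul x
  have hp := gaussPrimitive_tendsto_atTop.comp (h0.add_atTop hi)
  have hm := gaussPrimitive_tendsto_atBot.comp
    (h0.add_atBot (Filter.tendsto_neg_atTop_atBot.comp hi))
  refine (((hm.const_mul _).sub (hp.const_mul _)).const_mul _).congr fun t => ?_
  simp [levyPrimitive, sub_eq_add_neg]

theorem levyPrimitive_tendsto_atTop (k : ℝ) {x : ℝ} (hx : 0 < x) :
    Filter.Tendsto (levyPrimitive k x) Filter.atTop
      (nhds ((√Real.pi)⁻¹ * (Real.exp (-k * x) * (√Real.pi / 2)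
        - Real.exp (k * x) * (√Real.pi / 2)))) := by
  have hs := Real.tendsto_sqrt_atTop
  have hi : Filter.Tendsto (fun t : ℝ => k / 2 * (√t)⁻¹) Filter.atTop (nhds 0) := by
    simpa using (tendsto_inv_atTop_zero.comp hs).const_mul (k / 2)
  have h0 := hs.const_mul_atTop hx
  have hp := gaussPrimitive_tendsto_atTop.comp (h0.atTop_add hi)
  have hm := gaussPrimitive_tendsto_atTop.comp (h0.atTop_add hi.neg)
  refine (((hm.const_mul _).sub (hp.const_mul _)).const_mul _).congr fun t => ?_
  simp [levyPrimitive, sub_eq_add_neg]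

theorem levyDensity_nonneg {k t : ℝ} (hk : 0 ≤ k) (ht : 0 ≤ t) : 0 ≤ levyDensity k t := by
  have := Real.pi_pos
  unfold levyDensity
  positivity

/-- At both ends of the half-line the primitive has the same `exp (k x)` term, which cancels, and
opposite `exp (-k x)` terms, which add up. Since the integrand is nonnegative, the existence of the
limits already gives integrability. -/
theorem levyDensity_laplace {k x : ℝ} (hk : 0 < k) (hx : 0 < x) :
    IntegrableOn (fun t => levyDensity k t * Real.exp (-t * x ^ 2)) (Ioi 0) ∧
      ∫ t in Ioi (0 : ℝ), levyDensity k t * Real.exp (-t * x ^ 2) = Real.exp (-k * x) := by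
  classical
  set l₀ := (√Real.pi)⁻¹ * (Real.exp (-k * x) * (-(√Real.pi / 2))
        - Real.exp (k * x) * (√Real.pi / 2)) with hl₀
  -- At `t = 0` the primitive takes the junk value coming from `0⁻¹ = 0`; it is replaced there by
  -- the limit from the right.
  set g : ℝ → ℝ := Function.update (levyPrimitive k x) 0 l₀ with hg
  have hgc : ContinuousWithinAt g (Ici 0) 0 := by
    rw [hg, continuousWithinAt_update_same]
    rw [show Ici (0:ℝ) \ {0} = Ioi 0 by ext; simp [lt_iff_le_and_ne, eq_comm]]
    exact levyPrimitive_tendsto_nhdsGT hk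
  have hgd : ∀ t ∈ Ioi (0 : ℝ), HasDerivAt g (levyDensity k t * Real.exp (-t * x ^ 2)) t := by
    intro t ht
    refine (hasDerivAt_levyPrimitive k x ht).congr_of_eventuallyEq ?_
    filter_upwards [Ioi_mem_nhds (mem_Ioi.1 ht)] with s hs
    exact Function.update_of_ne (ne_of_gt hs) _ _
  have hpos : ∀ t ∈ Ioi (0 : ℝ), 0 ≤ levyDensity k t * Real.exp (-t * x ^ 2) := fun t ht =>
    mul_nonneg (levyDensity_nonneg hk.le (mem_Ioi.1 ht).le) (Real.exp_nonneg _)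
  have hlim : Filter.Tendsto g Filter.atTop
      (nhds ((√Real.pi)⁻¹ * (Real.exp (-k * x) * (√Real.pi / 2)
        - Real.exp (k * x) * (√Real.pi / 2)))) := by
    refine (levyPrimitive_tendsto_atTop k hx).congr' ?_
    filter_upwards [Filter.eventually_gt_atTop 0] with s hs
    exact (Function.update_of_ne (ne_of_gt hs) _ _).symm
  refine ⟨integrableOn_Ioi_deriv_of_nonneg hgc hgd hpos hlim, ?_⟩
  rw [integral_Ioi_of_hasDerivAt_of_nonneg hgc hgd hpos hlim, hg, Function.update_self, hl₀]
  have : 0 < √Real.pi := Real.sqrt_pos.2 Real.pi_pos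
  field_simp
  ring

/-! ### Laplace kernels given by series -/

/-- Termwise integration. The Lévy densities being nonnegative, the `L¹` norm of a term is exactly
`|a j| exp (-k j x)`, so summability of the transforms is all that is needed. -/
theorem isLaplaceKernel_tsum {a k : ℕ → ℝ} (hk : ∀ j, 0 < k j) {h φ : ℝ → ℝ}
    (hh : ∀ t, h t = ∑' j, a j * levyDensity (k j) t)
    (hs : ∀ x, 0 < x → Summable fun j => ‖a j‖ * Real.exp (-k j * x))
    (hφ : ∀ x, 0 < x → HasSum (fun j => a j * Real.exp (-k j * x)) (φ x)) :
    IsLaplaceKernel h φ := by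
  intro x hx
  have hint : ∀ j, Integrable (fun t => a j * (levyDensity (k j) t * Real.exp (-t * x ^ 2)))
      (volume.restrict (Ioi 0)) := fun j => (levyDensity_laplace (hk j) hx).1.const_mul _
  have hnorm : Summable fun j => ∫ t in Ioi (0 : ℝ),
      ‖a j * (levyDensity (k j) t * Real.exp (-t * x ^ 2))‖ := by
    refine (hs x hx).congr fun j => ?_
    rw [← (levyDensity_laplace (hk j) hx).2, ← integral_const_mul]
    refine setIntegral_congr_fun measurableSet_Ioi fun t ht => ?_
    rw [norm_mul, Real.norm_of_nonneg (mul_nonneg (levyDensity_nonneg (hk j).le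
      (mem_Ioi.1 ht).le) (Real.exp_nonneg _))]
  have heq : (fun t => ∑' j, a j * (levyDensity (k j) t * Real.exp (-t * x ^ 2)))
      = fun t => h t * Real.exp (-t * x ^ 2) := by
    ext t
    rw [hh, ← tsum_mul_right]
    exact tsum_congr fun j => by ring
  have h1 := integrable_tsum_of_summable_integral_norm hint hnorm
  have h2 := hasSum_integral_of_summable_integral_norm hint hnorm
  rw [heq] at h1 h2
  refine ⟨h1, (hφ x hx).unique ?_⟩
  refine h2.congr_fun fun j => ?_
  rw [integral_const_mul, (levyDensity_laplace (hk j) hx).2]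

theorem summable_exp_neg_mul {c : ℝ} (hc : 0 < c) :
    Summable fun j : ℕ => Real.exp (-((j : ℝ) + 1) * c) := by
  have h2 : Summable fun j : ℕ => Real.exp (-c) * Real.exp (-c) ^ j :=
    (summable_geometric_of_lt_one (Real.exp_nonneg _) (by simpa using hc)).mul_left _
  refine h2.congr fun j => ?_
  rw [← Real.exp_nat_mul, ← Real.exp_add]
  congr 1; ring

/-- The geometric series `∑ (-1)^j e^{-(j+1)x}` sums to the Fermi function; the index `j` stands for
`k = j + 1`. -/
theorem isLaplaceKernel_hf : IsLaplaceKernel hf fermi := by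
  refine isLaplaceKernel_tsum (a := fun j => (-1) ^ j) (k := fun j => (j : ℝ) + 1)
    (fun j => by positivity) (fun t => ?_) (fun x hx => ?_) (fun x hx => ?_)
  · rw [hf, ← tsum_mul_left]
    exact tsum_congr fun j => by rw [levyDensity]; ring
  · simpa using summable_exp_neg_mul hx
  · have h1 : ‖-Real.exp (-x)‖ < 1 := by simpa using hx
    have h := (hasSum_geometric_of_norm_lt_one h1).mul_left (Real.exp (-x))
    convert! h using 1
    · ext j
      rw [neg_pow (Real.exp (-x)), ← Real.exp_nat_mul, mul_left_comm, ← Real.exp_add]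
      congr 2; ring
    · have := Real.exp_pos x
      rw [fermi, Real.exp_neg, sub_neg_eq_add]; field_simp

theorem isLaplaceKernel_hb : IsLaplaceKernel hb bose := by
  refine isLaplaceKernel_tsum (a := fun j => 1) (k := fun j => (j : ℝ) + 1)
    (fun j => by positivity) (fun t => ?_) (fun x hx => ?_) (fun x hx => ?_)
  · rw [hb, ← tsum_mul_left]
    exact tsum_congr fun j => by rw [levyDensity]; ring
  · simpa using summable_exp_neg_mul hx
  · have h1 : ‖Real.exp (-x)‖ < 1 := by simpa using hx
    have h := (hasSum_geometric_of_norm_lt_one h1).mul_left (Real.exp (-x))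
    convert! h using 1
    · ext j
      rw [← Real.exp_nat_mul, one_mul, ← Real.exp_add]
      congr 1; ring
    · have h3 : 0 < Real.exp x - 1 := by simpa using hx
      have := Real.exp_pos x
      rw [bose, Real.exp_neg]; field_simp

theorem fermiBoseMean_eq {x : ℝ} (hx : 0 < x) :
    fermiBoseMean x = 1 / (2 * Real.sinh x) := by
  have h3 : 0 < Real.exp x - 1 := by simpa using hx
  have := Real.exp_pos x
  have h4 : Real.exp x ^ 2 - 1 ≠ 0 := by nlinarith
  rw [fermiBoseMean, bose, fermi, Real.sinh_eq, Real.exp_neg]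
  field_simp
  ring

/-- Here the series is `1 / (2 sinh x) = ∑ e^{-(2j+1)x}`: averaging the Fermi and Bose series keeps
the odd multiples of `x`. -/
theorem isLaplaceKernel_h0 : IsLaplaceKernel h0 fermiBoseMean := by
  refine isLaplaceKernel_tsum (a := fun j => 1) (k := fun j => 2 * (j : ℝ) + 1)
    (fun j => by positivity) (fun t => ?_) (fun x hx => ?_) (fun x hx => ?_)
  · rw [h0, ← tsum_mul_left]
    exact tsum_congr fun j => by rw [levyDensity]; ring
  · simp only [norm_one, one_mul]
    refine (summable_exp_neg_mul hx).of_nonneg_of_le (fun _ => Real.exp_nonneg _) fun j => ?_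
    refine Real.exp_le_exp.2 ?_
    have : (0 : ℝ) ≤ j := j.cast_nonneg
    nlinarith
  · have h1 : ‖Real.exp (-(2 * x))‖ < 1 := by simpa using hx
    have h := (hasSum_geometric_of_norm_lt_one h1).mul_left (Real.exp (-x))
    convert! h using 1
    · ext j
      rw [← Real.exp_nat_mul, one_mul, ← Real.exp_add]
      congr 1; ring
    · have h3 : 0 < Real.exp x - 1 := by simpa using hx
      have := Real.exp_pos x
      have h4 : Real.exp x ^ 2 - 1 ≠ 0 := by nlinarith
      rw [fermiBoseMean_eq hx, Real.sinh_eq, two_mul x, Real.exp_neg, Real.exp_neg, Real.exp_add]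
      field_simp

theorem hb_nonneg {t : ℝ} (ht : 0 ≤ t) : 0 ≤ hb t := by
  have := Real.pi_pos
  exact mul_nonneg (by positivity) (tsum_nonneg fun j => by positivity)

theorem h0_nonneg {t : ℝ} (ht : 0 ≤ t) : 0 ≤ h0 t := by
  have := Real.pi_pos
  exact mul_nonneg (by positivity) (tsum_nonneg fun j => by positivity)

/-- The series of `hf` alternates. This majorant supplies the absolute convergence needed for
Fubini, at the price of replacing the Fermi by the Bose function. -/
theorem abs_hf_le_hb {t : ℝ} (ht : 0 < t) : |hf t| ≤ hb t := by
  have hp := Real.pi_pos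
  rw [hf, hb, abs_mul, abs_of_nonneg (by positivity)]
  refine mul_le_mul_of_nonneg_left ?_ (by positivity)
  have hs : Summable fun j : ℕ => ((j : ℝ) + 1) * Real.exp (-((j : ℝ) + 1) ^ 2 / (4 * t)) := by
    have h := (Real.summable_pow_mul_exp_neg_nat_mul 1 (r := 1 / (4 * t)) (by positivity))
    refine ((summable_nat_add_iff 1).2 h).of_nonneg_of_le (fun _ => by positivity) fun j => ?_
    push_cast
    rw [pow_one]
    refine mul_le_mul_of_nonneg_left (Real.exp_le_exp.2 ?_) (by positivity)
    rw [neg_div, neg_mul, neg_le_neg_iff, one_div, inv_mul_eq_div]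
    gcongr
    nlinarith [(j.cast_nonneg : (0 : ℝ) ≤ j)]
  have habs : ∀ j : ℕ, ‖(-1) ^ j * ((j : ℝ) + 1) * Real.exp (-((j : ℝ) + 1) ^ 2 / (4 * t))‖
      = ((j : ℝ) + 1) * Real.exp (-((j : ℝ) + 1) ^ 2 / (4 * t)) := by
    intro j
    rw [norm_mul, norm_mul, norm_pow, norm_neg, norm_one, one_pow, one_mul,
      Real.norm_of_nonneg (by positivity), Real.norm_of_nonneg (by positivity)]
  rw [← Real.norm_eq_abs]
  refine (norm_tsum_le_tsum_norm (by simpa only [habs] using hs)).trans_eq ?_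
  exact tsum_congr habs

section Hilbert

variable {E : Type*} [NormedAddCommGroup E] [InnerProductSpace ℝ E] [CompleteSpace E]

/-! ### Sums of rank one operators and traces -/

/-- Cauchy–Schwarz and Bessel's inequality on finite sets of indices. -/
theorem summable_abs_inner_mul_inner {ι : Type*} {b : ι → E} (hb : Orthonormal ℝ b) (x y : E) :
    Summable (fun i => |⟪x, b i⟫_ℝ * ⟪b i, y⟫_ℝ|) ∧
      ∑' i, |⟪x, b i⟫_ℝ * ⟪b i, y⟫_ℝ| ≤ ‖x‖ * ‖y‖ := by
  have h : ∀ s : Finset ι, ∑ i ∈ s, |⟪x, b i⟫_ℝ * ⟪b i, y⟫_ℝ| ≤ ‖x‖ * ‖y‖ := by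
    intro s
    have hb' : ∀ z : E, √(∑ i ∈ s, |⟪b i, z⟫_ℝ| ^ 2) ≤ ‖z‖ := fun z =>
      Real.sqrt_le_iff.2 ⟨norm_nonneg _, by
        simpa using hb.sum_inner_products_le (s := s) z⟩
    calc ∑ i ∈ s, |⟪x, b i⟫_ℝ * ⟪b i, y⟫_ℝ|
        = ∑ i ∈ s, |⟪b i, x⟫_ℝ| * |⟪b i, y⟫_ℝ| := by
          refine Finset.sum_congr rfl fun i _ => ?_
          rw [abs_mul, real_inner_comm]
      _ ≤ √(∑ i ∈ s, |⟪b i, x⟫_ℝ| ^ 2) * √(∑ i ∈ s, |⟪b i, y⟫_ℝ| ^ 2) :=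
          Real.sum_mul_le_sqrt_mul_sqrt _ _ _
      _ ≤ ‖x‖ * ‖y‖ := mul_le_mul (hb' x) (hb' y) (Real.sqrt_nonneg _) (norm_nonneg _)
  have hs := summable_of_sum_le (fun i => abs_nonneg _) h
  exact ⟨hs, hs.tsum_le_of_sum_le h⟩

theorem summable_inner_smul {κ : Type*} {x y : κ → E}
    (hxy : Summable fun k => ‖x k‖ * ‖y k‖) (u : E) : Summable fun k => ⟪x k, u⟫_ℝ • y k := by
  refine Summable.of_norm_bounded (hxy.mul_right ‖u‖) fun k => ?_
  rw [norm_smul]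
  calc ‖⟪x k, u⟫_ℝ‖ * ‖y k‖ ≤ ‖x k‖ * ‖u‖ * ‖y k‖ := by gcongr; exact norm_inner_le_norm _ _
    _ = ‖x k‖ * ‖y k‖ * ‖u‖ := by ring

/-- The natural index sets below are sums and products of index sets of eigenbases; they are
embedded in `ℕ` and the families extended by zero. -/
theorem isTraceClass_of_countable {κ : Type*} [Countable κ] {x y : κ → E}
    (hxy : Summable fun k => ‖x k‖ * ‖y k‖) {T : E → E}
    (hT : ∀ u, T u = ∑' k, ⟪x k, u⟫_ℝ • y k) : IsTraceClass T := by
  obtain ⟨g, hg⟩ := exists_injective_nat κ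
  refine ⟨Function.extend g x 0, Function.extend g y 0, ?_, fun u => ?_⟩
  · rw [← hg.summable_iff]
    · simpa [Function.comp_def, hg.extend_apply] using hxy
    · intro k hk
      simp [Function.extend_apply' _ _ _ hk]
  · rw [hT, ← hg.tsum_eq (f := fun k => ⟪Function.extend g x 0 k, u⟫_ℝ • Function.extend g y 0 k)]
    · simp [hg.extend_apply]
    · intro k hk
      by_contra hk'
      exact hk (by simp [Function.extend_apply' _ _ _ hk'])

/-- Fubini for the double sum of `⟨x k, b i⟩ ⟨b i, y k⟩`, then Parseval in `i`. In particular the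
trace does not depend on the chosen basis. -/
theorem opTrace_eq_tsum {κ : Type*} {x y : κ → E}
    (hxy : Summable fun k => ‖x k‖ * ‖y k‖) {T : E → E}
    (hT : ∀ u, T u = ∑' k, ⟪x k, u⟫_ℝ • y k) : opTrace T = ∑' k, ⟪x k, y k⟫_ℝ := by
  set b := (exists_hilbertBasis ℝ E).choose_spec.choose
  have h1 : ∀ i, ⟪b i, T (b i)⟫_ℝ = ∑' k, ⟪x k, b i⟫_ℝ * ⟪b i, y k⟫_ℝ := by
    intro i
    have hs := summable_inner_smul hxy (b i)
    rw [hT, ← innerSL_apply_apply ℝ, (innerSL ℝ (b i)).map_tsum hs]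
    simp
  have hsum : Summable (Function.uncurry fun k i => ⟪x k, b i⟫_ℝ * ⟪b i, y k⟫_ℝ) := by
    refine Summable.of_norm ?_
    refine (summable_prod_of_nonneg fun _ => norm_nonneg _).2 ⟨fun k => ?_, ?_⟩
    · simpa using! (summable_abs_inner_mul_inner b.orthonormal (x k) (y k)).1
    · refine hxy.of_nonneg_of_le (fun k => tsum_nonneg fun _ => norm_nonneg _) fun k => ?_
      exact (summable_abs_inner_mul_inner b.orthonormal (x k) (y k)).2
  calc opTrace T = ∑' i, ⟪b i, T (b i)⟫_ℝ := rfl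
    _ = ∑' i, ∑' k, ⟪x k, b i⟫_ℝ * ⟪b i, y k⟫_ℝ := tsum_congr h1
    _ = ∑' k, ∑' i, ⟪x k, b i⟫_ℝ * ⟪b i, y k⟫_ℝ := hsum.tsum_comm
    _ = ∑' k, ⟪x k, y k⟫_ℝ := tsum_congr fun k => (b.hasSum_inner_mul_inner (x k) (y k)).tsum_eq

/-- The operator `∑ a_k ⟨v_k, ·⟩ v_k`. -/
def rankOneSum {κ : Type*} (v : κ → E) (a : κ → ℝ) : E → E :=
  fun u => ∑' k, (a k * ⟪v k, u⟫_ℝ) • v k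

theorem summable_norm_smul_mul_norm {κ : Type*} {v : κ → E} (hv : ∀ k, ‖v k‖ ≤ 1) {a : κ → ℝ}
    (ha : Summable fun k => |a k|) : Summable fun k => ‖a k • v k‖ * ‖v k‖ := by
  refine ha.of_nonneg_of_le (fun _ => by positivity) fun k => ?_
  rw [norm_smul, Real.norm_eq_abs, mul_assoc]
  exact mul_le_of_le_one_right (abs_nonneg _)
    (mul_le_one₀ (hv k) (norm_nonneg _) (hv k))

theorem summable_rankOneSum {κ : Type*} {v : κ → E} (hv : ∀ k, ‖v k‖ ≤ 1) {a : κ → ℝ}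
    (ha : Summable fun k => |a k|) (u : E) : Summable fun k => (a k * ⟪v k, u⟫_ℝ) • v k := by
  simpa [inner_smul_left] using summable_inner_smul (summable_norm_smul_mul_norm hv ha) u

theorem inner_rankOneSum {κ : Type*} {v : κ → E} (hv : ∀ k, ‖v k‖ ≤ 1) {a : κ → ℝ}
    (ha : Summable fun k => |a k|) (u w : E) :
    ⟪w, rankOneSum v a u⟫_ℝ = ∑' k, a k * ⟪v k, u⟫_ℝ * ⟪w, v k⟫_ℝ := by
  rw [rankOneSum, ← innerSL_apply_apply ℝ, (innerSL ℝ w).map_tsum (summable_rankOneSum hv ha u)]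
  simp

theorem norm_rankOneSum_le {κ : Type*} {v : κ → E} (hv : ∀ k, ‖v k‖ ≤ 1) {a : κ → ℝ}
    (ha : Summable fun k => |a k|) (u : E) : ‖rankOneSum v a u‖ ≤ (∑' k, |a k|) * ‖u‖ := by
  rw [← tsum_mul_right]
  refine tsum_of_norm_bounded (ha.mul_right _).hasSum fun k => ?_
  rw [norm_smul, norm_mul, mul_assoc, Real.norm_eq_abs]
  refine mul_le_mul_of_nonneg_left ?_ (abs_nonneg _)
  calc ‖⟪v k, u⟫_ℝ‖ * ‖v k‖ ≤ (‖v k‖ * ‖u‖) * ‖v k‖ := by gcongr; exact norm_inner_le_norm _ _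
    _ ≤ (1 * ‖u‖) * 1 := by gcongr <;> exact hv k
    _ = ‖u‖ := by ring

/-- The inner sum is a symmetric operator, so it can be moved onto `v k`. This presents the product
with one rank one term for each index of the outer sum. -/
theorem rankOneSum_comp_eq {κ : Type*} {v : κ → E} (hv : ∀ k, ‖v k‖ ≤ 1) {a c : κ → ℝ}
    (hc : Summable fun k => |c k|) (u : E) :
    (rankOneSum v a ∘ rankOneSum v c) u = ∑' k, ⟪a k • rankOneSum v c (v k), u⟫_ℝ • v k := by
  refine tsum_congr fun k => ?_
  rw [real_inner_smul_left, inner_rankOneSum hv hc, real_inner_comm, inner_rankOneSum hv hc]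
  congr 2
  exact tsum_congr fun l => by rw [real_inner_comm (v k) (v l), real_inner_comm u (v l)]; ring

theorem summable_rankOneSum_comp {κ : Type*} {v : κ → E} (hv : ∀ k, ‖v k‖ ≤ 1) {a c : κ → ℝ}
    (ha : Summable fun k => |a k|) (hc : Summable fun k => |c k|) :
    Summable fun k => ‖a k • rankOneSum v c (v k)‖ * ‖v k‖ := by
  refine (ha.mul_right (∑' k, |c k|)).of_nonneg_of_le (fun _ => by positivity) fun k => ?_
  rw [norm_smul, Real.norm_eq_abs, mul_assoc]
  refine mul_le_mul_of_nonneg_left ?_ (abs_nonneg _)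
  have h0 : 0 ≤ ∑' k, |c k| := tsum_nonneg fun _ => abs_nonneg _
  calc ‖rankOneSum v c (v k)‖ * ‖v k‖ ≤ ((∑' k, |c k|) * ‖v k‖) * ‖v k‖ := by
        gcongr; exact norm_rankOneSum_le hv hc _
    _ ≤ ((∑' k, |c k|) * 1) * 1 := by gcongr <;> exact hv k
    _ = _ := by ring

theorem isTraceClass_rankOneSum_comp {κ : Type*} [Countable κ] {v : κ → E} (hv : ∀ k, ‖v k‖ ≤ 1)
    {a c : κ → ℝ} (ha : Summable fun k => |a k|) (hc : Summable fun k => |c k|) :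
    IsTraceClass (rankOneSum v a ∘ rankOneSum v c) :=
  isTraceClass_of_countable (summable_rankOneSum_comp hv ha hc) (rankOneSum_comp_eq hv hc)

theorem summable_mul_mul_inner_sq {κ : Type*} {v : κ → E} (hv : ∀ k, ‖v k‖ ≤ 1)
    {a c : κ → ℝ} (ha : Summable fun k => |a k|) (hc : Summable fun k => |c k|) :
    Summable fun p : κ × κ => a p.1 * c p.2 * ⟪v p.1, v p.2⟫_ℝ ^ 2 := by
  refine Summable.of_norm_bounded (ha.mul_of_nonneg hc (fun _ => abs_nonneg _)
    fun _ => abs_nonneg _) fun p => ?_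
  rw [norm_mul, norm_mul, Real.norm_eq_abs, Real.norm_eq_abs]
  refine mul_le_of_le_one_right (by positivity) ?_
  rw [norm_pow]
  refine pow_le_one₀ (norm_nonneg _) ((norm_inner_le_norm _ _).trans ?_)
  exact mul_le_one₀ (hv _) (norm_nonneg _) (hv _)

/-- Every trace in the theorem is evaluated by this formula. The vectors need not be orthogonal,
since two unrelated eigenbases will be merged into one family. -/
theorem opTrace_rankOneSum_comp {κ : Type*} {v : κ → E} (hv : ∀ k, ‖v k‖ ≤ 1)
    {a c : κ → ℝ} (ha : Summable fun k => |a k|) (hc : Summable fun k => |c k|) :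
    opTrace (rankOneSum v a ∘ rankOneSum v c)
      = ∑' p : κ × κ, a p.1 * c p.2 * ⟪v p.1, v p.2⟫_ℝ ^ 2 := by
  rw [opTrace_eq_tsum (summable_rankOneSum_comp hv ha hc) (rankOneSum_comp_eq hv hc),
    (summable_mul_mul_inner_sq hv ha hc).tsum_prod]
  refine tsum_congr fun k => ?_
  rw [real_inner_smul_left, real_inner_comm, inner_rankOneSum hv hc, ← tsum_mul_left]
  refine tsum_congr fun l => ?_
  rw [real_inner_comm (v k) (v l)]
  ring

theorem rankOneSum_sumElim {ι κ : Type*} {v : ι → E} {w : κ → E} (hv : ∀ k, ‖v k‖ ≤ 1)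
    (hw : ∀ k, ‖w k‖ ≤ 1) {a : ι → ℝ} {c : κ → ℝ} (ha : Summable fun k => |a k|)
    (hc : Summable fun k => |c k|) :
    rankOneSum (Sum.elim v w) (Sum.elim a fun k => -c k)
      = rankOneSum v a - rankOneSum w c := by
  ext u
  simp only [rankOneSum, Pi.sub_apply]
  have h1 := summable_rankOneSum hv ha u
  have h2 := summable_rankOneSum hw (a := fun k => -c k) (by simpa using hc) u
  rw [Summable.tsum_sum (by exact h1) (by exact h2), sub_eq_add_neg, ← tsum_neg]
  simp

/-! ### Operators with an orthonormal basis of eigenvectors -/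

/-- `T` is symmetric and `b` is a Hilbert basis of eigenvectors with eigenvalues `l`. -/
structure IsEigenbasis {ι : Type*} (T : E →ₗ.[ℝ] E) (b : HilbertBasis ι ℝ E) (l : ι → ℝ) :
    Prop where
  symm : ∀ x y : T.domain, ⟪T x, (y : E)⟫_ℝ = ⟪(x : E), T y⟫_ℝ
  mem : ∀ i, (b i, l i • b i) ∈ T.graph

variable {ι : Type*}

theorem summable_diag (b : HilbertBasis ι ℝ E) {c : ι → ℝ} {C : ℝ} (hc : ∀ i, |c i| ≤ C) (u : E) :
    Summable fun i => (c i * ⟪b i, u⟫_ℝ) • b i := by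
  have hm : Memℓp (fun i => c i * ⟪b i, u⟫_ℝ) 2 := by
    rw [memℓp_gen_iff (by norm_num)]
    have h0 := (memℓp_gen_iff (p := 2) (by norm_num)).1 (lp.memℓp (b.repr u))
    refine (h0.mul_left (C ^ 2)).of_nonneg_of_le (fun _ => by positivity) fun i => ?_
    simp only [ENNReal.toReal_ofNat, Real.rpow_ofNat, HilbertBasis.repr_apply_apply]
    rw [norm_mul, mul_pow, Real.norm_eq_abs]
    gcongr
    exact hc i
  exact (b.hasSum_repr_symm ⟨_, hm⟩).summable

theorem inner_diag (b : HilbertBasis ι ℝ E) {c : ι → ℝ} {C : ℝ} (hc : ∀ i, |c i| ≤ C) (u : E)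
    (j : ι) : ⟪b j, rankOneSum b c u⟫_ℝ = c j * ⟪b j, u⟫_ℝ := by
  classical
  rw [rankOneSum, ← innerSL_apply_apply ℝ, (innerSL ℝ (b j)).map_tsum (summable_diag b hc u)]
  simp only [innerSL_apply_apply, inner_smul_right]
  rw [tsum_eq_single j]
  · simp [b.orthonormal.1 j]
  · intro i hi
    rw [b.orthonormal.2 hi.symm, mul_zero]

theorem mem_eigenspace {T : E →ₗ.[ℝ] E} {l : ℝ} {u : E} :
    u ∈ eigenspace T l ↔ (u, l • u) ∈ T.graph := by
  simp [eigenspace]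

theorem IsEigenbasis.inner_eq_zero {T : E →ₗ.[ℝ] E} {b : HilbertBasis ι ℝ E} {l : ι → ℝ}
    (h : IsEigenbasis T b l) {i : ι} {c : ℝ} (hi : l i ≠ c) {u : E} (hu : u ∈ eigenspace T c) :
    ⟪b i, u⟫_ℝ = 0 := by
  obtain ⟨x, hx, hx'⟩ := (T.mem_graph_iff).1 (mem_eigenspace.1 hu)
  obtain ⟨y, hy, hy'⟩ := (T.mem_graph_iff).1 (h.mem i)
  have := h.symm y x
  rw [hx', hy', hx, hy] at this
  simp only [real_inner_smul_left, real_inner_smul_right] at this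
  have h2 : (l i - c) * ⟪b i, u⟫_ℝ = 0 := by linarith
  exact (mul_eq_zero.1 h2).resolve_left (sub_ne_zero.2 hi)

-- The remainder `u - ∑` is orthogonal to the basis vectors of eigenvalue `c`. By symmetry of `T` an
-- eigenvector for `c` has no component along the other basis vectors, and this persists on the
-- closure of the eigenspace.
open Classical in
theorem IsEigenbasis.spectralProj_eq {T : E →ₗ.[ℝ] E} {b : HilbertBasis ι ℝ E} {l : ι → ℝ}
    (h : IsEigenbasis T b l) (c : ℝ) (u : E) :
    spectralProj T c u = rankOneSum b (fun i => if l i = c then 1 else 0) u := by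
  have hb : ∀ i, |(if l i = c then (1 : ℝ) else 0)| ≤ 1 := fun i => by split_ifs <;> simp
  refine Submodule.eq_starProjection_of_mem_of_inner_eq_zero ?_ ?_
  · refine (eigenspace T c).isClosed_topologicalClosure.mem_of_tendsto
      (summable_diag b hb u).hasSum (Filter.Eventually.of_forall fun s => ?_)
    refine Submodule.sum_mem _ fun i _ => ?_
    by_cases hi : l i = c
    · refine Submodule.smul_mem _ _ (Submodule.le_topologicalClosure _ (mem_eigenspace.2 ?_))
      exact hi ▸ h.mem i
    · simp [hi]
  · intro w hw
    have hw0 : ∀ i, l i ≠ c → ⟪b i, w⟫_ℝ = 0 := by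
      intro i hi
      have hcl : IsClosed {w : E | ⟪b i, w⟫_ℝ = 0} :=
        isClosed_eq (by fun_prop) continuous_const
      exact closure_minimal (fun w hw => h.inner_eq_zero hi hw) hcl hw
    rw [← b.tsum_inner_mul_inner]
    refine (tsum_congr fun i => ?_).trans tsum_zero
    by_cases hi : l i = c
    · rw [real_inner_comm, inner_sub_right, inner_diag b hb, if_pos hi]
      simp
    · rw [hw0 i hi, mul_zero]

/-- The eigenbasis expansion converges unconditionally, so it may be grouped along the fibres of
`l`; each fibre gives one spectral projection. -/
theorem IsEigenbasis.opFun_eq {T : E →ₗ.[ℝ] E} {b : HilbertBasis ι ℝ E} {l : ι → ℝ}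
    (h : IsEigenbasis T b l) {φ : ℝ → ℝ} {C : ℝ} (hφ : ∀ i, |φ (l i)| ≤ C) :
    opFun T φ = rankOneSum b (fun i => φ (l i)) := by
  classical
  ext u
  have hs := (summable_diag b hφ u).hasSum
  rw [← (Equiv.sigmaFiberEquiv l).hasSum_iff] at hs
  have hs2 := hs.tsum_eq.symm.trans hs.summable.tsum_sigma
  rw [opFun, show rankOneSum b (fun i => φ (l i)) u = _ from hs2]
  refine tsum_congr fun c => ?_
  rw [h.spectralProj_eq, rankOneSum, ← tsum_const_smul'']
  have hsub := tsum_subtype {i | l i = c} (fun i => (φ (l i) * ⟪b i, u⟫_ℝ) • b i)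
  refine Eq.trans ?_ (Eq.trans hsub.symm ?_)
  · refine tsum_congr fun i => ?_
    by_cases hi : l i = c
    · rw [indicator_of_mem (by exact hi), if_pos hi, one_mul, smul_smul, hi]
    · rw [indicator_of_notMem (by exact hi), if_neg hi, zero_mul, zero_smul, smul_zero]
  · rfl

end Hilbert

section Hilbert

universe u

variable {E : Type u} [NormedAddCommGroup E] [InnerProductSpace ℝ E] [CompleteSpace E]

/-! ### Self-adjoint operators whose domain is compactly included -/

theorem isSelfAdjoint_inner_graph {T : E →ₗ.[ℝ] E} (hT : IsSelfAdjoint T) {x x' y y' : E}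
    (hx : (x, x') ∈ T.graph) (hy : (y, y') ∈ T.graph) : ⟪x', y⟫_ℝ = ⟪x, y'⟫_ℝ := by
  obtain ⟨u, rfl, rfl⟩ := T.mem_graph_iff.1 hx
  obtain ⟨v, rfl, rfl⟩ := T.mem_graph_iff.1 hy
  have h := LinearPMap.adjoint_isFormalAdjoint hT.dense_domain
  rw [LinearPMap.isSelfAdjoint_def.1 hT] at h
  exact h u v

theorem isSelfAdjoint_mem_graph {T : E →ₗ.[ℝ] E} (hT : IsSelfAdjoint T) {y w : E}
    (h : ∀ v v', (v, v') ∈ T.graph → ⟪w, v⟫_ℝ = ⟪y, v'⟫_ℝ) : (y, w) ∈ T.graph := by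
  have h1 : ∀ x : T.domain, ⟪w, (x : E)⟫_ℝ = ⟪y, T x⟫_ℝ := fun x => h _ _ (T.mem_graph x)
  have hy := T.mem_adjoint_domain_of_exists y ⟨w, h1⟩
  have h2 : T.adjoint ⟨y, hy⟩ = w := LinearPMap.adjoint_apply_eq hT.dense_domain ⟨y, hy⟩ h1
  have h3 := T.adjoint.mem_graph ⟨y, hy⟩
  rw [h2] at h3
  have h4 : T.adjoint = T := hT
  exact LinearPMap.le_graph_of_le h4.le h3

/-- Von Neumann's argument: project `(f, 0)` orthogonally to the closed graph and call the result
`(R f, S f)`. Orthogonality of `(f - R f, -S f)` to the graph says, by self-adjointness, that `T S f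
= f - R f`. Thus `R = (1 + T²)⁻¹` and `S = T R`. -/
theorem exists_inverse_one_add_sq {T : E →ₗ.[ℝ] E} (hT : IsSelfAdjoint T) :
    ∃ R S : E →L[ℝ] E, ∀ f, (R f, S f) ∈ T.graph ∧ (S f, f - R f) ∈ T.graph := by
  let φ : WithLp 2 (E × E) ≃L[ℝ] E × E := WithLp.prodContinuousLinearEquiv 2 ℝ E E
  let G : Submodule ℝ (WithLp 2 (E × E)) := T.graph.comap φ.toLinearMap
  have hG : IsClosed (G : Set (WithLp 2 (E × E))) := hT.isClosed.preimage φ.continuous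
  have : CompleteSpace G := hG.completeSpace_coe
  let Q : E →L[ℝ] E × E :=
    φ.toContinuousLinearMap ∘L G.starProjection ∘L φ.symm.toContinuousLinearMap ∘L
      ContinuousLinearMap.inl ℝ E E
  refine ⟨ContinuousLinearMap.fst ℝ E E ∘L Q, ContinuousLinearMap.snd ℝ E E ∘L Q, fun f => ?_⟩
  have h1 : Q f ∈ T.graph := by
    have := G.starProjection_apply_mem (φ.symm (f, 0))
    exact this
  refine ⟨h1, isSelfAdjoint_mem_graph hT fun v v' hv => ?_⟩
  have h2 := G.starProjection_inner_eq_zero (φ.symm (f, 0)) (φ.symm (v, v')) (by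
    change φ (φ.symm (v, v')) ∈ T.graph
    simpa using hv)
  have h3 : ⟪f - (Q f).1, v⟫_ℝ + ⟪0 - (Q f).2, v'⟫_ℝ = 0 := h2
  simp only [zero_sub, inner_neg_left] at h3
  exact sub_eq_zero.1 (by simpa [sub_eq_add_neg] using h3)

/-- The unit ball of the graph norm of `T` can be discretized by `O(N ^ p)` functionals with an
error `O(1 / N)`. -/
def IsDiscretizable (T : E →ₗ.[ℝ] E) (p : ℕ) : Prop :=
  ∃ C : ℝ, 0 ≤ C ∧ ∀ N : ℕ, 0 < N → ∃ (K : ℕ) (f : Fin K → E →L[ℝ] ℝ) (D : ℝ), K ≤ C * N ^ p ∧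
    ∀ x x', (x, x') ∈ T.graph →
      ‖x‖ ^ 2 ≤ D * ∑ k, f k x ^ 2 + C / N ^ 2 * (‖x'‖ ^ 2 + ‖x‖ ^ 2)

section Resolvent

variable {T : E →ₗ.[ℝ] E} {R S : E →L[ℝ] E}

theorem norm_sq_add_le (hT : IsSelfAdjoint T)
    (hRS : ∀ f, (R f, S f) ∈ T.graph ∧ (S f, f - R f) ∈ T.graph) (f : E) :
    ‖S f‖ ^ 2 + ‖R f‖ ^ 2 ≤ ‖f‖ ^ 2 := by
  have h := isSelfAdjoint_inner_graph hT (hRS f).1 (hRS f).2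
  rw [real_inner_self_eq_norm_sq, inner_sub_right, real_inner_self_eq_norm_sq] at h
  have h2 := real_inner_le_norm (R f) f
  nlinarith [sq_nonneg (‖R f‖ - ‖f‖), sq_nonneg ‖S f‖]

theorem isSymmetric_of_inverse (hT : IsSelfAdjoint T)
    (hRS : ∀ f, (R f, S f) ∈ T.graph ∧ (S f, f - R f) ∈ T.graph) :
    (R : E →ₗ[ℝ] E).IsSymmetric := by
  intro f g
  have h1 := isSelfAdjoint_inner_graph hT (hRS f).1 (hRS g).2
  have h2 := isSelfAdjoint_inner_graph hT (hRS g).1 (hRS f).2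
  rw [inner_sub_right] at h1 h2
  have h3 := real_inner_comm (S f) (S g)
  have h4 := real_inner_comm (R f) (R g)
  have h5 := real_inner_comm f (R g)
  change ⟪R f, g⟫_ℝ = ⟪f, R g⟫_ℝ
  linarith

/-- `R` is a norm limit of the finite rank operators `R P`, where `P` projects to the span of the
Riesz vectors of the functionals `f k ∘ R`. If `z` is orthogonal to this span, the functionals
vanish at `R z`, and the discretization bounds `‖R z‖²` by `C / N² * ‖z‖²`. -/
theorem isCompactOperator_of_inverse (hT : IsSelfAdjoint T) {p : ℕ} (hd : IsDiscretizable T p)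
    (hRS : ∀ f, (R f, S f) ∈ T.graph ∧ (S f, f - R f) ∈ T.graph) : IsCompactOperator R := by
  obtain ⟨C, hC, hd⟩ := hd
  have key : ∀ N : ℕ, ∃ Q : E →L[ℝ] E, IsCompactOperator Q ∧ ‖R - Q‖ ≤ √C / (N + 1 : ℕ) := by
    intro N
    obtain ⟨K, f, D, -, hf⟩ := hd (N + 1) N.succ_pos
    let w : Fin K → E := fun k => (InnerProductSpace.toDual ℝ E).symm (f k ∘L R)
    have hw : ∀ k u, ⟪w k, u⟫_ℝ = f k (R u) := fun k u => by
      simp [w]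
    let W : Submodule ℝ E := Submodule.span ℝ (range w)
    have : FiniteDimensional ℝ W := FiniteDimensional.span_of_finite ℝ (finite_range w)
    refine ⟨R ∘L W.starProjection, ?_, ?_⟩
    · have h1 : IsCompactOperator (_root_.id : W → W) :=
        isCompactOperator_id_iff_finiteDimensional (𝕜 := ℝ).2 inferInstance
      exact (h1.comp_clm W.orthogonalProjectionOnto).clm_comp (R ∘L W.subtypeL)
    · refine ContinuousLinearMap.opNorm_le_bound _ (by positivity) fun u => ?_
      set z := u - W.starProjection u with hz
      have hRz : (R - R ∘L W.starProjection) u = R z := by simp [hz]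
      have hzf : ∀ k, f k (R z) = 0 := fun k => by
        rw [← hw, real_inner_comm]
        exact W.starProjection_inner_eq_zero u (w k) (Submodule.subset_span (mem_range_self k))
      have hzu : ‖z‖ ≤ ‖u‖ := by
        have h := W.norm_sq_eq_add_norm_sq_projection u
        have h2 : ‖z‖ ^ 2 ≤ ‖u‖ ^ 2 := by
          have h3 : z = W.orthogonal.starProjection u := by
            rw [Submodule.starProjection_orthogonal_val]
          rw [h3]
          have := W.norm_sq_eq_add_norm_sq_starProjection u
          nlinarith [sq_nonneg ‖W.starProjection u‖]
        exact (sq_le_sq₀ (norm_nonneg _) (norm_nonneg _)).1 h2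
      have h := hf _ _ (hRS z).1
      simp only [hzf] at h
      have h2 : ‖R z‖ ^ 2 ≤ (√C / (N + 1 : ℕ) * ‖u‖) ^ 2 := by
        rw [mul_pow, div_pow, Real.sq_sqrt hC]
        refine h.trans ?_
        simp only [ne_eq, OfNat.ofNat_ne_zero, not_false_eq_true, zero_pow, Finset.sum_const_zero,
          mul_zero, zero_add]
        refine mul_le_mul_of_nonneg_left ?_ (by positivity)
        exact (norm_sq_add_le hT hRS z).trans (by gcongr)
      rw [hRz]
      exact (sq_le_sq₀ (norm_nonneg _) (by positivity)).1 h2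
  choose Q hQ hRQ using key
  refine isCompactOperator_of_tendsto (F := Q) (l := Filter.atTop) ?_ (Filter.Eventually.of_forall hQ)
  rw [tendsto_iff_norm_sub_tendsto_zero]
  refine squeeze_zero (fun _ => norm_nonneg _) (fun N => (norm_sub_rev _ _).trans_le (hRQ N)) ?_
  exact (tendsto_const_div_atTop_nhds_zero_nat √C).comp (Filter.tendsto_add_atTop_nat 1)

/-- If `R u = c u` then `T² u = a u` with `a = 1/c - 1 ≥ 0`. For `a > 0`, `u` is the half-sum of `u
± a^{-1/2} T u`, which lie in the eigenspaces for `±√a`; for `a = 0` one has `T u = 0`. No complex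
scalars are needed because `a` is nonnegative. -/
theorem eigenspace_inverse_le (hT : IsSelfAdjoint T)
    (hRS : ∀ f, (R f, S f) ∈ T.graph ∧ (S f, f - R f) ∈ T.graph) (c : ℝ) :
    Module.End.eigenspace (R : E →ₗ[ℝ] E) c ≤ ⨆ l, eigenspace T l := by
  intro u hu
  by_cases hu0 : u = 0
  · rw [hu0]; exact zero_mem _
  have hRu : R u = c • u := Module.End.mem_eigenspace_iff.1 hu
  obtain ⟨h1, h2⟩ := hRS u
  -- Nonnegativity of this square confines `c` to `[0, 1]`; the value `c = 0` is excluded because it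
  -- would force `u = T 0 = 0`.
  have hS : ⟪S u, S u⟫_ℝ = c * (1 - c) * ‖u‖ ^ 2 := by
    rw [isSelfAdjoint_inner_graph hT h1 h2, hRu, inner_smul_left, inner_sub_right,
      real_inner_smul_right, real_inner_self_eq_norm_sq]
    simp; ring
  have hu2 : 0 < ‖u‖ ^ 2 := by positivity
  have hc0 : c ≠ 0 := by
    rintro rfl
    have hS0 : S u = 0 := by rw [← inner_self_eq_zero (𝕜 := ℝ), hS]; simp
    rw [hS0, hRu, zero_smul, sub_zero] at h2
    exact hu0 (T.graph_fst_eq_zero_snd h2 rfl)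
  have hcpos : 0 < c := by
    rcases lt_or_gt_of_ne hc0 with h | h
    · have h3 : 0 ≤ c * (1 - c) * ‖u‖ ^ 2 := hS ▸ real_inner_self_nonneg
      have h4 : c * (1 - c) < 0 := mul_neg_of_neg_of_pos h (by linarith)
      nlinarith
    · exact h
  set a := c⁻¹ - 1 with ha
  have ha0 : 0 ≤ a := by
    have h3 : 0 ≤ c * (1 - c) * ‖u‖ ^ 2 := hS ▸ real_inner_self_nonneg
    have h4 : 0 ≤ c * (1 - c) := nonneg_of_mul_nonneg_left h3 hu2
    have h5 : 0 ≤ 1 - c := nonneg_of_mul_nonneg_right h4 hcpos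
    rw [ha, sub_nonneg]
    exact (one_le_inv₀ hcpos).2 (by linarith)
  -- `w = T u`
  set w := c⁻¹ • S u with hw
  have g1 : (u, w) ∈ T.graph := by
    have := T.graph.smul_mem c⁻¹ h1
    rwa [Prod.smul_mk, hRu, smul_smul, inv_mul_cancel₀ hc0, one_smul] at this
  have g2 : (w, a • u) ∈ T.graph := by
    have := T.graph.smul_mem c⁻¹ h2
    rw [Prod.smul_mk, hRu] at this
    convert! this using 2
    rw [smul_sub, smul_smul, inv_mul_cancel₀ hc0, ha, sub_smul]
  have haa : a = √a * √a := (Real.mul_self_sqrt ha0).symm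
  rcases eq_or_lt_of_le ha0 with h0 | hpos
  · have hw0 : w = 0 := by
      rw [← inner_self_eq_zero (𝕜 := ℝ), isSelfAdjoint_inner_graph hT g1 g2, ← h0]
      simp
    refine Submodule.mem_iSup_of_mem 0 (mem_eigenspace.2 ?_)
    rw [zero_smul]; rwa [hw0] at g1
  · have hs : 0 < √a := Real.sqrt_pos.2 hpos
    have hs1 : (√a)⁻¹ • a • u = √a • u := by
      rw [smul_smul]
      congr 1
      rw [inv_mul_eq_iff_eq_mul₀ hs.ne']
      exact haa
    have hs2 : √a • (√a)⁻¹ • w = w := smul_inv_smul₀ hs.ne' w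
    have e1 : u + (√a)⁻¹ • w ∈ eigenspace T √a := by
      rw [mem_eigenspace]
      have := T.graph.add_mem g1 (T.graph.smul_mem (√a)⁻¹ g2)
      rw [Prod.smul_mk, Prod.mk_add_mk] at this
      rw [hs1] at this
      convert! this using 2
      rw [smul_add, hs2, add_comm]
    have e2 : u - (√a)⁻¹ • w ∈ eigenspace T (-√a) := by
      rw [mem_eigenspace]
      have := T.graph.sub_mem g1 (T.graph.smul_mem (√a)⁻¹ g2)
      rw [Prod.smul_mk, Prod.mk_sub_mk] at this
      rw [hs1] at this
      convert! this using 2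
      rw [smul_sub, neg_smul, neg_smul, hs2, sub_neg_eq_add, neg_add_eq_sub]
    have e3 : u = (1 / 2 : ℝ) • (u + (√a)⁻¹ • w) + (1 / 2 : ℝ) • (u - (√a)⁻¹ • w) := by module
    rw [e3]
    exact Submodule.add_mem _ (Submodule.smul_mem _ _ (Submodule.mem_iSup_of_mem _ e1))
      (Submodule.smul_mem _ _ (Submodule.mem_iSup_of_mem _ e2))

end Resolvent

theorem iSup_eigenspace_orthogonal {T : E →ₗ.[ℝ] E} (hT : IsSelfAdjoint T) {p : ℕ}
    (hd : IsDiscretizable T p) : (⨆ l, eigenspace T l)ᗮ = ⊥ := by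
  obtain ⟨R, S, hRS⟩ := exists_inverse_one_add_sq hT
  have h := ContinuousLinearMap.orthogonalComplement_iSup_eigenspaces_eq_bot
    (isCompactOperator_of_inverse hT hd hRS) (isSymmetric_of_inverse hT hRS)
  rw [eq_bot_iff, ← h]
  exact Submodule.orthogonal_le (iSup_le fun c => eigenspace_inverse_le hT hRS c)

theorem isClosed_eigenspace {T : E →ₗ.[ℝ] E} (hT : IsSelfAdjoint T) (l : ℝ) :
    IsClosed (eigenspace T l : Set E) := by
  have hc : Continuous fun u : E => (u, l • u) := by fun_prop
  have := hT.isClosed.preimage hc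
  exact this

theorem inner_eigenspace_eq_zero {T : E →ₗ.[ℝ] E} (hT : IsSelfAdjoint T) {l c : ℝ} (h : l ≠ c)
    {u v : E} (hu : u ∈ eigenspace T l) (hv : v ∈ eigenspace T c) : ⟪u, v⟫_ℝ = 0 := by
  have := isSelfAdjoint_inner_graph hT (mem_eigenspace.1 hu) (mem_eigenspace.1 hv)
  rw [real_inner_smul_left, real_inner_smul_right] at this
  have h2 : (l - c) * ⟪u, v⟫_ℝ = 0 := by linarith
  exact (mul_eq_zero.1 h2).resolve_left (sub_ne_zero.2 h)

theorem exists_isEigenbasis {T : E →ₗ.[ℝ] E} (hT : IsSelfAdjoint T)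
    (hd : (⨆ l, eigenspace T l)ᗮ = ⊥) :
    ∃ (ι : Type u) (b : HilbertBasis ι ℝ E) (l : ι → ℝ), IsEigenbasis T b l := by
  have : ∀ l, CompleteSpace (eigenspace T l) := fun l => (isClosed_eigenspace hT l).completeSpace_coe
  have h1 : ∀ l, ∃ (w : Set (eigenspace T l)) (b : HilbertBasis w ℝ (eigenspace T l)),
      ⇑b = ((↑) : w → eigenspace T l) := fun l => exists_hilbertBasis ℝ (eigenspace T l)
  choose w b hb using h1
  have hfam : OrthogonalFamily ℝ (fun l => eigenspace T l)
      fun l => (eigenspace T l).subtypeₗᵢ :=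
    fun l c hlc u v => inner_eigenspace_eq_zero hT hlc u.2 v.2
  have hon := hfam.orthonormal_sigma_orthonormal fun l => (b l).orthonormal
  have hbot : (Submodule.span ℝ (range fun a : Σ l, w l =>
      (eigenspace T a.1).subtypeₗᵢ (b a.1 a.2)))ᗮ = ⊥ := by
    rw [eq_bot_iff, ← hd]
    intro x hx
    rw [Submodule.mem_orthogonal'] at hx ⊢
    intro y hy
    induction hy using Submodule.iSup_induction' with
    | mem l y hy =>
      have hs := ((b l).hasSum_repr ⟨y, hy⟩).mapL ((innerSL ℝ x) ∘L (eigenspace T l).subtypeL)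
      refine hs.unique ?_
      convert! hasSum_zero using 2 with i
      have h2 := hx _ (Submodule.subset_span (mem_range_self (⟨l, i⟩ : Σ l, w l)))
      simp only [map_smul, ContinuousLinearMap.comp_apply, innerSL_apply_apply]
      rw [show ⟪x, (eigenspace T l).subtypeL (b l i)⟫_ℝ = 0 from h2, smul_zero]
    | zero => simp
    | add y z _ _ hy hz => rw [inner_add_right, hy, hz, add_zero]
  refine ⟨Σ l, w l, HilbertBasis.mkOfOrthogonalEqBot hon hbot, fun a => a.1, ?_, fun a => ?_⟩
  · exact fun x y => isSelfAdjoint_inner_graph hT (T.mem_graph x) (T.mem_graph y)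
  · rw [HilbertBasis.coe_mkOfOrthogonalEqBot]
    exact mem_eigenspace.1 (b a.1 a.2).2

/-- With more than `K` eigenvectors, some nonzero combination is annihilated by all `K` functionals.
For it the estimate reads `‖u‖² ≤ δ (‖T u‖² + ‖u‖²)`, against the assumption on the eigenvalues. -/
theorem card_le_of_isEigenbasis {T : E →ₗ.[ℝ] E} {ι : Type*} {b : HilbertBasis ι ℝ E} {l : ι → ℝ}
    (h : IsEigenbasis T b l) {K : ℕ} {f : Fin K → E →L[ℝ] ℝ} {D δ : ℝ}
    (hf : ∀ x x', (x, x') ∈ T.graph →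
      ‖x‖ ^ 2 ≤ D * ∑ k, f k x ^ 2 + δ * (‖x'‖ ^ 2 + ‖x‖ ^ 2))
    (s : Finset ι) (hs : ∀ i ∈ s, δ * (l i ^ 2 + 1) < 1) : s.card ≤ K := by
  by_contra! hK
  let Φ : (s → ℝ) →ₗ[ℝ] (Fin K → ℝ) :=
    LinearMap.pi fun k => ∑ i : s, (f k (b i)) • LinearMap.proj i
  have hker : LinearMap.ker Φ ≠ ⊥ := LinearMap.ker_ne_bot_of_finrank_lt (by simpa using hK)
  obtain ⟨c, hc, hc0⟩ := Submodule.exists_mem_ne_zero_of_ne_bot hker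
  set u := ∑ i : s, c i • b i with hu
  set u' := ∑ i : s, (c i * l i) • b i with hu'
  have hg : (u, u') ∈ T.graph := by
    have : (u, u') = ∑ i : s, c i • ((b i, l i • b i) : E × E) := by
      simp [hu, hu', Prod.ext_iff, Prod.fst_sum, Prod.snd_sum, smul_smul]
    rw [this]
    exact Submodule.sum_mem _ fun i _ => Submodule.smul_mem _ _ (h.mem i)
  have hon : Orthonormal ℝ fun i : s => b i := b.orthonormal.comp _ Subtype.val_injective
  have hnorm : ∀ a : s → ℝ, ‖∑ i : s, a i • b i‖ ^ 2 = ∑ i, a i ^ 2 := by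
    intro a
    rw [← real_inner_self_eq_norm_sq, hon.inner_sum]
    simp [sq]
  have hfu : ∀ k, f k u = 0 := by
    intro k
    have := congrFun (LinearMap.mem_ker.1 hc) k
    rw [hu, map_sum]
    simpa [Φ, mul_comm] using this
  have h1 := hf u u' hg
  rw [hnorm, hnorm] at h1
  simp only [hfu] at h1
  obtain ⟨j, hj⟩ := Function.ne_iff.1 hc0
  have h2 : ∑ i : s, δ * (l i ^ 2 + 1) * c i ^ 2 < ∑ i : s, c i ^ 2 := by
    refine Finset.sum_lt_sum (fun i _ => ?_) ⟨j, Finset.mem_univ _, ?_⟩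
    · nlinarith [hs i i.2, sq_nonneg (c i)]
    · have : 0 < c j ^ 2 := by
        have h0 : c j ≠ 0 := hj
        positivity
      nlinarith [hs j j.2]
  have h3 : ∑ i : s, δ * (l i ^ 2 + 1) * c i ^ 2
      = δ * (∑ i : s, (c i * l i) ^ 2 + ∑ i : s, c i ^ 2) := by
    rw [← Finset.sum_add_distrib, Finset.mul_sum]
    exact Finset.sum_congr rfl fun i _ => by ring
  rw [← h3] at h1
  simp only [ne_eq, OfNat.ofNat_ne_zero, not_false_eq_true, zero_pow, Finset.sum_const_zero,
    mul_zero, zero_add] at h1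
  exact absurd h1 (not_le.2 h2)

/-- A weak Weyl law. The eigenvalues are sorted by an integer `n i` of order at most `1 + l i ^ 2`;
at most `C N^p` of them have `n i = N`, so `∑ (n i)^{-(p+2)}` is dominated by `∑ C / N²`. -/
theorem summable_eigenvalues {T : E →ₗ.[ℝ] E} {ι : Type*} {b : HilbertBasis ι ℝ E} {l : ι → ℝ}
    (h : IsEigenbasis T b l) {p : ℕ} (hd : IsDiscretizable T p) :
    Summable fun i => ((1 + l i ^ 2) ^ (p + 2))⁻¹ := by
  classical
  obtain ⟨C, hC, hd⟩ := hd
  -- Adding one to the floor makes `C (1 + l i ^ 2) < (n i) ^ 2` strict and `n i` positive.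
  let n : ι → ℕ := fun i => ⌊√(C * (1 + l i ^ 2))⌋₊ + 1
  have hn : ∀ i, C * (l i ^ 2 + 1) < (n i : ℝ) ^ 2 := by
    intro i
    have h1 : √(C * (1 + l i ^ 2)) < n i := by
      simpa [n] using Nat.lt_floor_add_one √(C * (1 + l i ^ 2))
    have h2 := (Real.sqrt_lt' (by positivity)).1 h1
    linarith
  have hcard : ∀ (s : Finset ι) (N : ℕ), 0 < N →
      ((s.filter fun i => n i = N).card : ℝ) ≤ C * N ^ p := by
    intro s N hN
    obtain ⟨K, f, D, hK, hf⟩ := hd N hN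
    refine le_trans (Nat.cast_le.2 (card_le_of_isEigenbasis h hf _ fun i hi => ?_)) hK
    rw [Finset.mem_filter] at hi
    have := hn i
    rw [hi.2] at this
    rw [div_mul_eq_mul_div, div_lt_one (by positivity)]
    exact this
  have hsum2 : Summable fun N : ℕ => C * ((N : ℝ) ^ 2)⁻¹ :=
    (Real.summable_nat_pow_inv.2 one_lt_two).mul_left C
  have hsn : Summable fun i => ((n i : ℝ) ^ (p + 2))⁻¹ := by
    refine summable_of_sum_le (c := ∑' N : ℕ, C * ((N : ℝ) ^ 2)⁻¹) (fun i => by positivity)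
      fun s => ?_
    calc ∑ i ∈ s, ((n i : ℝ) ^ (p + 2))⁻¹
        = ∑ N ∈ s.image n, ∑ i ∈ s.filter fun i => n i = N, ((n i : ℝ) ^ (p + 2))⁻¹ :=
          (Finset.sum_fiberwise_of_maps_to (fun i hi => Finset.mem_image_of_mem n hi) _).symm
      _ ≤ ∑ N ∈ s.image n, C * ((N : ℝ) ^ 2)⁻¹ := by
          refine Finset.sum_le_sum fun N hN => ?_
          obtain ⟨i₀, -, hi₀⟩ := Finset.mem_image.1 hN
          have hN0 : 0 < N := hi₀ ▸ Nat.succ_pos _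
          have hN0' : (0 : ℝ) < N := Nat.cast_pos.2 hN0
          rw [Finset.sum_congr rfl (g := fun _ => ((N : ℝ) ^ (p + 2))⁻¹)
            fun i hi => by rw [(Finset.mem_filter.1 hi).2], Finset.sum_const, nsmul_eq_mul]
          calc _ ≤ C * (N : ℝ) ^ p * ((N : ℝ) ^ (p + 2))⁻¹ := by gcongr; exact hcard s N hN0
            _ = C * ((N : ℝ) ^ 2)⁻¹ := by rw [pow_add]; field_simp
      _ ≤ ∑' N : ℕ, C * ((N : ℝ) ^ 2)⁻¹ := hsum2.sum_le_tsum _ fun _ _ => by positivity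
  refine (hsn.mul_left ((√C + 1) ^ (p + 2))).of_nonneg_of_le (fun _ => by positivity) fun i => ?_
  have h1 : (n i : ℝ) ≤ (√C + 1) * (1 + l i ^ 2) := by
    have h2 : (n i : ℝ) ≤ √(C * (1 + l i ^ 2)) + 1 := by
      simpa [n] using Nat.floor_le (Real.sqrt_nonneg (C * (1 + l i ^ 2)))
    have h3 : √(1 + l i ^ 2) ≤ 1 + l i ^ 2 := by
      rw [Real.sqrt_le_left (by positivity)]
      nlinarith [sq_nonneg (l i)]
    rw [Real.sqrt_mul hC] at h2
    nlinarith [Real.sqrt_nonneg C, sq_nonneg (l i)]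
  have hn0 : (0 : ℝ) < n i := by positivity
  rw [← div_eq_mul_inv, le_div_iff₀ (by positivity), inv_mul_le_iff₀ (by positivity), mul_comm,
    ← mul_pow]
  gcongr

theorem exists_isEigenbasis_summable {T : E →ₗ.[ℝ] E} (hT : IsSelfAdjoint T) {p : ℕ}
    (hd : IsDiscretizable T p) :
    ∃ (ι : Type u) (b : HilbertBasis ι ℝ E) (l : ι → ℝ), IsEigenbasis T b l ∧
      Countable ι ∧ Summable fun i => ((1 + l i ^ 2) ^ (p + 2))⁻¹ := by
  obtain ⟨ι, b, l, h⟩ := exists_isEigenbasis hT (iSup_eigenspace_orthogonal hT hd)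
  have hs := summable_eigenvalues h hd
  refine ⟨ι, b, l, h, ?_, hs⟩
  -- A summable family has countable support, and here no term vanishes.
  have := hs.countable_support
  rw [← Set.countable_univ_iff]
  convert! this
  ext i
  have : (1 + l i ^ 2) ^ (p + 2) ≠ 0 := by positivity
  simpa using this

end Hilbert

/-! ### Double Laplace transforms of exponential series -/

/-- Interchange of a double series with a double Laplace integral. The kernels may change sign, so
absolute convergence is measured by majorants `H₁`, `H₂` with known transforms `g₁`, `g₂`. -/
theorem double_laplace_tsum {κ : Type*} [Countable κ] {h₁ h₂ H₁ H₂ φ₁ φ₂ g₁ g₂ : ℝ → ℝ}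
    (hφ₁ : IsLaplaceKernel h₁ φ₁) (hφ₂ : IsLaplaceKernel h₂ φ₂)
    (hg₁ : IsLaplaceKernel H₁ g₁) (hg₂ : IsLaplaceKernel H₂ g₂)
    (hH₁ : ∀ t, 0 < t → |h₁ t| ≤ H₁ t) (hH₂ : ∀ t, 0 < t → |h₂ t| ≤ H₂ t)
    {x : κ → ℝ} (hx : ∀ k, 0 < x k) {c : κ × κ → ℝ}
    (hs : Summable fun p => |c p| * (g₁ (x p.1) * g₂ (x p.2))) :
    IntegrableOn (fun q : ℝ × ℝ => h₁ q.1 * h₂ q.2 * ∑' p, c p *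
        (Real.exp (-q.1 * x p.1 ^ 2) * Real.exp (-q.2 * x p.2 ^ 2))) (Ioi 0 ×ˢ Ioi 0) ∧
      ∑' p, c p * (φ₁ (x p.1) * φ₂ (x p.2)) =
        ∫ t in Ioi (0 : ℝ), ∫ s in Ioi (0 : ℝ), h₁ t * h₂ s * ∑' p, c p *
          (Real.exp (-t * x p.1 ^ 2) * Real.exp (-s * x p.2 ^ 2)) := by
  set ν : Measure ℝ := volume.restrict (Ioi 0) with hν
  have hprod : (volume : Measure (ℝ × ℝ)).restrict (Ioi 0 ×ˢ Ioi 0) = ν.prod ν := by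
    rw [hν, Measure.prod_restrict]; rfl
  have hae : ∀ᵐ t ∂ν, 0 < t := ae_restrict_mem measurableSet_Ioi
  let f : κ × κ → ℝ × ℝ → ℝ := fun p q => c p *
    ((h₁ q.1 * Real.exp (-q.1 * x p.1 ^ 2)) * (h₂ q.2 * Real.exp (-q.2 * x p.2 ^ 2)))
  have hint : ∀ p, Integrable (f p) (ν.prod ν) := fun p =>
    ((hφ₁ _ (hx p.1)).1.mul_prod (hφ₂ _ (hx p.2)).1).const_mul _
  have hle : ∀ {h H φ g : ℝ → ℝ}, IsLaplaceKernel h φ → IsLaplaceKernel H g →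
      (∀ t, 0 < t → |h t| ≤ H t) → ∀ {y : ℝ}, 0 < y →
      ∫ t, ‖h t * Real.exp (-t * y ^ 2)‖ ∂ν ≤ g y := by
    intro h H φ g h1 h2 h3 y hy
    rw [(h2 y hy).2]
    refine integral_mono_ae (h1 y hy).1.norm (h2 y hy).1 ?_
    filter_upwards [hae] with t ht
    rw [norm_mul, Real.norm_of_nonneg (Real.exp_nonneg _)]
    exact mul_le_mul_of_nonneg_right (h3 t ht) (Real.exp_nonneg _)
  have hnorm : Summable fun p => ∫ q, ‖f p q‖ ∂(ν.prod ν) := by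
    refine hs.of_nonneg_of_le (fun p => integral_nonneg fun _ => norm_nonneg _) fun p => ?_
    have h1 := hle hφ₁ hg₁ hH₁ (hx p.1)
    have h2 := hle hφ₂ hg₂ hH₂ (hx p.2)
    calc ∫ q, ‖f p q‖ ∂(ν.prod ν)
        = |c p| * ((∫ t, ‖h₁ t * Real.exp (-t * x p.1 ^ 2)‖ ∂ν) *
          ∫ t, ‖h₂ t * Real.exp (-t * x p.2 ^ 2)‖ ∂ν) := by
          rw [← integral_prod_mul, ← integral_const_mul]
          refine integral_congr_ae (Filter.Eventually.of_forall fun q => ?_)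
          simp only [f, norm_mul, Real.norm_eq_abs]
      _ ≤ _ := by
          refine mul_le_mul_of_nonneg_left (mul_le_mul h1 h2 ?_ ?_) (abs_nonneg _)
          · exact integral_nonneg fun _ => norm_nonneg _
          · exact (integral_nonneg fun _ => norm_nonneg _).trans h1
  have heq : (fun q => ∑' p, f p q) = fun q : ℝ × ℝ => h₁ q.1 * h₂ q.2 * ∑' p, c p *
      (Real.exp (-q.1 * x p.1 ^ 2) * Real.exp (-q.2 * x p.2 ^ 2)) := by
    ext q
    rw [← tsum_mul_left]
    exact tsum_congr fun p => by simp only [f]; ring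
  have h1 := integrable_tsum_of_summable_integral_norm hint hnorm
  have h2 := hasSum_integral_of_summable_integral_norm hint hnorm
  rw [heq] at h1 h2
  refine ⟨by rw [IntegrableOn, hprod]; exact h1, ?_⟩
  rw [integral_prod _ h1] at h2
  rw [← h2.tsum_eq]
  refine tsum_congr fun p => ?_
  rw [integral_const_mul, integral_prod_mul (μ := ν) (ν := ν)
    (fun t => h₁ t * Real.exp (-t * x p.1 ^ 2)) (fun t => h₂ t * Real.exp (-t * x p.2 ^ 2)),
    ← (hφ₁ _ (hx p.1)).2, ← (hφ₂ _ (hx p.2)).2]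

/-! ### Sequences of frequencies -/

section Frequencies

variable {κ : Type*} {y : κ → ℝ}

/-- The partition function `∑ exp (-c ω)` is finite for all positive `c`. -/
def HasPartition (y : κ → ℝ) : Prop := ∀ c : ℝ, 0 < c → Summable fun k => Real.exp (-c * y k)

theorem HasPartition.sumElim {κ' : Type*} {y' : κ' → ℝ} (h : HasPartition y)
    (h' : HasPartition y') : HasPartition (Sum.elim y y') := fun c hc => by
  have h1 := (h c hc).hasSum
  have h2 := (h' c hc).hasSum
  refine ((h1.sum h2 : HasSum (fun k => Real.exp (-c * Sum.elim y y' k)) _)).summable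

theorem bose_nonneg {x : ℝ} (hx : 0 < x) : 0 ≤ bose x := by
  have : 0 < Real.exp x - 1 := by simpa using hx
  unfold bose; positivity

theorem fermi_nonneg (x : ℝ) : 0 ≤ fermi x := by
  have := Real.exp_pos x
  unfold fermi; positivity

theorem fermi_le_bose {x : ℝ} (hx : 0 < x) : fermi x ≤ bose x := by
  have : 0 < Real.exp x - 1 := by simpa using hx
  exact one_div_le_one_div_of_le this (by linarith)

theorem fermiBoseMean_nonneg {x : ℝ} (hx : 0 < x) : 0 ≤ fermiBoseMean x := by
  have := bose_nonneg hx
  have := fermi_nonneg x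
  unfold fermiBoseMean; positivity

theorem fermiBoseMean_le_bose {x : ℝ} (hx : 0 < x) : fermiBoseMean x ≤ bose x := by
  have := fermi_le_bose hx
  unfold fermiBoseMean; linarith

theorem HasPartition.summable_mul_exp (hy : HasPartition y) (hy0 : ∀ k, 0 < y k) {c : ℝ}
    (hc : 0 < c) : Summable fun k => y k * Real.exp (-c * y k) := by
  refine ((hy (c / 2) (half_pos hc)).mul_left (2 / c)).of_nonneg_of_le
    (fun k => mul_nonneg (hy0 k).le (Real.exp_nonneg _)) fun k => ?_
  have h1 : c / 2 * y k ≤ Real.exp (c / 2 * y k) := by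
    linarith [Real.add_one_le_exp (c / 2 * y k)]
  have h2 : Real.exp (-c * y k) = Real.exp (-(c / 2) * y k) * Real.exp (-(c / 2 * y k)) := by
    rw [← Real.exp_add]; congr 1; ring
  have h3 : y k * Real.exp (-(c / 2 * y k)) ≤ 2 / c := by
    rw [Real.exp_neg, ← div_eq_mul_inv, div_le_div_iff₀ (Real.exp_pos _) hc]
    linarith
  rw [h2]
  calc _ = y k * Real.exp (-(c / 2 * y k)) * Real.exp (-(c / 2) * y k) := by ring
    _ ≤ _ := mul_le_mul_of_nonneg_right h3 (Real.exp_nonneg _)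

/-- Terms of a convergent series are eventually below `1/2`; then the geometric series for the Bose
function is at most twice its first term. The finitely many other indices do not affect summability.
-/
theorem HasPartition.eventually_bose_le (hy : HasPartition y) (hy0 : ∀ k, 0 < y k) {c : ℝ}
    (hc : 0 < c) : ∀ᶠ k in Filter.cofinite, bose (c * y k) ≤ 2 * Real.exp (-c * y k) := by
  have h := (hy c hc).tendsto_cofinite_zero.eventually_lt_const (show (0 : ℝ) < 1 / 2 by norm_num)
  filter_upwards [h] with k hk
  have h1 : 0 < Real.exp (c * y k) - 1 := by simpa using mul_pos hc (hy0 k)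
  rw [neg_mul, Real.exp_neg] at hk ⊢
  have h2 := Real.exp_pos (c * y k)
  rw [inv_lt_comm₀ h2 (by norm_num)] at hk
  rw [bose, ← div_eq_mul_inv, div_le_div_iff₀ h1 h2]
  linarith

theorem HasPartition.summable_bose (hy : HasPartition y) (hy0 : ∀ k, 0 < y k) {c : ℝ}
    (hc : 0 < c) : Summable fun k => bose (c * y k) := by
  refine Summable.of_norm_bounded_eventually ((hy c hc).mul_left 2) ?_
  filter_upwards [hy.eventually_bose_le hy0 hc] with k hk
  rwa [Real.norm_of_nonneg (bose_nonneg (mul_pos hc (hy0 k)))]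

theorem HasPartition.summable_mul_bose (hy : HasPartition y) (hy0 : ∀ k, 0 < y k) {c : ℝ}
    (hc : 0 < c) : Summable fun k => y k * bose (c * y k) := by
  refine Summable.of_norm_bounded_eventually ((hy.summable_mul_exp hy0 hc).mul_left 2) ?_
  filter_upwards [hy.eventually_bose_le hy0 hc] with k hk
  rw [Real.norm_of_nonneg (mul_nonneg (hy0 k).le (bose_nonneg (mul_pos hc (hy0 k))))]
  calc _ ≤ y k * (2 * Real.exp (-c * y k)) := mul_le_mul_of_nonneg_left hk (hy0 k).le
    _ = _ := by ring

theorem HasPartition.summable_fermi (hy : HasPartition y) (hy0 : ∀ k, 0 < y k) {c : ℝ}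
    (hc : 0 < c) : Summable fun k => fermi (c * y k) :=
  (hy.summable_bose hy0 hc).of_nonneg_of_le (fun _ => fermi_nonneg _)
    fun k => fermi_le_bose (mul_pos hc (hy0 k))

theorem HasPartition.summable_mul_fermiBoseMean (hy : HasPartition y) (hy0 : ∀ k, 0 < y k) {c : ℝ}
    (hc : 0 < c) : Summable fun k => y k * fermiBoseMean (c * y k) :=
  (hy.summable_mul_bose hy0 hc).of_nonneg_of_le
    (fun k => mul_nonneg (hy0 k).le (fermiBoseMean_nonneg (mul_pos hc (hy0 k))))
    fun k => mul_le_mul_of_nonneg_left (fermiBoseMean_le_bose (mul_pos hc (hy0 k))) (hy0 k).le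

/-- From `(x - 1/2)² ≥ 0`; it bounds heat traces, which are Gaussian in the frequency, by the
partition function. -/
theorem exp_neg_mul_sq_le {t : ℝ} (ht : 0 < t) (x : ℝ) :
    Real.exp (-t * x ^ 2) ≤ Real.exp (t / 4) * Real.exp (-t * x) := by
  rw [← Real.exp_add, Real.exp_le_exp]
  nlinarith [mul_nonneg ht.le (sq_nonneg (x - 1 / 2))]

theorem HasPartition.summable_exp_sq (hy : HasPartition y) {t : ℝ} (ht : 0 < t) :
    Summable fun k => Real.exp (-t * y k ^ 2) :=
  ((hy t ht).mul_left _).of_nonneg_of_le (fun _ => Real.exp_nonneg _)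
    fun k => exp_neg_mul_sq_le ht (y k)

theorem HasPartition.summable_mul_exp_sq (hy : HasPartition y) (hy0 : ∀ k, 0 < y k) {t : ℝ}
    (ht : 0 < t) : Summable fun k => y k * Real.exp (-t * y k ^ 2) := by
  refine ((hy.summable_mul_exp hy0 ht).mul_left (Real.exp (t / 4))).of_nonneg_of_le
    (fun k => mul_nonneg (hy0 k).le (Real.exp_nonneg _)) fun k => ?_
  have := mul_le_mul_of_nonneg_left (exp_neg_mul_sq_le ht (y k)) (hy0 k).le
  linarith

/-- Summability forces `y → ∞` along the cofinite filter, and there an exponential is smaller than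
any inverse power. The shift `b` is the `m²` in `ω² = λ + m²`. -/
theorem hasPartition_of_summable_inv_pow (hy0 : ∀ k, 0 < y k) {q : ℕ} {b : ℝ}
    (hs : Summable fun k => ((1 + (y k ^ 2 - b) ^ 2) ^ (q + 1))⁻¹) : HasPartition y := by
  intro c hc
  have hpos : ∀ x : ℝ, (0 : ℝ) < (1 + (x ^ 2 - b) ^ 2) ^ (q + 1) := fun x => by positivity
  have ht : Filter.Tendsto y Filter.cofinite Filter.atTop := by
    refine Filter.tendsto_atTop.2 fun B => ?_
    have h1 := hs.tendsto_cofinite_zero.eventually_lt_const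
      (inv_pos.2 (show (0 : ℝ) < (1 + (B ^ 2 + |b|) ^ 2) ^ (q + 1) by positivity))
    filter_upwards [h1] with k hk
    by_contra! hB
    rw [inv_lt_inv₀ (hpos _) (by positivity)] at hk
    refine absurd hk (not_lt.2 ?_)
    have h2 : y k ^ 2 ≤ B ^ 2 := by nlinarith [hy0 k]
    have h3 : |y k ^ 2 - b| ≤ B ^ 2 + |b| := by
      refine (abs_sub _ _).trans ?_
      rw [abs_of_nonneg (sq_nonneg _)]; linarith
    have h4 : (y k ^ 2 - b) ^ 2 ≤ (B ^ 2 + |b|) ^ 2 := by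
      rw [← sq_abs]; gcongr
    gcongr
  have hO : (fun x : ℝ => Real.exp (-c * x)) =O[Filter.atTop]
      fun x : ℝ => ((1 + (x ^ 2 - b) ^ 2) ^ (q + 1))⁻¹ := by
    have h1 := (isLittleO_exp_neg_mul_rpow_atTop hc (-(4 * (q + 1 : ℕ) : ℝ))).isBigO
    refine h1.trans ?_
    -- For `x ≥ 1` one has `1 + (x² - b)² ≤ 1 + 2 x⁴ + 2 b² ≤ (3 + 2 b²) x⁴`.
    refine Asymptotics.IsBigO.of_bound ((2 + 2 * b ^ 2 + 1) ^ (q + 1)) ?_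
    filter_upwards [Filter.eventually_ge_atTop 1] with x hx
    have hx0 : 0 < x := by linarith
    rw [Real.rpow_neg hx0.le, norm_inv, norm_inv, Real.norm_of_nonneg (hpos x).le,
      Real.norm_of_nonneg (Real.rpow_nonneg hx0.le _)]
    have e : x ^ (4 * (q + 1 : ℕ) : ℝ) = (x ^ 4) ^ (q + 1) := by
      rw [← pow_mul]; exact_mod_cast Real.rpow_natCast x (4 * (q + 1))
    rw [e, ← div_eq_mul_inv, le_div_iff₀ (hpos x), inv_mul_le_iff₀ (by positivity), ← mul_pow]
    gcongr
    have : 1 ≤ x ^ 4 := one_le_pow₀ hx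
    nlinarith [sq_nonneg (x ^ 2 + b), sq_nonneg b]
  exact summable_of_isBigO hs (hO.comp_tendsto ht)

end Frequencies

section Hilbert

variable {E : Type*} [NormedAddCommGroup E] [InnerProductSpace ℝ E] [CompleteSpace E]

/-! ### Differences of functions of two operators -/

theorem _root_.Summable.exists_bound {ι : Type*} {a : ι → ℝ} (ha : Summable fun i => |a i|) :
    ∃ C, ∀ i, |a i| ≤ C :=
  ⟨_, fun i => ha.le_tsum i fun _ _ => abs_nonneg _⟩

theorem HilbertBasis.norm_le_one {ι : Type*} (b : HilbertBasis ι ℝ E) (i : ι) : ‖b i‖ ≤ 1 :=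
  (b.orthonormal.1 i).le

section TwoOperators

variable {ι ι' : Type*} {T T' : E →ₗ.[ℝ] E} {b : HilbertBasis ι ℝ E} {b' : HilbertBasis ι' ℝ E}
  {l : ι → ℝ} {l' : ι' → ℝ}

/-- The signs `+` and `-` of the two operators. -/
def relSign : ι ⊕ ι' → ℝ := Sum.elim (fun _ => 1) fun _ => -1

theorem abs_relSign (k : ι ⊕ ι') : |relSign k| = 1 := by
  rcases k with k | k <;> simp [relSign]

theorem relSign_mul_comp {α : Type*} (f : α → ℝ) (u : ι → α) (u' : ι' → α) :
    (fun k => relSign k * f (Sum.elim u u' k))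
      = Sum.elim (fun i => f (u i)) (fun j => -f (u' j)) := by
  ext k; rcases k with k | k <;> simp [relSign]

theorem norm_sumElim_le (k : ι ⊕ ι') : ‖Sum.elim b b' k‖ ≤ 1 := by
  rcases k with k | k
  · exact HilbertBasis.norm_le_one b k
  · exact HilbertBasis.norm_le_one b' k

theorem opFun_sub_opFun (h : IsEigenbasis T b l) (h' : IsEigenbasis T' b' l') {φ : ℝ → ℝ}
    (hs : Summable fun i => |φ (l i)|) (hs' : Summable fun i => |φ (l' i)|) :
    opFun T φ - opFun T' φ
      = rankOneSum (Sum.elim b b') fun k => relSign k * φ (Sum.elim l l' k) := by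
  obtain ⟨C, hC⟩ := hs.exists_bound
  obtain ⟨C', hC'⟩ := hs'.exists_bound
  rw [h.opFun_eq hC, h'.opFun_eq hC', relSign_mul_comp, rankOneSum_sumElim
    (HilbertBasis.norm_le_one b) (HilbertBasis.norm_le_one b') hs hs']

theorem IsEigenbasis.opFun_affine (h : IsEigenbasis T b l) {φ ψ : ℝ → ℝ} {x z : ℝ}
    (hψ : ∀ i, ψ (l i) = x + z * φ (l i)) (hs : Summable fun i => |φ (l i)|) (u : E) :
    opFun T ψ u = x • u + z • opFun T φ u := by
  obtain ⟨C, hC⟩ := hs.exists_bound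
  have hψC : ∀ i, |ψ (l i)| ≤ |x| + |z| * C := fun i => by
    rw [hψ]
    refine (abs_add_le _ _).trans ?_
    rw [abs_mul]
    gcongr
    exact hC i
  have h1 := (b.hasSum_repr u).const_smul x
  have h2 := (summable_diag b hC u).hasSum.const_smul z
  rw [h.opFun_eq hC, h.opFun_eq hψC]
  refine Eq.trans ?_ (h1.add h2).tsum_eq
  refine tsum_congr fun i => ?_
  change (ψ (l i) * ⟪b i, u⟫_ℝ) • b i = _
  rw [hψ, b.repr_apply_apply, smul_smul, smul_smul, ← add_smul]
  congr 1; ring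

/-- Needed because `tanh` and `coth` tend to one and are not summable along the spectrum. The
multiple `x` of the identity cancels in the difference and leaves the summable part. -/
theorem opFun_affine_sub (h : IsEigenbasis T b l) (h' : IsEigenbasis T' b' l') {φ ψ : ℝ → ℝ}
    {x z : ℝ} (hψ : ∀ i, ψ (l i) = x + z * φ (l i)) (hψ' : ∀ i, ψ (l' i) = x + z * φ (l' i))
    (hs : Summable fun i => |φ (l i)|) (hs' : Summable fun i => |φ (l' i)|) :
    opFun T ψ - opFun T' ψ
      = rankOneSum (Sum.elim b b') fun k => relSign k * (z * φ (Sum.elim l l' k)) := by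
  have h1 := opFun_sub_opFun h h' hs hs'
  ext u
  have h2 := congrFun h1 u
  simp only [Pi.sub_apply] at h2 ⊢
  rw [h.opFun_affine hψ hs, h'.opFun_affine hψ' hs', add_sub_add_left_eq_sub, ← smul_sub, h2,
    rankOneSum, rankOneSum, ← tsum_const_smul'']
  refine tsum_congr fun k => ?_
  rw [smul_smul]
  congr 1; ring

end TwoOperators

/-! ### Bosons -/

theorem tanh_half_eq (x : ℝ) : Real.tanh (x / 2) = 1 + -2 * fermi x := by
  have h1 := Real.exp_pos (x / 2)
  have h2 : Real.exp x = Real.exp (x / 2) ^ 2 := by rw [← Real.exp_nat_mul]; congr 1; push_cast; ring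
  rw [Real.tanh_eq_sinh_div_cosh, Real.sinh_eq, Real.cosh_eq, fermi, h2, Real.exp_neg]
  field_simp
  ring

theorem one_div_tanh_half_eq {x : ℝ} (hx : 0 < x) : 1 / Real.tanh (x / 2) = 1 + 2 * bose x := by
  have h1 := Real.exp_pos x
  have h2 : 0 < Real.exp x - 1 := by simpa using hx
  have h3 : 1 + -2 * fermi x = (Real.exp x - 1) / (Real.exp x + 1) := by
    rw [fermi]; field_simp; ring
  rw [tanh_half_eq, h3, bose]
  field_simp
  ring

/-- A relative operator `∑ ± φ(λ_k) ⟨v_k, ·⟩ v_k` for `λ_k = ω_k² - m²`, in terms of the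
frequencies `ω_k`. -/
def relRank {κ : Type*} (v : κ → E) (σ : κ → ℝ) (y : κ → ℝ) (φ : ℝ → ℝ) : E → E :=
  rankOneSum v fun k => σ k * φ (y k)

section RelRank

variable {κ : Type*} {v : κ → E} {σ y : κ → ℝ}

theorem summable_abs_sign_mul (hσ : ∀ k, |σ k| = 1) {φ : ℝ → ℝ}
    (hs : Summable fun k => |φ (y k)|) : Summable fun k => |σ k * φ (y k)| := by
  simpa [abs_mul, hσ] using hs

theorem opTrace_relRank (hv : ∀ k, ‖v k‖ ≤ 1) (hσ : ∀ k, |σ k| = 1) {φ ψ : ℝ → ℝ}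
    (hφ : Summable fun k => |φ (y k)|) (hψ : Summable fun k => |ψ (y k)|) :
    opTrace (relRank v σ y φ ∘ relRank v σ y ψ) = ∑' p : κ × κ,
      σ p.1 * σ p.2 * ⟪v p.1, v p.2⟫_ℝ ^ 2 * (φ (y p.1) * ψ (y p.2)) := by
  rw [relRank, relRank, opTrace_rankOneSum_comp hv (summable_abs_sign_mul hσ hφ)
    (summable_abs_sign_mul hσ hψ)]
  exact tsum_congr fun p => by ring

theorem isTraceClass_relRank [Countable κ] (hv : ∀ k, ‖v k‖ ≤ 1) (hσ : ∀ k, |σ k| = 1)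
    {φ ψ : ℝ → ℝ} (hφ : Summable fun k => |φ (y k)|) (hψ : Summable fun k => |ψ (y k)|) :
    IsTraceClass (relRank v σ y φ ∘ relRank v σ y ψ) :=
  isTraceClass_rankOneSum_comp hv (summable_abs_sign_mul hσ hφ) (summable_abs_sign_mul hσ hψ)

theorem abs_relWeight_le (hv : ∀ k, ‖v k‖ ≤ 1) (hσ : ∀ k, |σ k| = 1) (p : κ × κ) :
    |σ p.1 * σ p.2 * ⟪v p.1, v p.2⟫_ℝ ^ 2| ≤ 1 := by
  rw [abs_mul, abs_mul, hσ, hσ, one_mul, one_mul, abs_pow]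
  refine pow_le_one₀ (abs_nonneg _) ((abs_real_inner_le_norm _ _).trans ?_)
  exact mul_le_one₀ (hv _) (norm_nonneg _) (hv _)

theorem summable_abs_heat (hy : HasPartition y) (m : ℝ) {t : ℝ} (ht : 0 < t) :
    Summable fun k => |Real.exp (-t * (y k ^ 2 - m ^ 2))| := by
  simp only [abs_of_nonneg (Real.exp_nonneg _)]
  refine ((hy.summable_exp_sq ht).mul_left (Real.exp (t * m ^ 2))).congr fun k => ?_
  rw [← Real.exp_add]; congr 1; ring

/-- The mass factor of the final formula arises here, from writing `ω² = λ + m²` in both Gaussians.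
-/
theorem exp_mul_exp_eq (β m t s y z : ℝ) :
    Real.exp (-t * (β * y) ^ 2) * Real.exp (-s * (β * z) ^ 2)
      = Real.exp (-m ^ 2 * β ^ 2 * (s + t)) * (Real.exp (-(β ^ 2 * t) * (y ^ 2 - m ^ 2))
        * Real.exp (-(β ^ 2 * s) * (z ^ 2 - m ^ 2))) := by
  rw [← Real.exp_add, ← Real.exp_add, ← Real.exp_add]
  congr 1; ring

/-- Both sides are the same double series with weights `± ⟨v_k, v_l⟩²`: on the left with `fermi *
bose`, on the right with the Gaussians whose Laplace integrals these are. The prefactor `1/4`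
removes the two factors `2`. -/
theorem relRank_boson [Countable κ] (hv : ∀ k, ‖v k‖ ≤ 1) (hσ : ∀ k, |σ k| = 1)
    (hy0 : ∀ k, 0 < y k) (hy : HasPartition y) (m : ℝ) {β : ℝ} (hβ : 0 < β) {Ψ : ℝ → ℝ → ℝ}
    (hΨ : ∀ t s, 0 < t → 0 < s → Ψ t s = opTrace
      (relRank v σ y (fun x => Real.exp (-t * (x ^ 2 - m ^ 2))) ∘
        relRank v σ y (fun x => Real.exp (-s * (x ^ 2 - m ^ 2))))) :
    IsTraceClass (relRank v σ y (fun x => 2 * fermi (β * x)) ∘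
        relRank v σ y (fun x => 2 * bose (β * x))) ∧
      IntegrableOn (fun p : ℝ × ℝ => hf p.1 * hb p.2
          * Real.exp (-m ^ 2 * β ^ 2 * (p.2 + p.1)) * Ψ (β ^ 2 * p.1) (β ^ 2 * p.2))
          (Ioi 0 ×ˢ Ioi 0) ∧
        1 / 4 * opTrace (relRank v σ y (fun x => 2 * fermi (β * x)) ∘
          relRank v σ y (fun x => 2 * bose (β * x))) =
          ∫ t in Ioi (0 : ℝ), ∫ s in Ioi (0 : ℝ), hf t * hb s
            * Real.exp (-m ^ 2 * β ^ 2 * (s + t)) * Ψ (β ^ 2 * t) (β ^ 2 * s) := by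
  have hβy : ∀ k, 0 < β * y k := fun k => mul_pos hβ (hy0 k)
  have hfe : Summable fun k => |2 * fermi (β * y k)| := by
    simpa only [abs_mul, abs_two, abs_of_nonneg (fermi_nonneg _)]
      using (hy.summable_fermi hy0 hβ).mul_left 2
  have hbo0 : Summable fun k => bose (β * y k) := hy.summable_bose hy0 hβ
  have hbo : Summable fun k => |2 * bose (β * y k)| := by
    simpa only [abs_mul, abs_two, abs_of_nonneg (bose_nonneg (hβy _))] using hbo0.mul_left 2
  -- Bose functions occur in both variables since `|hf|` is majorized by `hb`; the weights have
  -- modulus at most one.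
  have hsum : Summable fun p : κ × κ => |σ p.1 * σ p.2 * ⟪v p.1, v p.2⟫_ℝ ^ 2| *
      (bose (β * y p.1) * bose (β * y p.2)) := by
    have h0 : Summable fun p : κ × κ => bose (β * y p.1) * bose (β * y p.2) :=
      hbo0.mul_of_nonneg hbo0 (fun k => bose_nonneg (hβy k)) fun k => bose_nonneg (hβy k)
    have hnn : ∀ p : κ × κ, 0 ≤ bose (β * y p.1) * bose (β * y p.2) := fun p =>
      mul_nonneg (bose_nonneg (hβy _)) (bose_nonneg (hβy _))
    exact h0.of_nonneg_of_le (fun p => mul_nonneg (abs_nonneg _) (hnn p))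
      fun p => mul_le_of_le_one_left (hnn p) (abs_relWeight_le hv hσ p)
  obtain ⟨hI1, hI2⟩ := double_laplace_tsum isLaplaceKernel_hf isLaplaceKernel_hb
    isLaplaceKernel_hb isLaplaceKernel_hb (fun t ht => abs_hf_le_hb ht)
    (fun t ht => (abs_of_nonneg (hb_nonneg ht.le)).le) hβy hsum
  have hintegrand : ∀ t s, 0 < t → 0 < s → hf t * hb s * (∑' p : κ × κ,
        σ p.1 * σ p.2 * ⟪v p.1, v p.2⟫_ℝ ^ 2 *
          (Real.exp (-t * (β * y p.1) ^ 2) * Real.exp (-s * (β * y p.2) ^ 2)))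
      = hf t * hb s * Real.exp (-m ^ 2 * β ^ 2 * (s + t)) * Ψ (β ^ 2 * t) (β ^ 2 * s) := by
    intro t s ht hs
    have ht' : 0 < β ^ 2 * t := by positivity
    have hs' : 0 < β ^ 2 * s := by positivity
    have hst := summable_abs_heat hy m ht'
    have hss := summable_abs_heat hy m hs'
    have htr := opTrace_relRank (φ := fun x => Real.exp (-(β ^ 2 * t) * (x ^ 2 - m ^ 2)))
      (ψ := fun x => Real.exp (-(β ^ 2 * s) * (x ^ 2 - m ^ 2))) hv hσ hst hss
    rw [hΨ _ _ ht' hs', mul_assoc (hf t * hb s), htr,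
      ← tsum_mul_left (a := Real.exp (-m ^ 2 * β ^ 2 * (s + t)))]
    refine congrArg (fun z => hf t * hb s * z) (tsum_congr fun p => ?_)
    rw [exp_mul_exp_eq β m]; ring
  refine ⟨?_, ?_, ?_⟩
  · exact isTraceClass_relRank (φ := fun x => 2 * fermi (β * x)) (ψ := fun x => 2 * bose (β * x))
      hv hσ hfe hbo
  · exact hI1.congr_fun (fun p hp => hintegrand _ _ hp.1 hp.2)
      (measurableSet_Ioi.prod measurableSet_Ioi)
  · rw [opTrace_relRank (φ := fun x => 2 * fermi (β * x)) (ψ := fun x => 2 * bose (β * x))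
      hv hσ hfe hbo, ← tsum_mul_left]
    refine Eq.trans (tsum_congr fun p => ?_) (hI2.trans ?_)
    · ring
    · refine setIntegral_congr_fun measurableSet_Ioi fun t ht => ?_
      exact setIntegral_congr_fun measurableSet_Ioi fun s hs => hintegrand t s ht hs

end RelRank

section Boson

variable {ι ι' : Type*} {T T' : E →ₗ.[ℝ] E} {b : HilbertBasis ι ℝ E} {b' : HilbertBasis ι' ℝ E}
  {l : ι → ℝ} {l' : ι' → ℝ} {m : ℝ}

/-- The frequencies `(λ + m²)^{1/2}` of two operators. -/
def frequencies (l : ι → ℝ) (l' : ι' → ℝ) (m : ℝ) : ι ⊕ ι' → ℝ :=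
  Sum.elim (fun i => √(l i + m ^ 2)) fun i => √(l' i + m ^ 2)

theorem opFun_affine_sub_eq_relRank (h : IsEigenbasis T b l) (h' : IsEigenbasis T' b' l')
    {φ ψ χ : ℝ → ℝ} {x z : ℝ}
    (hψ : ∀ i, ψ (l i) = x + z * χ (√(l i + m ^ 2)))
    (hψ' : ∀ i, ψ (l' i) = x + z * χ (√(l' i + m ^ 2)))
    (hφ : ∀ x, φ x = z * χ x)
    (hs : Summable fun k => |χ (frequencies l l' m k)|) :
    opFun T ψ - opFun T' ψ
      = relRank (Sum.elim b b') relSign (frequencies l l' m) φ := by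
  have h1 : Summable fun i => |χ (√(l i + m ^ 2))| := by
    simpa only [Function.comp_def, frequencies, Sum.elim_inl]
      using hs.comp_injective Sum.inl_injective
  have h2 : Summable fun i => |χ (√(l' i + m ^ 2))| := by
    simpa only [Function.comp_def, frequencies, Sum.elim_inr]
      using hs.comp_injective Sum.inr_injective
  rw [opFun_affine_sub (φ := fun x => χ (√(x + m ^ 2))) h h' hψ hψ' h1 h2, relRank]
  congr 1
  ext k
  rw [hφ]
  rcases k with k | k <;> rfl

theorem heatOp_sub_heatOp (h : IsEigenbasis T b l) (h' : IsEigenbasis T' b' l')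
    (hm : ∀ i, 0 < l i + m ^ 2) (hm' : ∀ i, 0 < l' i + m ^ 2)
    (hp : HasPartition (frequencies l l' m)) {t : ℝ} (ht : 0 < t) :
    heatOp T t - heatOp T' t = relRank (Sum.elim b b') relSign (frequencies l l' m)
      (fun x => Real.exp (-t * (x ^ 2 - m ^ 2))) := by
  refine opFun_affine_sub_eq_relRank (x := 0) (z := 1)
    (χ := fun x => Real.exp (-t * (x ^ 2 - m ^ 2))) h h' (fun i => ?_) (fun i => ?_)
    (fun x => (one_mul _).symm) (summable_abs_heat hp m ht)
  · simp only [Real.sq_sqrt (hm i).le, add_sub_cancel_right, one_mul, zero_add]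
  · simp only [Real.sq_sqrt (hm' i).le, add_sub_cancel_right, one_mul, zero_add]

theorem frequencies_pos (hm : ∀ i, 0 < l i + m ^ 2) (hm' : ∀ i, 0 < l' i + m ^ 2) (k : ι ⊕ ι') :
    0 < frequencies l l' m k := by
  rcases k with k | k
  exacts [Real.sqrt_pos.2 (hm k), Real.sqrt_pos.2 (hm' k)]

/-- The conclusion of the theorem for a pair of bosonic Hamiltonians. -/
theorem boson_of_isEigenbasis [Countable ι] [Countable ι']
    (h : IsEigenbasis T b l) (h' : IsEigenbasis T' b' l')
    (hm : ∀ i, 0 < l i + m ^ 2) (hm' : ∀ i, 0 < l' i + m ^ 2)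
    (hp : HasPartition fun i => √(l i + m ^ 2)) (hp' : HasPartition fun i => √(l' i + m ^ 2)) :
    (∀ t s : ℝ, 0 < t → 0 < s → IsTraceClass (relHeatOp T T' t s)) ∧
      ∀ β : ℝ, 0 < β → IsTraceClass (bosonicOp T T' m β) ∧
        IntegrableOn (fun p : ℝ × ℝ => hf p.1 * hb p.2
          * Real.exp (-m ^ 2 * β ^ 2 * (p.2 + p.1))
          * relHeatTrace T T' (β ^ 2 * p.1) (β ^ 2 * p.2)) (Ioi 0 ×ˢ Ioi 0) ∧
        bosonicInvariant T T' m β =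
          ∫ t in Ioi (0 : ℝ), ∫ s in Ioi (0 : ℝ), hf t * hb s
            * Real.exp (-m ^ 2 * β ^ 2 * (s + t))
            * relHeatTrace T T' (β ^ 2 * t) (β ^ 2 * s) := by
  have hy : HasPartition (frequencies l l' m) := hp.sumElim hp'
  have hy0 := frequencies_pos hm hm'
  have hv : ∀ k, ‖Sum.elim b b' k‖ ≤ 1 := norm_sumElim_le
  have hσ : ∀ k : ι ⊕ ι', |relSign k| = 1 := abs_relSign
  refine ⟨fun t s ht hs => ?_, fun β hβ => ?_⟩
  · rw [relHeatOp, heatOp_sub_heatOp h h' hm hm' hy ht, heatOp_sub_heatOp h h' hm hm' hy hs]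
    exact isTraceClass_relRank (φ := fun x => Real.exp (-t * (x ^ 2 - m ^ 2)))
      (ψ := fun x => Real.exp (-s * (x ^ 2 - m ^ 2))) hv hσ
      (summable_abs_heat hy m ht) (summable_abs_heat hy m hs)
  have hF : omegaFun T' m β (fun x => Real.tanh (x / 2))
      - omegaFun T m β (fun x => Real.tanh (x / 2))
      = relRank (Sum.elim b b') relSign (frequencies l l' m) fun x => 2 * fermi (β * x) := by
    have h1 : omegaFun T m β (fun x => Real.tanh (x / 2))
        - omegaFun T' m β (fun x => Real.tanh (x / 2))
        = relRank (Sum.elim b b') relSign (frequencies l l' m) fun x => -2 * fermi (β * x) :=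
      opFun_affine_sub_eq_relRank (x := 1) (z := -2) (χ := fun x => fermi (β * x)) h h'
        (fun i => tanh_half_eq _) (fun i => tanh_half_eq _) (fun _ => rfl)
        (by simpa only [abs_of_nonneg (fermi_nonneg _)] using hy.summable_fermi hy0 hβ)
    -- The first factor of the bosonic operator is "minus" less "plus"; the reversal absorbs the
    -- sign in `tanh (x/2) = 1 - 2 fermi x`.
    rw [← neg_sub, h1]
    ext u
    simp only [Pi.neg_apply, relRank, rankOneSum]
    rw [← tsum_neg]
    refine tsum_congr fun k => ?_
    rw [← neg_smul]
    congr 1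
    ring
  have hB : omegaFun T m β (fun x => 1 / Real.tanh (x / 2))
      - omegaFun T' m β (fun x => 1 / Real.tanh (x / 2))
      = relRank (Sum.elim b b') relSign (frequencies l l' m) fun x => 2 * bose (β * x) :=
    opFun_affine_sub_eq_relRank (x := 1) (z := 2) (χ := fun x => bose (β * x)) h h'
      (fun i => one_div_tanh_half_eq (mul_pos hβ (hy0 (Sum.inl i))))
      (fun i => one_div_tanh_half_eq (mul_pos hβ (hy0 (Sum.inr i)))) (fun _ => rfl)
      (by simpa only [abs_of_nonneg (bose_nonneg (mul_pos hβ (hy0 _)))]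
        using hy.summable_bose hy0 hβ)
  rw [bosonicInvariant, bosonicOp, hF, hB]
  refine relRank_boson hv hσ hy0 hy m hβ fun t s ht hs => ?_
  rw [relHeatTrace, relHeatOp, heatOp_sub_heatOp h h' hm hm' hy ht,
    heatOp_sub_heatOp h h' hm hm' hy hs]

end Boson

end Hilbert

section Hilbert

variable {E : Type*} [NormedAddCommGroup E] [InnerProductSpace ℝ E] [CompleteSpace E]

/-! ### The massive Dirac operator -/

theorem mem_graph_sqOp {A : E →ₗ.[ℝ] E} {x y z : E} (h1 : (x, y) ∈ A.graph)
    (h2 : (y, z) ∈ A.graph) : (x, z) ∈ (sqOp A).graph := by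
  obtain ⟨⟨u, hu⟩, rfl, hy⟩ := A.mem_graph_iff.1 h1
  obtain ⟨⟨w, hw⟩, rfl, hz⟩ := A.mem_graph_iff.1 h2
  change A ⟨u, hu⟩ = w at hy
  subst hy
  exact (sqOp A).mem_graph_iff.2 ⟨⟨u, hu, hw⟩, rfl, hz⟩

theorem IsEigenbasis.sqOp {ι : Type*} {A : E →ₗ.[ℝ] E} {b : HilbertBasis ι ℝ E} {a : ι → ℝ}
    (h : IsEigenbasis A b a) : IsEigenbasis (sqOp A) b fun i => a i ^ 2 where
  symm x y := by
    obtain ⟨x, hx, hx'⟩ := x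
    obtain ⟨y, hy, hy'⟩ := y
    exact (h.symm ⟨_, hx'⟩ ⟨y, hy⟩).trans (h.symm ⟨x, hx⟩ ⟨_, hy'⟩)
  mem i := by
    refine mem_graph_sqOp (h.mem i) ?_
    have := A.graph.smul_mem (a i) (h.mem i)
    rwa [Prod.smul_mk, smul_smul, ← sq] at this

/-- The two components `(c e, s e)` and `(-s e, c e)`. -/
def rotPair (c s : ℝ) (e : E) (σ : Bool) : WithLp 2 (E × E) :=
  if σ then WithLp.toLp 2 (c • e, s • e) else WithLp.toLp 2 (-s • e, c • e)

theorem inner_rotPair (c s c' s' : ℝ) (e e' : E) (σ τ : Bool) :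
    ⟪rotPair c s e σ, rotPair c' s' e' τ⟫_ℝ
      = (if σ then (if τ then c * c' + s * s' else s * c' - c * s')
          else (if τ then c * s' - s * c' else c * c' + s * s')) * ⟪e, e'⟫_ℝ := by
  cases σ <;> cases τ <;>
    simp [rotPair, WithLp.prod_inner_apply, inner_smul_left, inner_smul_right] <;> ring

theorem norm_rotPair {c s : ℝ} (hcs : c ^ 2 + s ^ 2 = 1) (e : E) (σ : Bool) :
    ‖rotPair c s e σ‖ = ‖e‖ := by
  rw [← sq_eq_sq₀ (norm_nonneg _) (norm_nonneg _), ← real_inner_self_eq_norm_sq, inner_rotPair,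
    ← real_inner_self_eq_norm_sq]
  have : c * c + s * s = 1 := by rw [← hcs]; ring
  cases σ <;> simp [this]

/-- The cosine of the mixing angle. -/
def mixCos (a m : ℝ) : ℝ := √((1 + a / √(a ^ 2 + m ^ 2)) / 2)

/-- The sine of the mixing angle. -/
def mixSin (a m : ℝ) : ℝ := √((1 - a / √(a ^ 2 + m ^ 2)) / 2)

section Mix

variable {m : ℝ} (hm : 0 < m) (a : ℝ)
include hm

theorem sqrt_sq_add_sq_pos : 0 < √(a ^ 2 + m ^ 2) := Real.sqrt_pos.2 (by positivity)

theorem abs_le_sqrt_sq_add_sq : |a| ≤ √(a ^ 2 + m ^ 2) :=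
  Real.abs_le_sqrt (by nlinarith [sq_nonneg m])

theorem abs_div_le_one : |a / √(a ^ 2 + m ^ 2)| ≤ 1 := by
  rw [abs_div, abs_of_pos (sqrt_sq_add_sq_pos hm a), div_le_one (sqrt_sq_add_sq_pos hm a)]
  exact abs_le_sqrt_sq_add_sq hm a

theorem mixCos_sq : mixCos a m ^ 2 = (1 + a / √(a ^ 2 + m ^ 2)) / 2 :=
  Real.sq_sqrt (by linarith [(abs_le.1 (abs_div_le_one hm a)).1])

theorem mixSin_sq : mixSin a m ^ 2 = (1 - a / √(a ^ 2 + m ^ 2)) / 2 :=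
  Real.sq_sqrt (by linarith [(abs_le.1 (abs_div_le_one hm a)).2])

theorem mixCos_sq_add_mixSin_sq : mixCos a m ^ 2 + mixSin a m ^ 2 = 1 := by
  rw [mixCos_sq hm, mixSin_sq hm]; ring

/-- For a mixing angle `θ` and `w = √(a² + m²)` this and the next lemma say `w cos 2θ = a` and `w
sin 2θ = m`: the block `((a, m), (m, -a))` is `w` times the reflection in the line of angle `θ`. -/
theorem mixCos_sq_sub_mixSin_sq :
    √(a ^ 2 + m ^ 2) * (mixCos a m ^ 2 - mixSin a m ^ 2) = a := by
  have := sqrt_sq_add_sq_pos hm a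
  rw [mixCos_sq hm, mixSin_sq hm]; field_simp; ring

theorem two_mul_mixCos_mul_mixSin :
    √(a ^ 2 + m ^ 2) * (2 * mixCos a m * mixSin a m) = m := by
  have h0 := sqrt_sq_add_sq_pos hm a
  -- Both square roots are nonnegative and `m > 0`, so it is enough to compare squares.
  have h1 : 0 ≤ √(a ^ 2 + m ^ 2) * (2 * mixCos a m * mixSin a m) := by
    unfold mixCos mixSin; positivity
  rw [← sq_eq_sq₀ h1 hm.le]
  have h2 : √(a ^ 2 + m ^ 2) ^ 2 = a ^ 2 + m ^ 2 := Real.sq_sqrt (by positivity)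
  calc _ = 4 * √(a ^ 2 + m ^ 2) ^ 2 * (mixCos a m ^ 2 * mixSin a m ^ 2) := by ring
    _ = √(a ^ 2 + m ^ 2) ^ 2 - a ^ 2 := by
        rw [mixCos_sq hm, mixSin_sq hm]; field_simp; ring
    _ = m ^ 2 := by rw [h2]; ring

end Mix

/-- The eigenvector of `massiveDirac A m` for the eigenvalue `±(a² + m²)^{1/2}`. -/
def diracVec (a m : ℝ) (e : E) (σ : Bool) : WithLp 2 (E × E) :=
  rotPair (mixCos a m) (mixSin a m) e σ

def boolSign (σ : Bool) : ℝ := if σ then 1 else -1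

theorem diracVec_mem_graph {A : E →ₗ.[ℝ] E} {a m : ℝ} (hm : 0 < m) {e : E}
    (he : (e, a • e) ∈ A.graph) (σ : Bool) :
    (diracVec a m e σ, (boolSign σ * √(a ^ 2 + m ^ 2)) • diracVec a m e σ)
      ∈ (massiveDirac A m).graph := by
  obtain ⟨⟨u, hu⟩, rfl, hAu⟩ := A.mem_graph_iff.1 he
  have hA : ∀ c : ℝ, A ⟨c • u, A.domain.smul_mem c hu⟩ = (c * a) • u := by
    intro c
    have := A.map_smul c ⟨u, hu⟩
    rw [hAu, smul_smul] at this
    exact this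
  set w := √(a ^ 2 + m ^ 2) with hw
  set c := mixCos a m with hc
  set s := mixSin a m with hs
  have e1 : c ^ 2 + s ^ 2 = 1 := mixCos_sq_add_mixSin_sq hm a
  have e2 : w * (c ^ 2 - s ^ 2) = a := mixCos_sq_sub_mixSin_sq hm a
  have e3 : w * (2 * c * s) = m := two_mul_mixCos_mul_mixSin hm a
  have e4 : a * c + m * s = w * c := by
    rw [← e2, ← e3]; linear_combination w * c * e1
  have e5 : m * c - a * s = w * s := by
    rw [← e2, ← e3]; linear_combination w * s * e1
  cases σ
  · refine (massiveDirac A m).mem_graph_iff.2 ⟨⟨WithLp.toLp 2 (-s • u, c • u),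
      A.domain.smul_mem _ hu, A.domain.smul_mem _ hu⟩, by simp [diracVec, rotPair, hc, hs], ?_⟩
    change WithLp.toLp 2 (A ⟨-s • u, _⟩ + m • c • u, m • -s • u - A ⟨c • u, _⟩) = _
    rw [hA, hA]
    simp only [diracVec, rotPair, boolSign, Bool.false_eq_true, if_false, ← WithLp.toLp_smul,
      Prod.smul_mk, smul_smul, ← add_smul, ← sub_smul]
    congr 3
    · linear_combination e5
    · linear_combination -e4
  · refine (massiveDirac A m).mem_graph_iff.2 ⟨⟨WithLp.toLp 2 (c • u, s • u),
      A.domain.smul_mem _ hu, A.domain.smul_mem _ hu⟩, by simp [diracVec, rotPair, hc, hs], ?_⟩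
    change WithLp.toLp 2 (A ⟨c • u, _⟩ + m • s • u, m • c • u - A ⟨s • u, _⟩) = _
    rw [hA, hA]
    simp only [diracVec, rotPair, boolSign, if_true, ← WithLp.toLp_smul,
      Prod.smul_mk, smul_smul, ← add_smul, ← sub_smul]
    congr 3
    · linear_combination e4
    · linear_combination e5

theorem exists_isEigenbasis_massiveDirac {ι : Type*} {A : E →ₗ.[ℝ] E} {b : HilbertBasis ι ℝ E}
    {a : ι → ℝ} (h : IsEigenbasis A b a) {m : ℝ} (hm : 0 < m) :
    ∃ B : HilbertBasis (ι × Bool) ℝ (WithLp 2 (E × E)),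
      (∀ k, B k = diracVec (a k.1) m (b k.1) k.2) ∧
      IsEigenbasis (massiveDirac A m) B fun k => boolSign k.2 * √(a k.1 ^ 2 + m ^ 2) := by
  have hon : Orthonormal ℝ fun k : ι × Bool => diracVec (a k.1) m (b k.1) k.2 := by
    refine ⟨fun k => ?_, ?_⟩
    · exact (norm_rotPair (mixCos_sq_add_mixSin_sq hm _) _ _).trans (b.orthonormal.1 _)
    · rintro ⟨i, σ⟩ ⟨j, τ⟩ hij
      simp only [diracVec]
      rw [inner_rotPair]
      by_cases h1 : i = j
      · subst h1
        have h2 : σ ≠ τ := fun h => hij (by rw [h])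
        cases σ <;> cases τ <;> simp_all <;> left <;> ring
      · rw [b.orthonormal.2 h1, mul_zero]
  have hbot : (Submodule.span ℝ (range fun k : ι × Bool => diracVec (a k.1) m (b k.1) k.2))ᗮ
      = ⊥ := by
    rw [eq_bot_iff]
    intro z hz
    have hz1 : ∀ i σ, ⟪diracVec (a i) m (b i) σ, z⟫_ℝ = 0 := fun i σ =>
      (Submodule.mem_orthogonal _ _).1 hz _ (Submodule.subset_span (mem_range_self (i, σ)))
    -- The rotation by the mixing angle is invertible: orthogonality to both rotated vectors gives
    -- orthogonality to `(b i, 0)` and `(0, b i)`.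
    have hz2 : ∀ i, ⟪b i, z.ofLp.1⟫_ℝ = 0 ∧ ⟪b i, z.ofLp.2⟫_ℝ = 0 := by
      intro i
      have h1 := hz1 i true
      have h2 := hz1 i false
      simp only [diracVec, rotPair, Bool.false_eq_true, if_true, if_false,
        WithLp.prod_inner_apply, real_inner_smul_left] at h1 h2
      have h3 := mixCos_sq_add_mixSin_sq hm (a i)
      constructor
      · linear_combination (mixCos (a i) m) * h1 - (mixSin (a i) m) * h2
          - ⟪b i, z.ofLp.1⟫_ℝ * h3
      · linear_combination (mixSin (a i) m) * h1 + (mixCos (a i) m) * h2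
          - ⟪b i, z.ofLp.2⟫_ℝ * h3
    have hzero : ∀ x : E, (∀ i, ⟪b i, x⟫_ℝ = 0) → x = 0 := by
      intro x hx
      rw [← inner_self_eq_zero (𝕜 := ℝ), ← b.tsum_inner_mul_inner]
      simp [hx]
    have h1 := hzero _ fun i => (hz2 i).1
    have h2 := hzero _ fun i => (hz2 i).2
    refine (Submodule.mem_bot ℝ).2 ?_
    rw [← WithLp.ofLp_eq_zero 2]
    exact Prod.ext h1 h2
  refine ⟨HilbertBasis.mkOfOrthogonalEqBot hon hbot, fun k => by
    rw [HilbertBasis.coe_mkOfOrthogonalEqBot], ?_, fun k => ?_⟩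
  · rintro ⟨⟨x, x'⟩, hx⟩ ⟨⟨y, y'⟩, hy⟩
    have h1 := h.symm ⟨x, hx.1⟩ ⟨y, hy.1⟩
    have h2 := h.symm ⟨x', hx.2⟩ ⟨y', hy.2⟩
    simp only at h1 h2
    change ⟪WithLp.toLp 2 (A ⟨x, hx.1⟩ + m • x', m • x - A ⟨x', hx.2⟩), WithLp.toLp 2 (y, y')⟫_ℝ
      = ⟪WithLp.toLp 2 (x, x'), WithLp.toLp 2 (A ⟨y, hy.1⟩ + m • y', m • y - A ⟨y', hy.2⟩)⟫_ℝ
    simp only [WithLp.prod_inner_apply, inner_add_left, inner_add_right, inner_sub_left,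
      inner_sub_right, real_inner_smul_left, real_inner_smul_right, h1, h2]
    ring
  · rw [HilbertBasis.coe_mkOfOrthogonalEqBot]
    exact diracVec_mem_graph hm (h.mem k.1) k.2

/-! ### Fermions -/

/-- `x / sinh x` equals `2 x` times the mean of the Fermi and Bose functions; this is how `h0`
enters. -/
theorem regularizedSign_apply {β w : ℝ} (hβ : 0 < β) (hw : 0 < w) (σ : Bool) :
    boolSign σ * w / |boolSign σ * w| * (β * |boolSign σ * w| / Real.sinh (β * |boolSign σ * w|))
      = boolSign σ * (2 * (β * w * fermiBoseMean (β * w))) := by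
  have h1 : |boolSign σ * w| = w := by cases σ <;> simp [boolSign, abs_of_pos hw]
  have h2 : 0 < β * w := mul_pos hβ hw
  have h3 : 0 < Real.sinh (β * w) := Real.sinh_pos_iff.2 h2
  rw [h1, fermiBoseMean_eq h2]
  field_simp

/-- Up to `⟨e, e'⟩²`, the sum of signs is the trace of the product of two reflections of the plane,
`2 cos (2θ - 2θ')`. Multiplied by `w w'` it splits into `a a'`, the source of `Φ`, and `m²`, the
source of `m² Ψ`. -/
theorem sum_boolSign_mul_inner_diracVec {a a' m : ℝ} (hm : 0 < m) (e e' : E) :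
    √(a ^ 2 + m ^ 2) * √(a' ^ 2 + m ^ 2) * ∑ q : Bool × Bool, boolSign q.1 * boolSign q.2 *
      ⟪diracVec a m e q.1, diracVec a' m e' q.2⟫_ℝ ^ 2
      = 2 * (a * a' + m ^ 2) * ⟪e, e'⟫_ℝ ^ 2 := by
  rw [Fintype.sum_prod_type]
  simp only [diracVec, inner_rotPair, Fintype.sum_bool, boolSign, Bool.false_eq_true, if_true,
    if_false]
  have e1 := mixCos_sq_sub_mixSin_sq hm a
  have e2 := mixCos_sq_sub_mixSin_sq hm a'
  have e3 := two_mul_mixCos_mul_mixSin hm a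
  have e4 := two_mul_mixCos_mul_mixSin hm a'
  set w := √(a ^ 2 + m ^ 2)
  set w' := √(a' ^ 2 + m ^ 2)
  set c := mixCos a m
  set s := mixSin a m
  set c' := mixCos a' m
  set s' := mixSin a' m
  have h1 : a * a' = w * (c ^ 2 - s ^ 2) * (w' * (c' ^ 2 - s' ^ 2)) := by rw [e1, e2]
  have h2 : m ^ 2 = w * (2 * c * s) * (w' * (2 * c' * s')) := by rw [e3, e4, sq]
  rw [h1, h2]
  ring

theorem rankOneSum_comp_equiv {κ κ' : Type*} (f : κ' ≃ κ) (v : κ → E) (a : κ → ℝ) :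
    rankOneSum (v ∘ f) (a ∘ f) = rankOneSum v a := by
  ext u
  exact f.tsum_eq fun k => (a k * ⟪v k, u⟫_ℝ) • v k

section Fermion

variable {ι ι' : Type*} {A A' : E →ₗ.[ℝ] E} {b : HilbertBasis ι ℝ E} {b' : HilbertBasis ι' ℝ E}
  {a : ι → ℝ} {a' : ι' → ℝ} {m : ℝ}

theorem HasPartition.summable_prod_bool {κ : Type*} {f : κ → ℝ} (hf : Summable fun k => |f k|) :
    Summable fun k : κ × Bool => |boolSign k.2 * f k.1| := by
  have : ∀ k : κ × Bool, |boolSign k.2 * f k.1| = |f k.1| := by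
    rintro ⟨k, σ⟩; cases σ <;> simp [boolSign]
  simp only [this]
  exact (summable_prod_of_nonneg (f := fun k : κ × Bool => |f k.1|) fun _ => abs_nonneg _).2
    ⟨fun k => (hasSum_fintype _).summable, by simpa using hf.mul_left 2⟩

/-- The weight `2 β ω φ(β ω)` of the regularized sign, where `φ` is the mean of the Fermi and Bose
functions. -/
def signWeight (β y : ℝ) : ℝ := 2 * (β * y * fermiBoseMean (β * y))

theorem summable_signWeight {κ : Type*} {y : κ → ℝ} (hy : HasPartition y) (hy0 : ∀ k, 0 < y k)
    {β : ℝ} (hβ : 0 < β) : Summable fun k => |signWeight β (y k)| := by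
  refine ((hy.summable_mul_fermiBoseMean hy0 hβ).mul_left (2 * β)).congr fun i => ?_
  have := fermiBoseMean_nonneg (mul_pos hβ (hy0 i))
  have := hy0 i
  rw [abs_of_nonneg, signWeight]
  · ring
  · unfold signWeight
    positivity

/-- The function of the massive Dirac operator that gives the regularized sign. -/
def signFun (β l : ℝ) : ℝ := l / |l| * (β * |l| / Real.sinh (β * |l|))

theorem summable_signFun {κ : Type*} {a : κ → ℝ} (hm : 0 < m)
    (hp : HasPartition fun i => √(a i ^ 2 + m ^ 2)) {β : ℝ} (hβ : 0 < β) :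
    Summable fun k : κ × Bool => |signFun β (boolSign k.2 * √(a k.1 ^ 2 + m ^ 2))| := by
  have h0 : ∀ i, 0 < √(a i ^ 2 + m ^ 2) := fun i => sqrt_sq_add_sq_pos hm _
  refine (HasPartition.summable_prod_bool (summable_signWeight hp h0 hβ)).congr fun k => ?_
  rw [signFun, regularizedSign_apply hβ (h0 _), signWeight]

theorem regularizedSign_sub_regularizedSign (h : IsEigenbasis A b a) (h' : IsEigenbasis A' b' a')
    (hm : 0 < m) (hp : HasPartition fun i => √(a i ^ 2 + m ^ 2))
    (hp' : HasPartition fun i => √(a' i ^ 2 + m ^ 2)) {β : ℝ} (hβ : 0 < β) :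
    regularizedSign A m β - regularizedSign A' m β =
      rankOneSum (fun k : (ι ⊕ ι') × Bool =>
          diracVec (Sum.elim a a' k.1) m (Sum.elim b b' k.1) k.2)
        fun k => boolSign k.2 * (relSign k.1 *
          signWeight β (√(Sum.elim a a' k.1 ^ 2 + m ^ 2))) := by
  obtain ⟨B, hB, hBe⟩ := exists_isEigenbasis_massiveDirac h hm
  obtain ⟨B', hB', hBe'⟩ := exists_isEigenbasis_massiveDirac h' hm
  have h1 := opFun_sub_opFun hBe hBe' (φ := signFun β) (summable_signFun hm hp hβ)
    (summable_signFun hm hp' hβ)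
  refine Eq.trans (b := opFun (massiveDirac A m) (signFun β)
    - opFun (massiveDirac A' m) (signFun β)) rfl (h1.trans ?_)
  rw [← rankOneSum_comp_equiv (Equiv.sumProdDistrib ι ι' Bool).symm]
  congr 1
  · ext k : 1
    rcases k with k | k
    · exact hB k
    · exact hB' k
  · ext k
    rcases k with k | k
    · simp only [Sum.elim_inl, Function.comp_apply, Equiv.sumProdDistrib_symm_apply_left]
      rw [signFun, regularizedSign_apply hβ (sqrt_sq_add_sq_pos hm _), signWeight]
      simp [relSign]
    · simp only [Sum.elim_inr, Function.comp_apply, Equiv.sumProdDistrib_symm_apply_right]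
      rw [signFun, regularizedSign_apply hβ (sqrt_sq_add_sq_pos hm _), signWeight]
      simp [relSign]

theorem tsum_diracVec (hm : 0 < m) {κ : Type*} {v : κ → E} (hv : ∀ k, ‖v k‖ ≤ 1) {α w : κ → ℝ}
    (hw : Summable fun k => |w k|) :
    ∑' P : (κ × Bool) × (κ × Bool), boolSign P.1.2 * w P.1.1 * (boolSign P.2.2 * w P.2.1) *
        ⟪diracVec (α P.1.1) m (v P.1.1) P.1.2, diracVec (α P.2.1) m (v P.2.1) P.2.2⟫_ℝ ^ 2
      = ∑' p : κ × κ, w p.1 / √(α p.1 ^ 2 + m ^ 2) * (w p.2 / √(α p.2 ^ 2 + m ^ 2)) *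
        (2 * (α p.1 * α p.2 + m ^ 2) * ⟪v p.1, v p.2⟫_ℝ ^ 2) := by
  have hV : ∀ k : κ × Bool, ‖diracVec (α k.1) m (v k.1) k.2‖ ≤ 1 := fun k =>
    (norm_rotPair (mixCos_sq_add_mixSin_sq hm _) _ _).trans_le (hv _)
  have hs := summable_mul_mul_inner_sq hV (HasPartition.summable_prod_bool hw)
    (HasPartition.summable_prod_bool hw)
  -- Reordered so that the four sign pairs are summed first, for a fixed pair of eigenvectors of `A`
  -- and `A'`.
  rw [← (Equiv.prodProdProdComm κ κ Bool Bool).tsum_eq]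
  rw [← (Equiv.prodProdProdComm κ κ Bool Bool).summable_iff] at hs
  rw [Summable.tsum_prod (by exact hs)]
  refine tsum_congr fun p => ?_
  rw [tsum_fintype, ← sum_boolSign_mul_inner_diracVec hm]
  have h1 := sqrt_sq_add_sq_pos hm (α p.1)
  have h2 := sqrt_sq_add_sq_pos hm (α p.2)
  rw [Finset.mul_sum, Finset.mul_sum]
  refine Finset.sum_congr rfl fun q _ => ?_
  simp only [Equiv.prodProdProdComm_apply]
  field_simp

theorem abs_mul_add_sq_le (hm : 0 < m) (x y : ℝ) :
    |x * y + m ^ 2| ≤ 2 * (√(x ^ 2 + m ^ 2) * √(y ^ 2 + m ^ 2)) := by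
  have h1 := abs_le_sqrt_sq_add_sq hm x
  have h2 := abs_le_sqrt_sq_add_sq hm y
  have h3 : m ≤ √(x ^ 2 + m ^ 2) := Real.le_sqrt_of_sq_le (by nlinarith [sq_nonneg x])
  have h4 : m ≤ √(y ^ 2 + m ^ 2) := Real.le_sqrt_of_sq_le (by nlinarith [sq_nonneg y])
  refine (abs_add_le _ _).trans ?_
  rw [abs_mul, abs_of_nonneg (sq_nonneg m), two_mul]
  refine add_le_add (mul_le_mul h1 h2 (abs_nonneg _) (Real.sqrt_nonneg _)) ?_
  exact (sq m).trans_le <| mul_le_mul h3 h4 hm.le (Real.sqrt_nonneg _)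

theorem summable_abs_diracHeat {κ : Type*} {α : κ → ℝ} (hm : 0 < m)
    (hy : HasPartition fun k => √(α k ^ 2 + m ^ 2)) {t : ℝ} (ht : 0 < t) :
    Summable fun k => |α k * Real.exp (-t * α k ^ 2)| := by
  have h0 : ∀ i, 0 < √(α i ^ 2 + m ^ 2) := fun i => sqrt_sq_add_sq_pos hm _
  refine ((hy.summable_mul_exp_sq h0 ht).mul_left (Real.exp (t * m ^ 2))).of_nonneg_of_le
    (fun _ => abs_nonneg _) fun k => ?_
  rw [abs_mul, abs_of_nonneg (Real.exp_nonneg _), mul_left_comm, ← Real.exp_add,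
    Real.sq_sqrt (by positivity)]
  have e : t * m ^ 2 + -t * (α k ^ 2 + m ^ 2) = -t * α k ^ 2 := by ring
  rw [e]
  exact mul_le_mul_of_nonneg_right (abs_le_sqrt_sq_add_sq hm _) (Real.exp_nonneg _)

theorem summable_abs_sqHeat {κ : Type*} {α : κ → ℝ}
    (hy : HasPartition fun k => √(α k ^ 2 + m ^ 2)) {t : ℝ} (ht : 0 < t) :
    Summable fun k => |Real.exp (-t * α k ^ 2)| := by
  refine (summable_abs_heat hy m ht).congr fun k => ?_
  rw [Real.sq_sqrt (by positivity), add_sub_cancel_right]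

/-- As for bosons, with the weight `β² (α α' + m²)`. This weight grows like the product of the
frequencies, so the absolute convergence requires summability of `ω` times the mean function. -/
theorem relRank_fermion {κ : Type*} [Countable κ] {v : κ → E} {σ α : κ → ℝ}
    (hv : ∀ k, ‖v k‖ ≤ 1) (hσ : ∀ k, |σ k| = 1) (hm : 0 < m)
    (hy : HasPartition fun k => √(α k ^ 2 + m ^ 2)) {β : ℝ} (hβ : 0 < β) {Φ Ψ : ℝ → ℝ → ℝ}
    (hΦ : ∀ t s, 0 < t → 0 < s → Φ t s = opTrace
      (rankOneSum v (fun k => σ k * (α k * Real.exp (-t * α k ^ 2))) ∘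
        rankOneSum v (fun k => σ k * (α k * Real.exp (-s * α k ^ 2)))))
    (hΨ : ∀ t s, 0 < t → 0 < s → Ψ t s = opTrace
      (rankOneSum v (fun k => σ k * Real.exp (-t * α k ^ 2)) ∘
        rankOneSum v (fun k => σ k * Real.exp (-s * α k ^ 2)))) :
    IntegrableOn (fun p : ℝ × ℝ => h0 p.2 * h0 p.1
          * Real.exp (-m ^ 2 * β ^ 2 * (p.2 + p.1)) * (β ^ 2 * (Φ (β ^ 2 * p.1) (β ^ 2 * p.2)
            + m ^ 2 * Ψ (β ^ 2 * p.1) (β ^ 2 * p.2)))) (Ioi 0 ×ˢ Ioi 0) ∧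
      ∑' p : κ × κ, σ p.1 * σ p.2 * (β ^ 2 * (α p.1 * α p.2 + m ^ 2)) * ⟪v p.1, v p.2⟫_ℝ ^ 2 *
          (fermiBoseMean (β * √(α p.1 ^ 2 + m ^ 2)) * fermiBoseMean (β * √(α p.2 ^ 2 + m ^ 2)))
        = ∫ t in Ioi (0 : ℝ), ∫ s in Ioi (0 : ℝ), h0 s * h0 t
            * Real.exp (-m ^ 2 * β ^ 2 * (s + t)) * (β ^ 2 * (Φ (β ^ 2 * t) (β ^ 2 * s)
              + m ^ 2 * Ψ (β ^ 2 * t) (β ^ 2 * s))) := by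
  have hy0 : ∀ k, 0 < √(α k ^ 2 + m ^ 2) := fun k => sqrt_sq_add_sq_pos hm _
  have hβy : ∀ k, 0 < β * √(α k ^ 2 + m ^ 2) := fun k => mul_pos hβ (hy0 k)
  have hsum : Summable fun p : κ × κ =>
      |σ p.1 * σ p.2 * (β ^ 2 * (α p.1 * α p.2 + m ^ 2)) * ⟪v p.1, v p.2⟫_ℝ ^ 2| *
      (fermiBoseMean (β * √(α p.1 ^ 2 + m ^ 2)) * fermiBoseMean (β * √(α p.2 ^ 2 + m ^ 2))) := by
    have hnn : ∀ k, 0 ≤ fermiBoseMean (β * √(α k ^ 2 + m ^ 2)) := fun k =>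
      fermiBoseMean_nonneg (hβy k)
    have h1 := hy.summable_mul_fermiBoseMean hy0 hβ
    have h2 := (h1.mul_of_nonneg h1 (fun k => mul_nonneg (hy0 k).le (hnn k))
      fun k => mul_nonneg (hy0 k).le (hnn k)).mul_left (2 * β ^ 2)
    refine h2.of_nonneg_of_le
      (fun p => mul_nonneg (abs_nonneg _) (mul_nonneg (hnn _) (hnn _))) fun p => ?_
    have h3 := abs_relWeight_le hv hσ p
    have h4 := abs_mul_add_sq_le hm (α p.1) (α p.2)
    have h5 : |σ p.1 * σ p.2 * (β ^ 2 * (α p.1 * α p.2 + m ^ 2)) * ⟪v p.1, v p.2⟫_ℝ ^ 2|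
        ≤ β ^ 2 * (2 * (√(α p.1 ^ 2 + m ^ 2) * √(α p.2 ^ 2 + m ^ 2))) := by
      calc _ = |σ p.1 * σ p.2 * ⟪v p.1, v p.2⟫_ℝ ^ 2| * (β ^ 2 * |α p.1 * α p.2 + m ^ 2|) := by
            rw [← abs_of_nonneg (sq_nonneg β), ← abs_mul, ← abs_mul, abs_of_nonneg (sq_nonneg β)]
            congr 1; ring
        _ ≤ 1 * (β ^ 2 * (2 * (√(α p.1 ^ 2 + m ^ 2) * √(α p.2 ^ 2 + m ^ 2)))) := by gcongr
        _ = _ := one_mul _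
    calc _ ≤ β ^ 2 * (2 * (√(α p.1 ^ 2 + m ^ 2) * √(α p.2 ^ 2 + m ^ 2))) *
          (fermiBoseMean (β * √(α p.1 ^ 2 + m ^ 2)) * fermiBoseMean (β * √(α p.2 ^ 2 + m ^ 2))) :=
          mul_le_mul_of_nonneg_right h5 (mul_nonneg (hnn _) (hnn _))
      _ = _ := by ring
  obtain ⟨hI1, hI2⟩ := double_laplace_tsum isLaplaceKernel_h0 isLaplaceKernel_h0
    isLaplaceKernel_h0 isLaplaceKernel_h0 (fun t ht => (abs_of_nonneg (h0_nonneg ht.le)).le)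
    (fun t ht => (abs_of_nonneg (h0_nonneg ht.le)).le) hβy hsum
  have hintegrand : ∀ t s, 0 < t → 0 < s → h0 t * h0 s * (∑' p : κ × κ,
        σ p.1 * σ p.2 * (β ^ 2 * (α p.1 * α p.2 + m ^ 2)) * ⟪v p.1, v p.2⟫_ℝ ^ 2 *
          (Real.exp (-t * (β * √(α p.1 ^ 2 + m ^ 2)) ^ 2) *
            Real.exp (-s * (β * √(α p.2 ^ 2 + m ^ 2)) ^ 2)))
      = h0 s * h0 t * Real.exp (-m ^ 2 * β ^ 2 * (s + t))
          * (β ^ 2 * (Φ (β ^ 2 * t) (β ^ 2 * s) + m ^ 2 * Ψ (β ^ 2 * t) (β ^ 2 * s))) := by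
    intro t s ht hs
    have ht' : 0 < β ^ 2 * t := by positivity
    have hs' : 0 < β ^ 2 * s := by positivity
    have hσs : ∀ {f : κ → ℝ}, (Summable fun k => |f k|) → Summable fun k => |σ k * f k| :=
      fun hf => by simpa [abs_mul, hσ] using hf
    have a1 := hσs (summable_abs_diracHeat hm hy ht')
    have a2 := hσs (summable_abs_diracHeat hm hy hs')
    have b1 := hσs (summable_abs_sqHeat hy ht')
    have b2 := hσs (summable_abs_sqHeat hy hs')
    have s1 := summable_mul_mul_inner_sq hv a1 a2
    have s2 := summable_mul_mul_inner_sq hv b1 b2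
    rw [hΦ _ _ ht' hs', hΨ _ _ ht' hs', opTrace_rankOneSum_comp hv a1 a2,
      opTrace_rankOneSum_comp hv b1 b2, ← s2.tsum_mul_left (m ^ 2),
      ← s1.tsum_add (s2.mul_left (m ^ 2)), mul_comm (h0 t), mul_assoc (h0 s * h0 t),
      ← tsum_mul_left (a := β ^ 2), ← tsum_mul_left (a := Real.exp (-m ^ 2 * β ^ 2 * (s + t)))]
    refine congrArg (fun z => h0 s * h0 t * z) (tsum_congr fun p => ?_)
    rw [exp_mul_exp_eq β m, Real.sq_sqrt (by positivity), Real.sq_sqrt (by positivity),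
      add_sub_cancel_right, add_sub_cancel_right]
    ring
  refine ⟨hI1.congr_fun (fun p hp => hintegrand _ _ hp.1 hp.2)
    (measurableSet_Ioi.prod measurableSet_Ioi), hI2.trans ?_⟩
  refine setIntegral_congr_fun measurableSet_Ioi fun t ht => ?_
  exact setIntegral_congr_fun measurableSet_Ioi fun s hs => hintegrand t s ht hs

/-- The conclusion of the theorem for a pair of Dirac operators. -/
theorem fermion_of_isEigenbasis [Countable ι] [Countable ι']
    (h : IsEigenbasis A b a) (h' : IsEigenbasis A' b' a') (hm : 0 < m)
    (hp : HasPartition fun i => √(a i ^ 2 + m ^ 2))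
    (hp' : HasPartition fun i => √(a' i ^ 2 + m ^ 2)) :
    (∀ t s : ℝ, 0 < t → 0 < s → IsTraceClass (relHeatOp (sqOp A) (sqOp A') t s) ∧
        IsTraceClass (relDiracHeatOp A A' t s)) ∧
      ∀ β : ℝ, 0 < β → IsTraceClass (fermionicOp A A' m β) ∧
        IntegrableOn (fun p : ℝ × ℝ => h0 p.2 * h0 p.1
          * Real.exp (-m ^ 2 * β ^ 2 * (p.2 + p.1))
          * (β ^ 2 * (relDiracHeatTrace A A' (β ^ 2 * p.1) (β ^ 2 * p.2)
              + m ^ 2 * relHeatTrace (sqOp A) (sqOp A') (β ^ 2 * p.1) (β ^ 2 * p.2))))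
          (Ioi 0 ×ˢ Ioi 0) ∧
        fermionicInvariant A A' m β =
          ∫ t in Ioi (0 : ℝ), ∫ s in Ioi (0 : ℝ), h0 s * h0 t
            * Real.exp (-m ^ 2 * β ^ 2 * (s + t))
            * (β ^ 2 * (relDiracHeatTrace A A' (β ^ 2 * t) (β ^ 2 * s)
                + m ^ 2 * relHeatTrace (sqOp A) (sqOp A') (β ^ 2 * t) (β ^ 2 * s))) := by
  have hv : ∀ k, ‖Sum.elim b b' k‖ ≤ 1 := norm_sumElim_le
  have hσ : ∀ k : ι ⊕ ι', |relSign k| = 1 := abs_relSign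
  have hy : HasPartition fun k : ι ⊕ ι' => √(Sum.elim a a' k ^ 2 + m ^ 2) := by
    have := hp.sumElim hp'
    convert! this using 1
    ext k; rcases k with k | k <;> rfl
  have hy0 : ∀ k : ι ⊕ ι', 0 < √(Sum.elim a a' k ^ 2 + m ^ 2) := fun k => sqrt_sq_add_sq_pos hm _
  have hσs : ∀ {f : ι ⊕ ι' → ℝ}, (Summable fun k => |f k|) →
      Summable fun k => |relSign k * f k| := fun hf => by simpa [abs_mul, hσ] using hf
  have hD : ∀ t, 0 < t → diracHeatOp A t - diracHeatOp A' t = rankOneSum (Sum.elim b b')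
      fun k => relSign k * (Sum.elim a a' k * Real.exp (-t * Sum.elim a a' k ^ 2)) := fun t ht =>
    opFun_sub_opFun h h' (φ := fun l => l * Real.exp (-t * l ^ 2))
      (summable_abs_diracHeat hm hp ht) (summable_abs_diracHeat hm hp' ht)
  have hH : ∀ t, 0 < t → heatOp (sqOp A) t - heatOp (sqOp A') t = rankOneSum (Sum.elim b b')
      fun k => relSign k * Real.exp (-t * Sum.elim a a' k ^ 2) := by
    intro t ht
    refine (opFun_sub_opFun h.sqOp h'.sqOp (φ := fun l => Real.exp (-t * l))
      (summable_abs_sqHeat hp ht) (summable_abs_sqHeat hp' ht)).trans ?_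
    congr 1
    ext k; rcases k with k | k <;> rfl
  have hsD := fun {t : ℝ} (ht : 0 < t) => hσs (summable_abs_diracHeat hm hy ht)
  have hsH := fun {t : ℝ} (ht : 0 < t) => hσs (summable_abs_sqHeat hy ht)
  have hV : ∀ k : (ι ⊕ ι') × Bool,
      ‖diracVec (Sum.elim a a' k.1) m (Sum.elim b b' k.1) k.2‖ ≤ 1 := fun k =>
    (norm_rotPair (mixCos_sq_add_mixSin_sq hm _) _ _).trans_le (hv _)
  refine ⟨fun t s ht hs => ⟨?_, ?_⟩, fun β hβ => ?_⟩
  · rw [relHeatOp, hH t ht, hH s hs]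
    exact isTraceClass_rankOneSum_comp hv (hsH ht) (hsH hs)
  · rw [relDiracHeatOp, hD t ht, hD s hs]
    exact isTraceClass_rankOneSum_comp hv (hsD ht) (hsD hs)
  have hw := hσs (summable_signWeight hy hy0 hβ)
  have hwB := HasPartition.summable_prod_bool hw
  have hR := regularizedSign_sub_regularizedSign h h' hm hp hp' hβ
  obtain ⟨hI1, hI2⟩ := relRank_fermion hv hσ hm hy hβ (Φ := relDiracHeatTrace A A')
    (Ψ := relHeatTrace (sqOp A) (sqOp A'))
    (fun t s ht hs => by rw [relDiracHeatTrace, relDiracHeatOp, hD t ht, hD s hs])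
    (fun t s ht hs => by rw [relHeatTrace, relHeatOp, hH t ht, hH s hs])
  refine ⟨?_, hI1, ?_⟩
  · rw [fermionicOp, hR]
    exact isTraceClass_rankOneSum_comp hV hwB hwB
  · rw [fermionicInvariant, fermionicOp, hR, opTrace_rankOneSum_comp hV hwB hwB,
      tsum_diracVec hm hv hw, ← tsum_mul_left, ← hI2]
    refine tsum_congr fun p => ?_
    have h1 := hy0 p.1
    have h2 := hy0 p.2
    -- The constants match: `1/8 · 2 · 2 · 2 = 1`, and the frequencies in the two weights cancel the
    -- denominators.
    unfold signWeight
    field_simp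
    ring

end Fermion

end Hilbert

/-! ### A Fourier estimate on the cube -/

section Torus

local instance : MeasureSpace UnitAddCircle := ⟨AddCircle.haarAddCircle⟩

local instance : IsProbabilityMeasure (volume : Measure UnitAddCircle) :=
  inferInstanceAs (IsProbabilityMeasure AddCircle.haarAddCircle)

/-- The exponential `exp (-2πi k·x)`. -/
def cubeExp {n : ℕ} (k : Fin n → ℤ) (x : Fin n → ℝ) : ℂ :=
  Complex.exp (((-(2 * Real.pi * ∑ i, (k i : ℝ) * x i) : ℝ) : ℂ) * Complex.I)

theorem mFourier_neg_coe {n : ℕ} (k : Fin n → ℤ) (x : Fin n → ℝ) :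
    UnitAddTorus.mFourier (-k) (fun i => (x i : UnitAddCircle)) = cubeExp k x := by
  simp only [UnitAddTorus.mFourier, ContinuousMap.coe_mk, fourier_coe_apply, cubeExp,
    Pi.neg_apply]
  rw [← Complex.exp_sum]
  congr 1
  push_cast
  rw [Finset.mul_sum, ← Finset.sum_neg_distrib, Finset.sum_mul]
  refine Finset.sum_congr rfl fun i _ => ?_
  simp only [div_one]
  ring

/-- A half-open unit cube is a fundamental domain of the torus, so a function supported there has
its own integrals over `ℝⁿ` as Fourier coefficients. -/
theorem hasSum_cube_parseval {n : ℕ} (c : Fin n → ℝ) {g : (Fin n → ℝ) → ℝ} (hg : Continuous g)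
    (hc : HasCompactSupport g)
    (hs : ∀ x, g x ≠ 0 → ∀ i, x i ∈ Ioc (c i) (c i + 1)) :
    HasSum (fun k : Fin n → ℤ => ‖∫ x, cubeExp k x * (g x : ℂ)‖ ^ 2) (∫ x, g x ^ 2) := by
  set Q : Set (Fin n → ℝ) := {x | ∀ i, x i ∈ Ioc (c i) (c i + 1)} with hQ
  let G : UnitAddTorus (Fin n) → ℂ := fun t => (g (UnitAddTorus.measurableEquivPiIoc c t).1 : ℂ)
  have hGx : ∀ x ∈ Q, G (fun i => (x i : UnitAddCircle)) = (g x : ℂ) := by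
    intro x hx
    have : UnitAddTorus.measurableEquivPiIoc c (fun i => (x i : UnitAddCircle)) = ⟨x, hx⟩ := by
      rw [← UnitAddTorus.coe_symm_measurableEquivPiIoc_apply c ⟨x, hx⟩,
        MeasurableEquiv.apply_symm_apply]
    simp only [G, this]
  have hGm : Measurable G :=
    Complex.measurable_ofReal.comp (hg.measurable.comp (measurable_subtype_coe.comp
      (UnitAddTorus.measurableEquivPiIoc c).measurable))
  obtain ⟨B, hB⟩ := hg.bounded_above_of_compact_support hc
  have hGL : MemLp G 2 (volume : Measure (UnitAddTorus (Fin n))) :=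
    MemLp.of_bound hGm.aestronglyMeasurable B (Filter.Eventually.of_forall fun t => by
      simpa [G] using hB _)
  have hQm : MeasurableSet Q := MeasurableSet.univ_pi' (fun i => measurableSet_Ioc)
  have hP := UnitAddTorus.hasSum_sq_mFourierCoeff (MemLp.toLp G hGL)
  have e1 : ∫ t, ‖(MemLp.toLp G hGL) t‖ ^ 2 = ∫ x, g x ^ 2 := by
    rw [integral_congr_ae (g := fun t => ‖G t‖ ^ 2)
      (hGL.coeFn_toLp.mono fun t ht => by simp only [ht]), UnitAddTorus.integral_preimage _ c,
      setIntegral_congr_fun (g := fun x => g x ^ 2) hQm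
        (fun x hx => by
          have := hGx x hx
          simp only [this, Complex.norm_real, Real.norm_eq_abs, sq_abs])]
    refine setIntegral_eq_integral_of_forall_compl_eq_zero fun x hx => ?_
    by_contra h
    exact hx (hs x fun h0 => h (by rw [h0]; norm_num))
  have e2 : ∀ k, UnitAddTorus.mFourierCoeff (MemLp.toLp G hGL) k = ∫ x, cubeExp k x * (g x : ℂ) := by
    intro k
    have : UnitAddTorus.mFourierCoeff (MemLp.toLp G hGL) k = UnitAddTorus.mFourierCoeff G k :=
      integral_congr_ae (hGL.coeFn_toLp.mono fun t ht => by simp only [ht])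
    rw [this, UnitAddTorus.mFourierCoeff_eq_integral _ _ c,
      setIntegral_congr_fun (g := fun x => cubeExp k x * (g x : ℂ)) hQm
        (fun x hx => by
          have := hGx x hx
          simp only [this, mFourier_neg_coe, smul_eq_mul])]
    refine setIntegral_eq_integral_of_forall_compl_eq_zero fun x hx => ?_
    by_contra h
    exact hx (hs x fun h0 => h (by rw [h0]; simp))
  rw [e1] at hP
  simpa only [e2] using hP

end Torus

theorem hasFDerivAt_cubeExp {n : ℕ} (k : Fin n → ℤ) (x : Fin n → ℝ) :
    HasFDerivAt (cubeExp k) (cubeExp k x • Complex.I • (Complex.ofRealCLM.comp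
      (-(2 * Real.pi) • ∑ i, (k i : ℝ) •
        ContinuousLinearMap.proj (R := ℝ) (φ := fun _ : Fin n => ℝ) i))) x := by
  unfold cubeExp
  have h1 : HasFDerivAt (fun x : Fin n → ℝ => -(2 * Real.pi * ∑ i, (k i : ℝ) * x i))
      (-(2 * Real.pi) • ∑ i, (k i : ℝ) • ContinuousLinearMap.proj (R := ℝ) (φ := fun _ => ℝ) i) x := by
    have := (-(2 * Real.pi) • ∑ i, (k i : ℝ) •
      ContinuousLinearMap.proj (R := ℝ) (φ := fun _ : Fin n => ℝ) i).hasFDerivAt (x := x)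
    convert! this using 1
    ext y
    simp
  have h2 := Complex.ofRealCLM.hasFDerivAt.comp x h1
  exact (h2.mul_const Complex.I).cexp

theorem integral_cubeExp_mul_fderiv {n : ℕ} (k : Fin n → ℤ) (i : Fin n) {g : (Fin n → ℝ) → ℝ}
    (hg : ContDiff ℝ 1 g) (hc : HasCompactSupport g) :
    ∫ x, cubeExp k x * ((fderiv ℝ g x (Pi.single i 1) : ℝ) : ℂ) =
      (2 * Real.pi * k i * Complex.I) * ∫ x, cubeExp k x * (g x : ℂ) := by
  have hf : ∀ x, HasFDerivAt (fun x => (g x : ℂ)) (Complex.ofRealCLM.comp (fderiv ℝ g x)) x :=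
    fun x => Complex.ofRealCLM.hasFDerivAt.comp x (hg.differentiable (by simp) x).hasFDerivAt
  have he : ∀ x, fderiv ℝ (cubeExp k) x (Pi.single i 1) =
      -(2 * Real.pi * k i * Complex.I) * cubeExp k x := fun x => by
    rw [(hasFDerivAt_cubeExp k x).fderiv]
    simp only [smul_apply, ContinuousLinearMap.comp_apply,
      sum_apply, ContinuousLinearMap.proj_apply, Pi.single_apply, smul_eq_mul, mul_ite, mul_one,
      mul_zero, Finset.sum_ite_eq', Finset.mem_univ, if_true, Complex.ofRealCLM_apply]
    push_cast
    ring
  have hec : Continuous (cubeExp k) :=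
    continuous_iff_continuousAt.2 fun x => (hasFDerivAt_cubeExp k x).continuousAt
  have hgc : Continuous fun x => (g x : ℂ) := Complex.continuous_ofReal.comp hg.continuous
  have hdc : Continuous fun x => ((fderiv ℝ g x (Pi.single i 1) : ℝ) : ℂ) :=
    Complex.continuous_ofReal.comp
      ((hg.continuous_fderiv (by simp)).clm_apply continuous_const)
  have hgs : HasCompactSupport (fun x => (g x : ℂ)) := hc.comp_left (g := Complex.ofReal) Complex.ofReal_zero
  have hds : HasCompactSupport fun x => ((fderiv ℝ g x (Pi.single i 1) : ℝ) : ℂ) :=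
    (hc.fderiv_apply (𝕜 := ℝ) (Pi.single i 1)).comp_left (g := Complex.ofReal) Complex.ofReal_zero
  have i1 : Integrable fun x => cubeExp k x * (g x : ℂ) :=
    (hec.mul hgc).integrable_of_hasCompactSupport hgs.mul_left
  have i2 : Integrable fun x => cubeExp k x * ((fderiv ℝ g x (Pi.single i 1) : ℝ) : ℂ) :=
    (hec.mul hdc).integrable_of_hasCompactSupport hds.mul_left
  have hfe : ∀ x, fderiv ℝ (fun x => (g x : ℂ)) x (Pi.single i 1) =
      ((fderiv ℝ g x (Pi.single i 1) : ℝ) : ℂ) := fun x => by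
    rw [(hf x).fderiv]
    rfl
  have heq : ∀ x, fderiv ℝ (cubeExp k) x (Pi.single i 1) * (g x : ℂ) =
      -(2 * Real.pi * k i * Complex.I) * (cubeExp k x * (g x : ℂ)) := fun x => by
    rw [he, mul_assoc]
  have key := integral_mul_fderiv_eq_neg_fderiv_mul_of_integrable (𝕜 := ℂ) (μ := volume)
    (f := cubeExp k) (g := fun x => (g x : ℂ)) (v := Pi.single i 1)
    ((i1.const_mul _).congr (Filter.Eventually.of_forall fun x => (heq x).symm))
    (i2.congr (Filter.Eventually.of_forall fun x => congrArg (cubeExp k x * ·) (hfe x).symm)) i1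
    (fun x _ => (hasFDerivAt_cubeExp k x).differentiableAt) (fun x _ => (hf x).differentiableAt)
  rw [integral_congr_ae (Filter.Eventually.of_forall heq), integral_const_mul] at key
  rw [← integral_congr_ae (Filter.Eventually.of_forall fun x =>
    congrArg (cubeExp k x * ·) (hfe x)), key]
  ring

/-- Parseval for `g` and for its partial derivatives. Outside the box of frequencies some `|k i|`
exceeds `N`, and the coefficient of `∂ᵢ g` is `2π k i` times that of `g`. -/
theorem integral_sq_le_fourier_pi {n : ℕ} (c : Fin n → ℝ) {g : (Fin n → ℝ) → ℝ}
    (hg : ContDiff ℝ 1 g) (hc : HasCompactSupport g)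
    (hs : ∀ x ∈ tsupport g, ∀ i, x i ∈ Ioc (c i) (c i + 1)) {N : ℕ} (hN : 0 < N) :
    ∫ x, g x ^ 2 ≤ ∑ k ∈ Fintype.piFinset fun _ : Fin n => Finset.Icc (-(N : ℤ)) N,
        ‖∫ x, cubeExp k x * (g x : ℂ)‖ ^ 2 +
      1 / N ^ 2 * ∑ i, ∫ x, fderiv ℝ g x (Pi.single i 1) ^ 2 := by
  have h0 := hasSum_cube_parseval c hg.continuous hc fun x hx => hs x (subset_tsupport _ hx)
  have h1 : ∀ i, HasSum (fun k : Fin n → ℤ => ‖(2 * Real.pi * k i * Complex.I) *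
      ∫ x, cubeExp k x * (g x : ℂ)‖ ^ 2) (∫ x, fderiv ℝ g x (Pi.single i 1) ^ 2) := fun i => by
    have := hasSum_cube_parseval c (g := fun x => fderiv ℝ g x (Pi.single i 1))
      ((hg.continuous_fderiv (by simp)).clm_apply continuous_const)
      (hc.fderiv_apply (𝕜 := ℝ) _) fun x hx => hs x ?_
    · simpa only [integral_cubeExp_mul_fderiv _ i hg hc] using this
    · exact (tsupport_fderiv_apply_subset ℝ _) (subset_tsupport _ hx)
  have h2 := (hasSum_sum fun i (_ : i ∈ Finset.univ) => h1 i).mul_left (1 / (N : ℝ) ^ 2)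
  set s := Fintype.piFinset fun _ : Fin n => Finset.Icc (-(N : ℤ)) N
  have h3 := hasSum_sum_of_ne_finset_zero (L := SummationFilter.unconditional _) (f := fun k : Fin n → ℤ =>
    if k ∈ s then ‖∫ x, cubeExp k x * (g x : ℂ)‖ ^ 2 else 0) (s := s) (by simp_all)
  have h4 := h3.add h2
  rw [Finset.sum_congr rfl (g := fun k => ‖∫ x, cubeExp k x * (g x : ℂ)‖ ^ 2)
    (fun k hk => by simp [hk])] at h4
  refine hasSum_le (fun k => ?_) h0 h4
  have hN' : (0 : ℝ) < N := by exact_mod_cast hN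
  by_cases hk : k ∈ s
  · simp only [hk, if_true, le_add_iff_nonneg_right]
    positivity
  · simp only [hk, if_false, zero_add]
    obtain ⟨i, hi⟩ : ∃ i, k i ∉ Finset.Icc (-(N : ℤ)) N := by
      simpa [s, Fintype.mem_piFinset] using hk
    have hki : (N : ℝ) ^ 2 ≤ (k i : ℝ) ^ 2 := by
      have : (N : ℤ) ^ 2 ≤ (k i) ^ 2 := by
        rw [Finset.mem_Icc, not_and_or] at hi
        rcases hi with hi | hi <;> nlinarith
      exact_mod_cast this
    set z := ∫ x, cubeExp k x * (g x : ℂ)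
    -- The factor `4 π² (k i)² / N²` is at least one.
    have h5 : ‖z‖ ^ 2 ≤ 1 / (N : ℝ) ^ 2 * ‖(2 * Real.pi * k i * Complex.I) * z‖ ^ 2 := by
      rw [norm_mul, mul_pow, ← mul_assoc]
      refine le_mul_of_one_le_left (sq_nonneg _) ?_
      rw [one_div, ← div_eq_inv_mul, le_div_iff₀ (by positivity), one_mul]
      simp only [norm_mul, Complex.norm_real, Complex.norm_I, Complex.norm_ofNat,
        Complex.norm_intCast, mul_one, mul_pow, Real.norm_eq_abs, sq_abs]
      nlinarith [mul_self_nonneg ((k i : ℝ)), mul_le_mul_of_nonneg_right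
        (by nlinarith [Real.pi_gt_three] : (1 : ℝ) ≤ 2 ^ 2 * Real.pi ^ 2) (sq_nonneg (k i : ℝ))]
    refine h5.trans (mul_le_mul_of_nonneg_left ?_ (by positivity))
    exact Finset.single_le_sum (f := fun i => ‖(2 * Real.pi * k i * Complex.I) * z‖ ^ 2)
      (fun i _ => sq_nonneg _) (Finset.mem_univ i)

/-- A smooth function supported in a unit cube is controlled by its Fourier coefficients of
frequency at most `N` and, with a factor `1 / N²`, its gradient. -/
theorem integral_sq_le_fourier {n : ℕ} (c : Fin n → ℝ) {g : EuclideanSpace ℝ (Fin n) → ℝ}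
    (hg : ContDiff ℝ 1 g) (hc : HasCompactSupport g)
    (hs : ∀ x ∈ tsupport g, ∀ i, x i ∈ Ioc (c i) (c i + 1)) {N : ℕ} (hN : 0 < N) :
    ∫ x, g x ^ 2 ≤ ∑ k ∈ Fintype.piFinset fun _ : Fin n => Finset.Icc (-(N : ℤ)) N,
        ‖∫ x, cubeExp k x.ofLp * (g x : ℂ)‖ ^ 2 +
      1 / N ^ 2 * ∑ i, ∫ x, fderiv ℝ g x (EuclideanSpace.single i 1) ^ 2 := by
  let L := (EuclideanSpace.equiv (Fin n) ℝ).symm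
  have hL : ContDiff ℝ 1 (g ∘ L) := hg.comp L.contDiff
  have key := integral_sq_le_fourier_pi c hL (hc.comp_homeomorph L.toHomeomorph) (fun x hx i => by
    have : L x ∈ tsupport g := by
      have h := tsupport_comp_subset_preimage g L.continuous hx
      exact h
    exact hs _ this i) hN
  have mp := EuclideanSpace.volume_preserving_symm_measurableEquiv_toLp (Fin n)
  have tr : ∀ (E : Type) [NormedAddCommGroup E] [NormedSpace ℝ E]
      (φ : EuclideanSpace ℝ (Fin n) → E), ∫ x : Fin n → ℝ, φ (L x) = ∫ x, φ x := by
    intro E _ _ φ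
    exact (PiLp.volume_preserving_toLp (Fin n)).integral_comp
      (MeasurableEquiv.toLp 2 (Fin n → ℝ)).measurableEmbedding φ
  have d : ∀ x i, fderiv ℝ (g ∘ L) x (Pi.single i 1) =
      fderiv ℝ g (L x) (EuclideanSpace.single i 1) := fun x i => by
    rw [(((hg.differentiable (by simp)) (L x)).hasFDerivAt.comp x L.hasFDerivAt).fderiv]
    rfl
  simp only [d] at key
  have e1 := tr ℝ (fun x => g x ^ 2)
  have e2 := fun i => tr ℝ (fun x => fderiv ℝ g x (EuclideanSpace.single i 1) ^ 2)
  have e3 := fun k => tr ℂ (fun x => cubeExp k x.ofLp * (g x : ℂ))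
  simp only [← e1, ← e2, ← e3]
  exact key

/-! ### Hadamard's lemma and positive definite matrix functions -/

/-- Repeated differentiation under the integral. The target `F` is quantified inside the induction
since the derivative takes values in `E →L[ℝ] F`; compactness of a ball times `[0, 1]` gives the
dominating constant. -/
theorem contDiff_nat_integral {E : Type} [NormedAddCommGroup E] [NormedSpace ℝ E] [ProperSpace E]
    (k : ℕ) : ∀ {F : Type} [NormedAddCommGroup F] [NormedSpace ℝ F] {φ : E × ℝ → F},
    ContDiff ℝ ∞ φ → ContDiff ℝ k fun y => ∫ t in (0 : ℝ)..1, φ (y, t) := by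
  induction k with
  | zero =>
    intro F _ _ φ h
    refine contDiff_zero.2 ?_
    exact intervalIntegral.continuous_parametric_intervalIntegral_of_continuous'
      (f := fun y t => φ (y, t)) h.continuous 0 1
  | succ k ih =>
    intro F _ _ φ h
    let φ' : E × ℝ → E →L[ℝ] F := fun z => (fderiv ℝ φ z).comp (ContinuousLinearMap.inl ℝ E ℝ)
    have h' : ContDiff ℝ ∞ φ' :=
      (h.fderiv_right (m := ∞) (by simp)).clm_comp contDiff_const
    refine contDiff_succ_iff_hasFDerivAt.2 ⟨fun y => ∫ t in (0 : ℝ)..1, φ' (y, t), ih h', fun y => ?_⟩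
    have hd : ∀ z t, HasFDerivAt (fun x => φ (x, t)) (φ' (z, t)) z := fun z t =>
      (h.differentiable (by simp) (z, t)).hasFDerivAt.comp z (hasFDerivAt_prodMk_left z t)
    obtain ⟨B, hB⟩ := ((isCompact_closedBall y 1).prod (isCompact_Icc (a := (0 : ℝ)) (b := 1)))
      |>.exists_bound_of_continuousOn h'.continuous.continuousOn
    refine intervalIntegral.hasFDerivAt_integral_of_dominated_of_fderiv_le
      (F := fun y t => φ (y, t)) (F' := fun y t => φ' (y, t)) (bound := fun _ => B)
      (Metric.closedBall_mem_nhds y one_pos) ?_ ?_ ?_ ?_ ?_ ?_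
    · exact Filter.Eventually.of_forall fun x =>
        (h.continuous.comp (by fun_prop : Continuous fun t : ℝ => (x, t))).aestronglyMeasurable
    · exact (h.continuous.comp (by fun_prop : Continuous fun t : ℝ => (y, t))).intervalIntegrable _ _
    · exact (h'.continuous.comp (by fun_prop : Continuous fun t : ℝ => (y, t))).aestronglyMeasurable
    · refine Filter.Eventually.of_forall fun t ht x hx => hB _ ⟨hx, ?_⟩
      rw [uIoc_of_le zero_le_one] at ht
      exact ⟨ht.1.le, ht.2⟩
    · exact intervalIntegrable_const
    · exact Filter.Eventually.of_forall fun t _ x _ => hd x t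

/-- Integrate the derivative of `f` along the segment from `x` to `y` and expand `y - x` in
coordinates. -/
theorem exists_hadamard {n : ℕ} {f : EuclideanSpace ℝ (Fin n) → ℝ} (hf : ContDiff ℝ ∞ f)
    (x : EuclideanSpace ℝ (Fin n)) :
    ∃ g : Fin n → EuclideanSpace ℝ (Fin n) → ℝ, (∀ i, ContDiff ℝ ∞ (g i)) ∧
      (∀ i, g i x = fderiv ℝ f x (EuclideanSpace.single i 1)) ∧
      ∀ y, f y - f x = ∑ i, (y i - x i) * g i y := by
  refine ⟨fun i y => ∫ t in (0 : ℝ)..1, fderiv ℝ f (x + t • (y - x)) (EuclideanSpace.single i 1),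
    fun i => contDiff_infty.2 fun k => contDiff_nat_integral k (φ := fun z =>
      fderiv ℝ f (x + z.2 • (z.1 - x)) (EuclideanSpace.single i 1)) ?_, fun i => by simp,
      fun y => ?_⟩
  · exact ((hf.fderiv_right (m := ∞) (by simp)).comp (by fun_prop)).clm_apply contDiff_const
  · have hc : ∀ v, Continuous fun t : ℝ => fderiv ℝ f (x + t • (y - x)) v := fun v =>
      ((hf.continuous_fderiv (by simp)).comp (by fun_prop)).clm_apply continuous_const
    have hv : y - x = ∑ i, (y i - x i) • EuclideanSpace.single i (1 : ℝ) := by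
      ext j
      simp [Finset.sum_apply, Pi.single_apply]
    have h1 : ∀ t : ℝ, HasDerivAt (fun t : ℝ => f (x + t • (y - x)))
        (fderiv ℝ f (x + t • (y - x)) (y - x)) t := fun t => by
      have h2 : HasDerivAt (fun t : ℝ => x + t • (y - x)) (y - x) t := by
        simpa using ((hasDerivAt_id t).smul_const (y - x)).const_add x
      exact ((hf.differentiable (by simp) _).hasFDerivAt).comp_hasDerivAt t h2
    have h3 := intervalIntegral.integral_eq_sub_of_hasDerivAt (a := 0) (b := 1) (fun t _ => h1 t)
      ((hc _).intervalIntegrable _ _)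
    rw [zero_smul, one_smul, add_zero, add_sub_cancel] at h3
    rw [← h3]
    have h4 : ∀ t : ℝ, fderiv ℝ f (x + t • (y - x)) (y - x) =
        ∑ i, (y i - x i) * fderiv ℝ f (x + t • (y - x)) (EuclideanSpace.single i 1) := fun t => by
      conv_lhs => rw [hv]
      rw [map_sum]
      simp only [map_smul, smul_eq_mul]
      -- The expansion of `y - x` was also performed in the base point of the derivative; it is
      -- folded back there.
      rw [← hv]
    simp only [h4]
    rw [intervalIntegral.integral_finsetSum fun i _ => ((hc _).const_mul _).intervalIntegrable _ _]
    simp only [intervalIntegral.integral_const_mul]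

/-- A continuous matrix function which is positive definite at a point is uniformly so nearby. -/
theorem eventually_quadratic_ge {X ι : Type*} [TopologicalSpace X] [Fintype ι] {Q : ι → ι → X → ℝ}
    (hQ : ∀ i j, Continuous (Q i j)) {x₀ : X}
    (hpos : ∀ p : ι → ℝ, p ≠ 0 → 0 < ∑ i, ∑ j, Q i j x₀ * (p i * p j)) :
    ∃ c : ℝ, 0 < c ∧ ∀ᶠ x in nhds x₀, ∀ p : ι → ℝ,
      c * ∑ i, p i ^ 2 ≤ ∑ i, ∑ j, Q i j x * (p i * p j) := by
  -- The Euclidean unit sphere; the general vector follows by homogeneity.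
  set K : Set (ι → ℝ) := {p | ∑ i, p i ^ 2 = 1}
  have hK : IsCompact K := by
    refine Metric.isCompact_of_isClosed_isBounded
      (isClosed_eq (by fun_prop) continuous_const) ?_
    refine (Metric.isBounded_closedBall (x := (0 : ι → ℝ)) (r := 1)).subset fun p hp => ?_
    rw [mem_closedBall_zero_iff, pi_norm_le_iff_of_nonneg zero_le_one]
    intro i
    have : p i ^ 2 ≤ 1 := hp ▸ Finset.single_le_sum (f := fun i => p i ^ 2)
      (fun _ _ => sq_nonneg _) (Finset.mem_univ i)
    rw [Real.norm_eq_abs]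
    exact abs_le_one_iff_mul_self_le_one.2 (by nlinarith)
  have hcont : Continuous fun z : X × (ι → ℝ) => ∑ i, ∑ j, Q i j z.1 * (z.2 i * z.2 j) := by
    refine continuous_finsetSum _ fun i _ => continuous_finsetSum _ fun j _ => ?_
    exact ((hQ i j).comp continuous_fst).mul (by fun_prop)
  have hKne : ∀ p ∈ K, p ≠ 0 := by
    rintro p hp rfl
    simp [K] at hp
  obtain ⟨c, hc, hcK⟩ : ∃ c : ℝ, 0 < c ∧ ∀ p ∈ K, c < ∑ i, ∑ j, Q i j x₀ * (p i * p j) := by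
    rcases K.eq_empty_or_nonempty with h | h
    · exact ⟨1, one_pos, by simp [h]⟩
    · obtain ⟨p, hp, hmin⟩ := hK.exists_isMinOn h
        (hcont.comp (by fun_prop : Continuous fun p : ι → ℝ => (x₀, p))).continuousOn
      refine ⟨(∑ i, ∑ j, Q i j x₀ * (p i * p j)) / 2, half_pos (hpos p (hKne p hp)), fun q hq => ?_⟩
      exact (half_lt_self (hpos p (hKne p hp))).trans_le (hmin hq)
  refine ⟨c, hc, ?_⟩
  -- Tube lemma: a strict inequality valid on `{x₀} × K` holds on `U × K` for a neighbourhood `U`.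
  have key := hK.eventually_forall_of_forall_eventually (x₀ := x₀)
    (P := fun x p => c < ∑ i, ∑ j, Q i j x * (p i * p j))
    (fun p hp => hcont.continuousAt.eventually (lt_mem_nhds (hcK p hp)))
  filter_upwards [key] with x hx p
  by_cases hp : p = 0
  · simp [hp]
  have hs : 0 < ∑ i, p i ^ 2 := by
    obtain ⟨i, hi⟩ := Function.ne_iff.1 hp
    exact Finset.sum_pos' (fun i _ => sq_nonneg _) ⟨i, Finset.mem_univ _, sq_pos_of_ne_zero hi⟩
  set s := √(∑ i, p i ^ 2)
  have hs2 : s ^ 2 = ∑ i, p i ^ 2 := Real.sq_sqrt hs.le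
  have hs0 : 0 < s := Real.sqrt_pos.2 hs
  have h1 := hx (fun i => s⁻¹ * p i) (by
    simp only [K, mem_ofPred_eq, mul_pow, ← Finset.mul_sum, ← hs2]
    field_simp)
  have h2 : ∑ i, ∑ j, Q i j x * (s⁻¹ * p i * (s⁻¹ * p j)) =
      (∑ i, ∑ j, Q i j x * (p i * p j)) / s ^ 2 := by
    rw [Finset.sum_div]
    refine Finset.sum_congr rfl fun i _ => ?_
    rw [Finset.sum_div]
    refine Finset.sum_congr rfl fun j _ => ?_
    field_simp
  rw [h2, lt_div_iff₀ (by positivity), hs2] at h1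
  exact h1.le

/-! ### Functions in a chart -/

section Chart

variable {n : ℕ} {M : Type*} [TopologicalSpace M] [ChartedSpace (EuclideanSpace ℝ (Fin n)) M]
  [IsManifold (𝓡 n) ∞ M] [CompactSpace M] [T2Space M]

/-- The chart at a point. -/
abbrev chrt (x₀ : M) : OpenPartialHomeomorph M (EuclideanSpace ℝ (Fin n)) :=
  chartAt (EuclideanSpace ℝ (Fin n)) x₀

/-- A function of the coordinates, cut off by a bump function. -/
def chartFun {x₀ : M} (χ : SmoothBumpFunction (𝓡 n) x₀) (g : EuclideanSpace ℝ (Fin n) → ℝ)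
    (hg : ContDiff ℝ ∞ g) : C^∞⟮𝓡 n, M; ℝ⟯ :=
  ⟨fun x => χ x • g (chrt x₀ x),
    χ.contMDiff_smul (hg.contMDiff.comp_contMDiffOn contMDiffOn_chart)⟩

theorem chartFun_apply {x₀ : M} (χ : SmoothBumpFunction (𝓡 n) x₀)
    (g : EuclideanSpace ℝ (Fin n) → ℝ) (hg : ContDiff ℝ ∞ g) (x : M) :
    chartFun χ g hg x = χ x * g (chrt x₀ x) := rfl

/-- The coordinate functions, cut off by a bump function. -/
def coordFun {x₀ : M} (χ : SmoothBumpFunction (𝓡 n) x₀) (i : Fin n) : C^∞⟮𝓡 n, M; ℝ⟯ :=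
  chartFun χ (fun y => y i) (by fun_prop)

/-- A function in the coordinates of a chart, extended by zero. -/
def chartPush (x₀ : M) (f : M → ℝ) : EuclideanSpace ℝ (Fin n) → ℝ :=
  indicator (chrt x₀).target (f ∘ (chrt x₀).symm)

theorem chartPush_apply {x₀ x : M} (hx : x ∈ (chrt x₀ (n := n)).source) (f : M → ℝ) :
    chartPush x₀ f (chrt (n := n) x₀ x) = f x := by
  rw [chartPush, indicator_of_mem ((chrt x₀).map_source hx), Function.comp_apply,
    (chrt x₀).left_inv hx]

theorem chartPush_eventuallyEq_zero {x₀ : M} {f : M → ℝ} (hf : tsupport f ⊆ (chrt x₀ (n := n)).source)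
    {y : EuclideanSpace ℝ (Fin n)} (hy : y ∉ chrt (n := n) x₀ '' tsupport f) :
    chartPush x₀ f =ᶠ[nhds y] 0 := by
  have hc : IsClosed (chrt (n := n) x₀ '' tsupport f) :=
    ((isClosed_tsupport f).isCompact.image_of_continuousOn
      ((chrt x₀).continuousOn.mono hf)).isClosed
  filter_upwards [hc.isOpen_compl.mem_nhds hy] with z hz
  by_cases hzt : z ∈ (chrt (n := n) x₀).target
  · rw [chartPush, indicator_of_mem hzt, Function.comp_apply]
    refine image_eq_zero_of_notMem_tsupport fun h => hz ⟨_, h, (chrt x₀).right_inv hzt⟩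
  · simp [chartPush, indicator_of_notMem hzt]

theorem tsupport_chartPush {x₀ : M} {f : M → ℝ} (hf : tsupport f ⊆ (chrt x₀ (n := n)).source) :
    tsupport (chartPush (n := n) x₀ f) ⊆ chrt x₀ '' tsupport f := by
  intro y hy
  by_contra h
  exact notMem_tsupport_iff_eventuallyEq.2 (chartPush_eventuallyEq_zero hf h) hy

theorem hasCompactSupport_chartPush {x₀ : M} {f : M → ℝ}
    (hf : tsupport f ⊆ (chrt x₀ (n := n)).source) :
    HasCompactSupport (chartPush (n := n) x₀ f) :=
  ((isClosed_tsupport f).isCompact.image_of_continuousOn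
    ((chrt x₀).continuousOn.mono hf)).of_isClosed_subset (isClosed_tsupport _)
    (tsupport_chartPush hf)

theorem contDiff_chartPush {x₀ : M} (f : C^∞⟮𝓡 n, M; ℝ⟯)
    (hf : tsupport f ⊆ (chrt x₀ (n := n)).source) :
    ContDiff ℝ ∞ (chartPush (n := n) x₀ f) := by
  rw [contDiff_iff_contDiffAt]
  intro y
  by_cases hy : y ∈ chrt x₀ '' tsupport f
  · have hyt : y ∈ (chrt x₀).target := by
      obtain ⟨x, hx, rfl⟩ := hy
      exact (chrt x₀).map_source (hf hx)
    have h1 : ContMDiffAt (𝓡 n) 𝓘(ℝ, ℝ) ∞ (f ∘ (chrt x₀).symm) y :=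
      f.contMDiff.contMDiffAt.comp y
        (contMDiffOn_chart_symm.contMDiffAt ((chrt x₀).open_target.mem_nhds hyt))
    refine h1.contDiffAt.congr_of_eventuallyEq ?_
    filter_upwards [(chrt x₀).open_target.mem_nhds hyt] with z hz
    exact indicator_of_mem hz _
  · exact contDiffAt_const.congr_of_eventuallyEq (chartPush_eventuallyEq_zero hf hy)

/-- A derivation at a point is a combination of the partial derivatives. -/
theorem derivation_chart {x₀ : M} (χ : SmoothBumpFunction (𝓡 n) x₀) {W : Type*} [AddCommGroup W]
    [Module ℝ W] (X : C^∞⟮𝓡 n, M; ℝ⟯ →ₗ[ℝ] W) {x : M}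
    (hX : ∀ f g, X (f * g) = f x • X g + g x • X f) (hx : x ∈ (chrt x₀ (n := n)).source)
    (hχ : χ =ᶠ[nhds x] 1) (f : C^∞⟮𝓡 n, M; ℝ⟯) (hf : tsupport f ⊆ (chrt x₀ (n := n)).source) :
    X f = ∑ i, fderiv ℝ (chartPush x₀ f) (chrt x₀ x) (EuclideanSpace.single i 1) •
      X (coordFun χ i) := by
  have hχx : χ x = 1 := hχ.eq_of_nhds
  let one' : C^∞⟮𝓡 n, M; ℝ⟯ := chartFun χ (fun _ => 1) contDiff_const
  have h1x : one' x = 1 := by simp [one', chartFun_apply, hχx]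
  have hX1 : X 1 = 0 := by
    have := hX 1 1
    simp only [mul_one, ContMDiffMap.coe_one, Pi.one_apply, one_smul] at this
    simpa using this
  -- Cut-off coordinates recentred at `x`. They vanish at `x`, so the derivation sees only the
  -- values at `x` of their cofactors.
  let η : Fin n → C^∞⟮𝓡 n, M; ℝ⟯ := fun i => coordFun χ i - (chrt x₀ x) i • one'
  have hηx : ∀ i, η i x = 0 := fun i => by
    simp [η, coordFun, chartFun_apply, hχx, h1x, one']
  have main : ∀ f : C^∞⟮𝓡 n, M; ℝ⟯, tsupport f ⊆ (chrt x₀ (n := n)).source →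
      X f = ∑ i, fderiv ℝ (chartPush x₀ f) (chrt x₀ x) (EuclideanSpace.single i 1) • X (η i) := by
    intro f hf
    obtain ⟨g, hg, hgx, hfg⟩ := exists_hadamard (contDiff_chartPush f hf) (chrt x₀ x)
    -- Hadamard's identity in the chart, multiplied by the square of the cut-off to hold on all of
    -- `M`: outside the chart both sides vanish.
    have e : one' * one' * (f - f x • 1) = ∑ i, η i * chartFun χ (g i) (hg i) := by
      ext z
      rw [ContMDiffMap.coe_mul, ContMDiffMap.coe_mul]
      have hs : (∑ i, η i * chartFun χ (g i) (hg i) : C^∞⟮𝓡 n, M; ℝ⟯) z =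
          ∑ i, η i z * chartFun χ (g i) (hg i) z := by
        rw [← ContMDiffMap.coeFnRingHom_apply, map_sum, Finset.sum_apply]
        rfl
      rw [hs]
      simp only [Pi.mul_apply, ContMDiffMap.coe_sub, Pi.sub_apply, ContMDiffMap.coe_smul,
        Pi.smul_apply, ContMDiffMap.coe_one, Pi.one_apply, smul_eq_mul, mul_one, one', η, coordFun,
        chartFun_apply]
      by_cases hz : z ∈ (chrt x₀ (n := n)).source
      · rw [← chartPush_apply (n := n) hz f, ← chartPush_apply (n := n) hx f, hfg, Finset.mul_sum]
        refine Finset.sum_congr rfl fun i _ => ?_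
        ring
      · have : χ z = 0 := by
          by_contra h
          exact hz (χ.support_subset_source h)
        simp [this]
    have h2 := congrArg X e
    rw [hX, map_sum] at h2
    simp only [hX, hηx, map_sub, map_smul, hX1, zero_smul, smul_zero, sub_zero,
      ContMDiffMap.coe_mul, ContMDiffMap.coe_sub, ContMDiffMap.coe_smul, Pi.mul_apply,
      Pi.sub_apply, Pi.smul_apply, h1x, ContMDiffMap.coe_one, Pi.one_apply, smul_eq_mul, mul_one,
      sub_self, add_zero, one_smul, zero_add, chartFun_apply, hχx, one_mul, hgx] at h2
    exact h2
  -- The cut-off is constant near `x`, so its partial derivatives there vanish and the formula just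
  -- proved kills it; recentring therefore changes nothing.
  have hXχ : X one' = 0 := by
    have hts : tsupport one' ⊆ (chrt x₀ (n := n)).source := by
      have : (one' : M → ℝ) = χ := by
        ext z
        simp [one', chartFun_apply]
      rw [this]
      exact χ.tsupport_subset_chartAt_source
    rw [main one' hts]
    refine Finset.sum_eq_zero fun i _ => ?_
    have : chartPush x₀ one' =ᶠ[nhds (chrt (n := n) x₀ x)] fun _ => 1 := by
      have h3 : ∀ᶠ y in nhds (chrt (n := n) x₀ x), χ ((chrt x₀).symm y) = 1 :=
        ((chrt x₀).tendsto_symm hx).eventually hχ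
      filter_upwards [h3, (chrt x₀).open_target.mem_nhds ((chrt x₀).map_source hx)] with y hy hyt
      rw [chartPush, indicator_of_mem hyt]
      simp [one', chartFun_apply, hy]
    rw [this.fderiv_eq]
    simp
  rw [main f hf]
  simp [η, hXχ]

theorem mdifferentiableAt_contMDiffMap (f : C^∞⟮𝓡 n, M; ℝ⟯) (x : M) :
    MDifferentiableAt (𝓡 n) 𝓘(ℝ, ℝ) f x :=
  f.contMDiff.mdifferentiable (by simp) x

/-- The differential at a point as a linear map. -/
def differentialLin (x : M) : C^∞⟮𝓡 n, M; ℝ⟯ →ₗ[ℝ] (TangentSpace (𝓡 n) x →L[ℝ] ℝ) where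
  toFun f := differential f x
  map_add' f g :=
    mfderiv_add (mdifferentiableAt_contMDiffMap f x) (mdifferentiableAt_contMDiffMap g x)
  map_smul' c f := const_smul_mfderiv (mdifferentiableAt_contMDiffMap f x) c

theorem differentialLin_apply (x : M) (f : C^∞⟮𝓡 n, M; ℝ⟯) :
    differentialLin x f = differential f x := rfl

theorem differentialLin_mul (x : M) (f g : C^∞⟮𝓡 n, M; ℝ⟯) :
    differentialLin x (f * g) = f x • differentialLin x g + g x • differentialLin x f :=
  ((mdifferentiableAt_contMDiffMap f x).hasMFDerivAt.mul
    (mdifferentiableAt_contMDiffMap g x).hasMFDerivAt).mfderiv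

/-- At the centre `x₀` the manifold derivative is computed in the very chart defining the
coordinates, where these differentials are the coordinate projections. -/
theorem coordFun_linearIndependent {x₀ : M} (χ : SmoothBumpFunction (𝓡 n) x₀) (c : Fin n → ℝ)
    (h : ∑ i, c i • differentialLin x₀ (coordFun χ i) = 0) : c = 0 := by
  have hd : ∀ i, HasMFDerivAt (𝓡 n) 𝓘(ℝ, ℝ) (coordFun χ i) x₀
      (EuclideanSpace.proj i : EuclideanSpace ℝ (Fin n) →L[ℝ] ℝ) := by
    intro i
    refine ⟨(coordFun χ i).contMDiff.continuous.continuousAt, ?_⟩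
    refine HasFDerivAt.hasFDerivWithinAt ?_
    refine (EuclideanSpace.proj (𝕜 := ℝ) i).hasFDerivAt.congr_of_eventuallyEq ?_
    have h3 : ∀ᶠ y in nhds (chrt (n := n) x₀ x₀), χ ((chrt x₀).symm y) = 1 :=
      ((chrt x₀).tendsto_symm (mem_chart_source _ x₀)).eventually χ.eventuallyEq_one
    have h4 := (chrt (n := n) x₀).open_target.mem_nhds
      ((chrt x₀).map_source (mem_chart_source _ x₀))
    filter_upwards [h3, h4] with y hy hyt
    have h5 : coordFun χ i ((chrt x₀).symm y) = y i := by
      simp [coordFun, chartFun_apply, hy, (chrt (n := n) x₀).right_inv hyt]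
    exact h5
  ext i
  have h5 : (∑ i, c i • (EuclideanSpace.proj i : EuclideanSpace ℝ (Fin n) →L[ℝ] ℝ)) = 0 := by
    refine Eq.trans (Finset.sum_congr rfl fun i _ => ?_) h
    rw [differentialLin_apply, differential, (hd i).mfderiv]
    rfl
  have h6 := DFunLike.congr_fun h5 (EuclideanSpace.single i (1 : ℝ))
  simpa [sum_apply, Pi.single_apply] using h6

end Chart

/-! ### Algebra of Laplace type operators -/

section Laplace

variable {n : ℕ} {M : Type*} [TopologicalSpace M] [ChartedSpace (EuclideanSpace ℝ (Fin n)) M]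
  [IsManifold (𝓡 n) ∞ M] [CompactSpace M] [T2Space M]
  {F : Type*} [NormedAddCommGroup F] [NormedSpace ℝ F]
  {V : M → Type*} [TopologicalSpace (TotalSpace F V)] [∀ x, NormedAddCommGroup (V x)]
  [∀ x, InnerProductSpace ℝ (V x)] [FiberBundle F V] [VectorBundle ℝ F V]

theorem mulSection_apply (f : C^∞⟮𝓡 n, M; ℝ⟯) (u : Cₛ^∞⟮𝓡 n; F, V⟯) (x : M) :
    mulSection f u x = f x • u x := rfl

theorem mulSection_add (f : C^∞⟮𝓡 n, M; ℝ⟯) (u v : Cₛ^∞⟮𝓡 n; F, V⟯) :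
    mulSection f (u + v) = mulSection f u + mulSection f v := by
  ext x
  exact smul_add _ _ _

theorem mulSection_smul (f : C^∞⟮𝓡 n, M; ℝ⟯) (c : ℝ) (u : Cₛ^∞⟮𝓡 n; F, V⟯) :
    mulSection f (c • u) = c • mulSection f u := by
  ext x
  exact smul_comm _ _ _

theorem add_mulSection (f g : C^∞⟮𝓡 n, M; ℝ⟯) (u : Cₛ^∞⟮𝓡 n; F, V⟯) :
    mulSection (f + g) u = mulSection f u + mulSection g u := by
  ext x
  exact add_smul _ _ _

theorem smul_mulSection (c : ℝ) (f : C^∞⟮𝓡 n, M; ℝ⟯) (u : Cₛ^∞⟮𝓡 n; F, V⟯) :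
    mulSection (c • f) u = c • mulSection f u := by
  ext x
  exact mul_smul c (f x) (u x)

theorem mul_mulSection (f g : C^∞⟮𝓡 n, M; ℝ⟯) (u : Cₛ^∞⟮𝓡 n; F, V⟯) :
    mulSection (f * g) u = mulSection f (mulSection g u) := by
  ext x
  exact mul_smul _ _ _

theorem mulSection_comm (f g : C^∞⟮𝓡 n, M; ℝ⟯) (u : Cₛ^∞⟮𝓡 n; F, V⟯) :
    mulSection f (mulSection g u) = mulSection g (mulSection f u) := by
  rw [← mul_mulSection, mul_comm, mul_mulSection]

/-- The commutator `[H, f]`, bilinear in the function and the section. -/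
def bracket (H : Cₛ^∞⟮𝓡 n; F, V⟯ →ₗ[ℝ] Cₛ^∞⟮𝓡 n; F, V⟯) :
    C^∞⟮𝓡 n, M; ℝ⟯ →ₗ[ℝ] Cₛ^∞⟮𝓡 n; F, V⟯ →ₗ[ℝ] Cₛ^∞⟮𝓡 n; F, V⟯ :=
  LinearMap.mk₂ ℝ (fun f u => H (mulSection f u) - mulSection f (H u))
    (fun f g u => by rw [add_mulSection, add_mulSection, map_add]; abel)
    (fun c f u => by rw [smul_mulSection, smul_mulSection, map_smul, smul_sub])
    (fun f u v => by rw [mulSection_add, map_add, map_add, mulSection_add]; abel)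
    (fun c f u => by rw [mulSection_smul, map_smul, map_smul, mulSection_smul, smul_sub])

theorem bracket_apply (H : Cₛ^∞⟮𝓡 n; F, V⟯ →ₗ[ℝ] Cₛ^∞⟮𝓡 n; F, V⟯) (f : C^∞⟮𝓡 n, M; ℝ⟯)
    (u : Cₛ^∞⟮𝓡 n; F, V⟯) : bracket H f u = H (mulSection f u) - mulSection f (H u) := rfl

/-- The cometric as a bilinear form. -/
def cometric (G : ∀ x : M, QuadraticForm ℝ (TangentSpace (𝓡 n) x →L[ℝ] ℝ)) (x : M)
    (f g : C^∞⟮𝓡 n, M; ℝ⟯) : ℝ :=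
  QuadraticMap.associated (R := ℝ) (G x) (differentialLin x f) (differentialLin x g)

/-- `G` is the leading symbol of `H`. -/
def IsSymbol (H : Cₛ^∞⟮𝓡 n; F, V⟯ →ₗ[ℝ] Cₛ^∞⟮𝓡 n; F, V⟯)
    (G : ∀ x : M, QuadraticForm ℝ (TangentSpace (𝓡 n) x →L[ℝ] ℝ)) : Prop :=
  (∀ x, (G x).PosDef) ∧
    ∀ (f : C^∞⟮𝓡 n, M; ℝ⟯) (u : Cₛ^∞⟮𝓡 n; F, V⟯) (x : M),
      H (mulSection f (mulSection f u)) x - (2 * f x) • H (mulSection f u) x + (f x) ^ 2 • H u x =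
        (-2 * G x (differential f x)) • u x

variable {H : Cₛ^∞⟮𝓡 n; F, V⟯ →ₗ[ℝ] Cₛ^∞⟮𝓡 n; F, V⟯}
  {G : ∀ x : M, QuadraticForm ℝ (TangentSpace (𝓡 n) x →L[ℝ] ℝ)}

theorem cometric_self (f : C^∞⟮𝓡 n, M; ℝ⟯) (x : M) :
    cometric G x f f = G x (differential f x) :=
  QuadraticMap.associated_eq_self_apply ℝ (G x) _

theorem cometric_comm (f g : C^∞⟮𝓡 n, M; ℝ⟯) (x : M) :
    cometric G x f g = cometric G x g f :=
  QuadraticMap.associated_isSymm ℝ (G x) _ _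

theorem doubleBracket_apply_self (hG : IsSymbol H G) (f : C^∞⟮𝓡 n, M; ℝ⟯)
    (u : Cₛ^∞⟮𝓡 n; F, V⟯) (x : M) :
    bracket (bracket H f) f u x = (-2 * cometric G x f f) • u x := by
  rw [cometric_self, ← hG.2]
  change (H (mulSection f (mulSection f u)) x - f x • H (mulSection f u) x)
    - f x • (H (mulSection f u) x - f x • H u x) = _
  module

theorem doubleBracket_comm (f g : C^∞⟮𝓡 n, M; ℝ⟯) (u : Cₛ^∞⟮𝓡 n; F, V⟯) :
    bracket (bracket H f) g u = bracket (bracket H g) f u := by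
  simp only [bracket_apply, mulSection_comm f g u]
  ext x
  change (H (mulSection g (mulSection f u)) x - f x • H (mulSection g u) x)
    - g x • (H (mulSection f u) x - f x • H u x) = (H (mulSection g (mulSection f u)) x
      - g x • H (mulSection f u) x) - f x • (H (mulSection g u) x - g x • H u x)
  module

theorem bracket_add_left (H H' : Cₛ^∞⟮𝓡 n; F, V⟯ →ₗ[ℝ] Cₛ^∞⟮𝓡 n; F, V⟯)
    (f : C^∞⟮𝓡 n, M; ℝ⟯) : bracket (H + H') f = bracket H f + bracket H' f := by
  ext u x
  change (H (mulSection f u) x + H' (mulSection f u) x) - f x • (H u x + H' u x) =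
    (H (mulSection f u) x - f x • H u x) + (H' (mulSection f u) x - f x • H' u x)
  module

/-- Polarization: the symbol is given on the diagonal only, and the two mixed double commutators
agree because multiplications commute. -/
theorem doubleBracket_apply (hG : IsSymbol H G) (f g : C^∞⟮𝓡 n, M; ℝ⟯)
    (u : Cₛ^∞⟮𝓡 n; F, V⟯) (x : M) :
    bracket (bracket H f) g u x = (-2 * cometric G x f g) • u x := by
  have h1 := doubleBracket_apply_self hG (f + g) u x
  have h2 : cometric G x (f + g) (f + g) =
      cometric G x f f + 2 * cometric G x f g + cometric G x g g := by
    have h3 := cometric_comm (G := G) f g x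
    simp only [cometric, map_add, LinearMap.add_apply] at h3 ⊢
    linarith
  rw [h2, map_add (bracket H) f g, bracket_add_left, LinearMap.add_apply, map_add (bracket (bracket H f)),
    map_add (bracket (bracket H g))] at h1
  change (bracket (bracket H f) f u x + bracket (bracket H f) g u x) +
    (bracket (bracket H g) f u x + bracket (bracket H g) g u x) = _ at h1
  rw [doubleBracket_apply_self hG, doubleBracket_apply_self hG, doubleBracket_comm g f] at h1
  have h4 : (2 : ℝ) • bracket (bracket H f) g u x = (2 : ℝ) • (-2 * cometric G x f g) • u x := by
    linear_combination (norm := module) h1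
  exact smul_right_injective _ (two_ne_zero' ℝ) h4

theorem bracket_mulSection (hG : IsSymbol H G) (f g : C^∞⟮𝓡 n, M; ℝ⟯) (u : Cₛ^∞⟮𝓡 n; F, V⟯)
    (x : M) : bracket H f (mulSection g u) x =
      g x • bracket H f u x + (-2 * cometric G x f g) • u x := by
  rw [← doubleBracket_apply hG]
  change _ = g x • bracket H f u x + (bracket H f (mulSection g u) x - g x • bracket H f u x)
  module

theorem bracket_mul (hG : IsSymbol H G) (f g : C^∞⟮𝓡 n, M; ℝ⟯) (u : Cₛ^∞⟮𝓡 n; F, V⟯) (x : M) :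
    bracket H (f * g) u x = f x • bracket H g u x + g x • bracket H f u x
      + (-2 * cometric G x f g) • u x := by
  rw [← sub_eq_iff_eq_add.2 ((bracket_mulSection hG f g u x).trans (add_comm _ _)),
    bracket_apply, mul_mulSection]
  change H (mulSection f (mulSection g u)) x - (f x * g x) • H u x =
    f x • (H (mulSection g u) x - g x • H u x) + g x • bracket H f u x +
      ((H (mulSection f (mulSection g u)) x - f x • H (mulSection g u) x) - g x • bracket H f u x)
  module

/-- The first order part of `H` in the sections `s`, `t` at a point, a derivation. -/
def connForm (H : Cₛ^∞⟮𝓡 n; F, V⟯ →ₗ[ℝ] Cₛ^∞⟮𝓡 n; F, V⟯) (s t : Cₛ^∞⟮𝓡 n; F, V⟯) (x : M) :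
    C^∞⟮𝓡 n, M; ℝ⟯ →ₗ[ℝ] ℝ where
  toFun f := ⟪bracket H f s x, t x⟫_ℝ - ⟪bracket H f t x, s x⟫_ℝ
  map_add' f g := by
    have h : ∀ u : Cₛ^∞⟮𝓡 n; F, V⟯, bracket H (f + g) u x = bracket H f u x + bracket H g u x :=
      fun u => by rw [map_add]; rfl
    rw [h, h, inner_add_left, inner_add_left]
    ring
  map_smul' c f := by
    have h : ∀ u : Cₛ^∞⟮𝓡 n; F, V⟯, bracket H (c • f) u x = c • bracket H f u x :=
      fun u => by rw [map_smul]; rfl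
    rw [h, h, real_inner_smul_left, real_inner_smul_left, RingHom.id_apply, smul_eq_mul]
    ring

theorem connForm_apply (s t : Cₛ^∞⟮𝓡 n; F, V⟯) (x : M) (f : C^∞⟮𝓡 n, M; ℝ⟯) :
    connForm H s t x f = ⟪bracket H f s x, t x⟫_ℝ - ⟪bracket H f t x, s x⟫_ℝ := rfl

/-- The Leibniz rule for `[H, f]` has the defect `-2 ⟨df, dg⟩`. Paired with `s` and `t` it is
symmetric in the two sections, hence drops out of the antisymmetrization. -/
theorem connForm_mul (hG : IsSymbol H G) (s t : Cₛ^∞⟮𝓡 n; F, V⟯) (x : M)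
    (f g : C^∞⟮𝓡 n, M; ℝ⟯) :
    connForm H s t x (f * g) = f x • connForm H s t x g + g x • connForm H s t x f := by
  simp only [connForm_apply, bracket_mul hG, inner_add_left, real_inner_smul_left, smul_eq_mul,
    real_inner_comm (s x) (t x)]
  ring

variable [MeasurableSpace M] [BorelSpace M] [IsContMDiffRiemannianBundle (𝓡 n) ∞ F V]

/-- The `L²` inner product of smooth sections. -/
def ip (μ : Measure M) (u v : Cₛ^∞⟮𝓡 n; F, V⟯) : ℝ := ∫ x, ⟪u x, v x⟫_ℝ ∂μ

variable (μ : Measure M) [IsFiniteMeasure μ]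

theorem ip_comm (u v : Cₛ^∞⟮𝓡 n; F, V⟯) : ip μ u v = ip μ v u := by
  simp only [ip, real_inner_comm]

theorem ip_add_left (u v w : Cₛ^∞⟮𝓡 n; F, V⟯) : ip μ (u + v) w = ip μ u w + ip μ v w := by
  simp only [ip]
  rw [← integral_add (integrable_inner_section μ u w) (integrable_inner_section μ v w)]
  exact integral_congr_ae (Filter.Eventually.of_forall fun x => inner_add_left _ _ _)

theorem ip_smul_left (c : ℝ) (u v : Cₛ^∞⟮𝓡 n; F, V⟯) : ip μ (c • u) v = c * ip μ u v := by
  simp only [ip]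
  rw [← integral_const_mul]
  exact integral_congr_ae (Filter.Eventually.of_forall fun x => real_inner_smul_left _ _ _)

theorem ip_add_right (u v w : Cₛ^∞⟮𝓡 n; F, V⟯) : ip μ u (v + w) = ip μ u v + ip μ u w := by
  rw [ip_comm, ip_add_left, ip_comm μ v, ip_comm μ w]

theorem ip_sub_left (u v w : Cₛ^∞⟮𝓡 n; F, V⟯) : ip μ (u - v) w = ip μ u w - ip μ v w := by
  rw [sub_eq_add_neg, ip_add_left, ← neg_one_smul ℝ v, ip_smul_left]
  ring

theorem ip_sub_right (u v w : Cₛ^∞⟮𝓡 n; F, V⟯) : ip μ u (v - w) = ip μ u v - ip μ u w := by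
  rw [ip_comm, ip_sub_left, ip_comm μ v, ip_comm μ w]

theorem ip_sum_left {ι : Type*} (s : Finset ι) (u : ι → Cₛ^∞⟮𝓡 n; F, V⟯) (v : Cₛ^∞⟮𝓡 n; F, V⟯) :
    ip μ (∑ i ∈ s, u i) v = ∑ i ∈ s, ip μ (u i) v := by
  classical
  induction s using Finset.induction_on with
  | empty =>
    have := ip_add_left μ 0 0 v
    rw [add_zero] at this
    rw [Finset.sum_empty, Finset.sum_empty]
    linarith
  | insert a s ha ih => rw [Finset.sum_insert ha, Finset.sum_insert ha, ip_add_left, ih]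

theorem ip_sum_right {ι : Type*} (s : Finset ι) (u : ι → Cₛ^∞⟮𝓡 n; F, V⟯)
    (v : Cₛ^∞⟮𝓡 n; F, V⟯) : ip μ v (∑ i ∈ s, u i) = ∑ i ∈ s, ip μ v (u i) := by
  rw [ip_comm, ip_sum_left]
  exact Finset.sum_congr rfl fun i _ => ip_comm ..

theorem ip_self_nonneg (u : Cₛ^∞⟮𝓡 n; F, V⟯) : 0 ≤ ip μ u u :=
  integral_nonneg fun _ => real_inner_self_nonneg

theorem ip_mulSection (f : C^∞⟮𝓡 n, M; ℝ⟯) (u v : Cₛ^∞⟮𝓡 n; F, V⟯) :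
    ip μ (mulSection f u) v = ip μ u (mulSection f v) := by
  simp only [ip, mulSection_apply, real_inner_smul_left, real_inner_smul_right]

variable {μ}

theorem ip_bracket (hs : ∀ u v, ip μ (H u) v = ip μ u (H v)) (f : C^∞⟮𝓡 n, M; ℝ⟯)
    (u v : Cₛ^∞⟮𝓡 n; F, V⟯) : ip μ (bracket H f u) v = -ip μ u (bracket H f v) := by
  rw [bracket_apply, bracket_apply, ip_sub_left, ip_sub_right, hs, ip_mulSection, ip_mulSection, hs]
  ring

/-- No regularity of `G` is assumed: the product is, up to a factor, the inner product of the smooth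
section `[[H, f], g] s` with `t`. On zero fibres `G` is not even determined by `H`, whence the
factor `⟪s x, t x⟫`. -/
theorem continuous_cometric_inner (hG : IsSymbol H G) (f g : C^∞⟮𝓡 n, M; ℝ⟯)
    (s t : Cₛ^∞⟮𝓡 n; F, V⟯) : Continuous fun x => cometric G x f g * ⟪s x, t x⟫_ℝ := by
  have := continuous_inner_section (bracket (bracket H f) g s) t
  simp only [doubleBracket_apply hG, real_inner_smul_left] at this
  convert! this.const_mul (-1 / 2 : ℝ) using 2
  ring

theorem continuous_connForm (f : C^∞⟮𝓡 n, M; ℝ⟯) (s t : Cₛ^∞⟮𝓡 n; F, V⟯) :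
    Continuous fun x => connForm H s t x f :=
  (continuous_inner_section _ _).sub (continuous_inner_section _ _)

theorem integrable_of_continuous {φ : M → ℝ} (h : Continuous φ) : Integrable φ μ :=
  h.integrable_of_hasCompactSupport (HasCompactSupport.of_compactSpace _)

/-- The quadratic form of `H` in terms of local coefficients. -/
theorem ip_laplace_mulSection (hG : IsSymbol H G) (hs : ∀ u v, ip μ (H u) v = ip μ u (H v))
    (f g : C^∞⟮𝓡 n, M; ℝ⟯) (s t : Cₛ^∞⟮𝓡 n; F, V⟯) :
    ip μ (H (mulSection f s)) (mulSection g t) =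
      ∫ x, (f x * g x * ⟪H s x, t x⟫_ℝ + 1 / 2 * (g x * connForm H s t x f) +
        cometric G x f g * ⟪s x, t x⟫_ℝ) ∂μ := by
  have hc := fun h : C^∞⟮𝓡 n, M; ℝ⟯ => h.contMDiff.continuous
  have e1 : ip μ (H (mulSection f s)) (mulSection g t) =
      ∫ x, f x * g x * ⟪H s x, t x⟫_ℝ ∂μ + ip μ (bracket H f s) (mulSection g t) := by
    have h1 : ip μ (mulSection f (H s)) (mulSection g t) =
        ∫ x, f x * g x * ⟪H s x, t x⟫_ℝ ∂μ := by
      simp only [ip, mulSection_apply, real_inner_smul_left, real_inner_smul_right]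
      congr 1
      ext x
      ring
    rw [← h1, bracket_apply, ip_sub_left]
    ring
  have e2 : ip μ (bracket H f s) (mulSection g t) = ∫ x, g x * ⟪bracket H f s x, t x⟫_ℝ ∂μ := by
    simp only [ip, mulSection_apply, real_inner_smul_right]
  have c1 : Continuous fun x => g x * ⟪bracket H f s x, t x⟫_ℝ :=
    (hc g).mul (continuous_inner_section _ _)
  have c2 : Continuous fun x => g x * ⟪bracket H f t x, s x⟫_ℝ :=
    (hc g).mul (continuous_inner_section _ _)
  have c3 := continuous_cometric_inner hG f g s t
  have c4 : Continuous fun x => 2 * (cometric G x f g * ⟪s x, t x⟫_ℝ) - g x *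
      ⟪bracket H f t x, s x⟫_ℝ := (c3.const_mul 2).sub c2
  have e3 : ip μ (bracket H f s) (mulSection g t) =
      ∫ x, (2 * (cometric G x f g * ⟪s x, t x⟫_ℝ) - g x * ⟪bracket H f t x, s x⟫_ℝ) ∂μ := by
    rw [ip_bracket hs, ip, ← integral_neg]
    congr 1
    ext x
    rw [bracket_mulSection hG, inner_add_right, real_inner_smul_right, real_inner_smul_right,
      real_inner_comm (s x)]
    ring
  -- The average of the direct expression and the one obtained from antisymmetry of `[H, f]`: the
  -- first order part becomes `connForm`, a derivation in `f`.
  have e4 : ip μ (bracket H f s) (mulSection g t) =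
      ∫ x, (1 / 2 * (g x * connForm H s t x f) + cometric G x f g * ⟪s x, t x⟫_ℝ) ∂μ := by
    have h := congrArg₂ (· + ·) e2 e3
    rw [← integral_add (integrable_of_continuous c1)
      (integrable_of_continuous c4), ← two_mul] at h
    rw [← mul_right_inj' (two_ne_zero' ℝ), h, ← integral_const_mul]
    congr 1
    ext x
    rw [connForm_apply]
    ring
  rw [e1, e4, ← integral_add]
  · congr 1
    ext x
    ring
  · exact integrable_of_continuous
      (((hc f).mul (hc g)).mul (continuous_inner_section _ _))
  · exact integrable_of_continuous
      ((((hc g).mul (continuous_connForm f s t)).const_mul _).add c3)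

end Laplace

/-! ### Smooth densities and local frames -/

theorem norm_sq_fourier_le {n : ℕ} (c : Fin n → ℝ) {g : EuclideanSpace ℝ (Fin n) → ℝ}
    (hg : Continuous g) (hc : HasCompactSupport g)
    (hs : ∀ x ∈ tsupport g, ∀ i, x i ∈ Ioc (c i) (c i + 1)) (k : Fin n → ℤ) :
    ‖∫ x, cubeExp k x.ofLp * (g x : ℂ)‖ ^ 2 ≤ ∫ x, g x ^ 2 := by
  let L := (EuclideanSpace.equiv (Fin n) ℝ).symm
  have h := hasSum_cube_parseval c (hg.comp L.continuous) (hc.comp_homeomorph L.toHomeomorph)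
    (fun x hx => hs (L x) (subset_tsupport _ hx))
  have tr : ∀ (E : Type) [NormedAddCommGroup E] [NormedSpace ℝ E]
      (φ : EuclideanSpace ℝ (Fin n) → E), ∫ x : Fin n → ℝ, φ (L x) = ∫ x, φ x := by
    intro E _ _ φ
    exact (PiLp.volume_preserving_toLp (Fin n)).integral_comp
      (MeasurableEquiv.toLp 2 (Fin n → ℝ)).measurableEmbedding φ
  have e1 := tr ℝ (fun x => g x ^ 2)
  have e3 := fun k => tr ℂ (fun x => cubeExp k x.ofLp * (g x : ℂ))
  rw [← e1, ← e3]
  exact le_hasSum h k fun _ _ => sq_nonneg _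

section Density

variable {n : ℕ} {M : Type*} [TopologicalSpace M] [ChartedSpace (EuclideanSpace ℝ (Fin n)) M]
  [MeasurableSpace M] [BorelSpace M] (μ : Measure M) [IsFiniteMeasure μ]

/-- A function on the chart, transported to the manifold and extended by zero. -/
def chartPull (x₀ : M) (ψ : EuclideanSpace ℝ (Fin n) → ℝ) : M → ℝ :=
  indicator (chrt (n := n) x₀).source (ψ ∘ chrt (n := n) x₀)

theorem integrable_chartPull (x₀ : M) {ψ : EuclideanSpace ℝ (Fin n) → ℝ} (hψ : Continuous ψ)
    (hc : HasCompactSupport ψ) : Integrable (chartPull x₀ ψ) μ := by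
  obtain ⟨B, hB⟩ := hψ.bounded_above_of_compact_support hc
  refine Integrable.of_bound (C := B) ?_ (Filter.Eventually.of_forall fun x => ?_)
  · refine (aestronglyMeasurable_indicator_iff (chrt x₀).open_source.measurableSet).2 ?_
    exact (hψ.comp_continuousOn (chrt x₀).continuousOn).aestronglyMeasurable
      (chrt x₀).open_source.measurableSet
  · exact (norm_indicator_le_norm_self _ _).trans (hB _)

/-- Near `x₀` the density lies between `r / 2` and `2 r`, where `r` is its value at `x₀`. This
replaces `μ` by Lebesgue measure in all local estimates. -/
theorem exists_density_bounds (hμ : IsSmoothDensity n μ) (x₀ : M) :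
    ∃ c C : ℝ, 0 < c ∧ 0 < C ∧ ∃ U ∈ nhds x₀, U ⊆ (chrt (n := n) x₀).source ∧
      ∀ ψ : EuclideanSpace ℝ (Fin n) → ℝ, Continuous ψ → HasCompactSupport ψ → (∀ y, 0 ≤ ψ y) →
        (∀ y, ψ y ≠ 0 → y ∈ chrt x₀ '' U) →
        c * ∫ y, ψ y ≤ ∫ x, chartPull x₀ ψ x ∂μ ∧ ∫ x, chartPull x₀ ψ x ∂μ ≤ C * ∫ y, ψ y := by
  obtain ⟨ρ, hρ, hρ0, hmap⟩ := hμ (chrt x₀) (chart_mem_atlas _ x₀)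
  set e := chrt (n := n) x₀
  have hx₀ : x₀ ∈ e.source := mem_chart_source _ x₀
  have hy₀ : e x₀ ∈ e.target := e.map_source hx₀
  have hr := hρ0 _ hy₀
  set r := ρ (e x₀)
  have hρc : ContinuousAt ρ (e x₀) :=
    (hρ.continuousOn).continuousAt (e.open_target.mem_nhds hy₀)
  have hev : ∀ᶠ y in nhds (e x₀), ρ y ∈ Ioo (r / 2) (2 * r) :=
    hρc.eventually (Ioo_mem_nhds (by linarith) (by linarith))
  refine ⟨r / 2, 2 * r, by linarith, by linarith, {x | x ∈ e.source ∧ ρ (e x) ∈ Ioo (r / 2) (2 * r)},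
    ?_, fun x hx => hx.1, fun ψ hψ hc h0 hsupp => ?_⟩
  · filter_upwards [e.open_source.mem_nhds hx₀, (e.continuousAt hx₀).eventually hev] with x h1 h2
    exact ⟨h1, h2⟩
  have hb : ∀ y, ψ y ≠ 0 → y ∈ e.target ∧ ρ y ∈ Ioo (r / 2) (2 * r) := by
    intro y hy
    obtain ⟨x, hx, rfl⟩ := hsupp y hy
    exact ⟨e.map_source hx.1, hx.2⟩
  have hm : MeasurableSet e.target := e.open_target.measurableSet
  have hρm : AEMeasurable ρ (volume.restrict e.target) := hρ.continuousOn.aemeasurable hm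
  have key : ∫ x, chartPull x₀ ψ x ∂μ = ∫ y in e.target, ρ y * ψ y := by
    rw [chartPull, integral_indicator e.open_source.measurableSet]
    have h1 : ∫ x in e.source, (ψ ∘ e) x ∂μ = ∫ y, ψ y ∂((μ.restrict e.source).map e) :=
      (integral_map (e.continuousOn.aemeasurable e.open_source.measurableSet)
        hψ.aestronglyMeasurable).symm
    rw [h1, hmap, integral_withDensity_eq_integral_toReal_smul₀ hρm.ennreal_ofReal
      (Filter.Eventually.of_forall fun _ => ENNReal.ofReal_lt_top)]
    refine setIntegral_congr_fun hm fun y hy => ?_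
    simp only [ENNReal.toReal_ofReal (hρ0 y hy).le, smul_eq_mul]
  have hint : Integrable ψ := hψ.integrable_of_hasCompactSupport hc
  have hset : ∫ y in e.target, ψ y = ∫ y, ψ y :=
    setIntegral_eq_integral_of_forall_compl_eq_zero fun y hy => by
      by_contra h
      exact hy (hb y h).1
  have hle : ∀ y, r / 2 * ψ y ≤ ρ y * ψ y ∧ ρ y * ψ y ≤ 2 * r * ψ y := by
    intro y
    by_cases h : ψ y = 0
    · simp [h]
    · exact ⟨mul_le_mul_of_nonneg_right (hb y h).2.1.le (h0 y),
        mul_le_mul_of_nonneg_right (hb y h).2.2.le (h0 y)⟩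
  have hint2 : IntegrableOn (fun y => ρ y * ψ y) e.target := by
    refine Integrable.mono' ((hint.const_mul (2 * r)).integrableOn)
      (hρm.aestronglyMeasurable.mul hψ.aestronglyMeasurable) ?_
    refine Filter.Eventually.of_forall fun y => ?_
    rw [Real.norm_of_nonneg ((mul_nonneg (by linarith) (h0 y)).trans (hle y).1)]
    exact (hle y).2
  rw [key, ← hset, ← integral_const_mul, ← integral_const_mul]
  exact ⟨integral_mono (hint.const_mul _).integrableOn hint2 fun y => (hle y).1,
    integral_mono hint2 (hint.const_mul _).integrableOn fun y => (hle y).2⟩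

end Density

section Frame

variable {n : ℕ} {M : Type*} [TopologicalSpace M] [ChartedSpace (EuclideanSpace ℝ (Fin n)) M]
  [IsManifold (𝓡 n) ∞ M] [CompactSpace M] [T2Space M]
  {F : Type*} [NormedAddCommGroup F] [NormedSpace ℝ F] [FiniteDimensional ℝ F]
  {V : M → Type*} [TopologicalSpace (TotalSpace F V)] [∀ x, NormedAddCommGroup (V x)]
  [∀ x, InnerProductSpace ℝ (V x)] [FiberBundle F V] [VectorBundle ℝ F V]
  [ContMDiffVectorBundle ∞ F V (𝓡 n)]

-- A trivialization carries an orthonormal basis of the fibre at `x₀` to a local frame, which a bump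
-- function extends to global sections. Orthonormality at the one point `x₀` is enough, as
-- positivity persists nearby. The factor `ρ` makes the local coefficients global smooth functions.
variable (F V) in
theorem exists_smooth_frame (x₀ : M) :
    ∃ (r : ℕ) (χ : SmoothBumpFunction (𝓡 n) x₀) (s : Fin r → Cₛ^∞⟮𝓡 n; F, V⟯),
      (∀ a b, ⟪s a x₀, s b x₀⟫_ℝ = if a = b then 1 else 0) ∧
      ∃ U ∈ nhds x₀, U ⊆ (chrt (n := n) x₀).source ∧ (∀ x ∈ U, χ =ᶠ[nhds x] 1) ∧
        (∀ x ∈ U, ∀ v : V x, ∃ w : Fin r → ℝ, v = ∑ a, w a • s a x) ∧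
        ∀ ρ : C^∞⟮𝓡 n, M; ℝ⟯, tsupport ρ ⊆ U →
          ∃ c : Fin r → Cₛ^∞⟮𝓡 n; F, V⟯ →ₗ[ℝ] C^∞⟮𝓡 n, M; ℝ⟯,
            (∀ a u, tsupport (c a u) ⊆ tsupport ρ) ∧
            ∀ u, mulSection ρ u = ∑ a, mulSection (c a u) (s a) := by
  let t := trivializationAt F V x₀
  have hx₀ : x₀ ∈ t.baseSet := FiberBundle.mem_baseSet_trivializationAt' x₀
  have hfin : FiniteDimensional ℝ (V x₀) :=
    Module.Finite.equiv (t.linearEquivAt ℝ x₀ hx₀).symm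
  let o := stdOrthonormalBasis ℝ (V x₀)
  let b : Module.Basis (Fin (Module.finrank ℝ (V x₀))) ℝ F :=
    o.toBasis.map (t.linearEquivAt ℝ x₀ hx₀)
  have h1 : ContMDiffVectorBundle 1 F V (𝓡 n) := ContMDiffVectorBundle.of_le (n := ∞) (by simp)
  obtain ⟨χ, -, hχ⟩ := (SmoothBumpFunction.nhds_basis_tsupport (I := 𝓡 n) x₀).mem_iff.1
    (t.open_baseSet.mem_nhds hx₀)
  let s : Fin (Module.finrank ℝ (V x₀)) → Cₛ^∞⟮𝓡 n; F, V⟯ := fun a =>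
    ⟨fun x => χ x • t.localFrame b a x, ContMDiffOn.smul_section_of_tsupport
      χ.contMDiff.contMDiffOn t.open_baseSet hχ (t.contMDiffOn_localFrame_baseSet ∞ b a)⟩
  have hsx : ∀ a x, s a x = χ x • t.localFrame b a x := fun _ _ => rfl
  obtain ⟨U, hU, hUo, hxU⟩ := eventually_nhds_iff.1 χ.eventuallyEq_one
  refine ⟨_, χ, s, fun i j => ?_, U ∩ (t.baseSet ∩ (chrt (n := n) x₀).source), ?_, fun x hx => hx.2.2,
    fun x hx => ?_, fun x hx v => ?_, fun ρ hρ => ?_⟩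
  · have : ∀ a, s a x₀ = o a := fun a => by
      rw [hsx, χ.eq_one, one_smul, t.localFrame_apply_of_mem_baseSet b hx₀]
      simpa [Trivialization.basisAt, b] using t.symm_apply_apply_mk hx₀ (o a)
    rw [this, this]
    exact orthonormal_iff_ite.1 o.orthonormal i j
  · exact Filter.inter_mem (hUo.mem_nhds hxU) (Filter.inter_mem (t.open_baseSet.mem_nhds hx₀)
      ((chrt x₀).open_source.mem_nhds (mem_chart_source _ x₀)))
  · filter_upwards [hUo.mem_nhds hx.1] with z hz using hU z hz
  · refine ⟨fun a => (t.basisAt b hx.2.1).repr v a, ?_⟩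
    conv_lhs => rw [← (t.basisAt b hx.2.1).sum_repr v]
    refine Finset.sum_congr rfl fun a _ => ?_
    rw [hsx, hU x hx.1, Pi.one_apply, one_smul, t.localFrame_apply_of_mem_baseSet b hx.2.1]
  · have hsm : ∀ a (u : Cₛ^∞⟮𝓡 n; F, V⟯), ContMDiff (𝓡 n) 𝓘(ℝ, ℝ) ∞ fun x =>
        ρ x * t.localFrameCoeff (𝓡 n) b a x (u x) := by
      intro a u
      refine contMDiff_of_tsupport fun x hx => ?_
      have hxρ : x ∈ tsupport ρ := tsupport_mul_subset_left hx
      exact ρ.contMDiff.contMDiffAt.mul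
        (contMDiffAt_localFrameCoeff b (hρ hxρ).2.1 u.contMDiff.contMDiffAt a)
    refine ⟨fun a => ⟨⟨fun u => ⟨_, hsm a u⟩, fun u v => ?_⟩, fun k u => ?_⟩, fun a u => ?_,
      fun u => ?_⟩
    · ext x
      change ρ x * t.localFrameCoeff (𝓡 n) b a x (u x + v x) = ρ x * _ + ρ x * _
      rw [map_add, mul_add]
    · ext x
      change ρ x * t.localFrameCoeff (𝓡 n) b a x (k • u x) = k * (ρ x * _)
      rw [map_smul, smul_eq_mul]
      ring
    · exact tsupport_mul_subset_left
    · ext x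
      have hsum : (∑ a, mulSection (⟨_, hsm a u⟩ : C^∞⟮𝓡 n, M; ℝ⟯) (s a) :
          Cₛ^∞⟮𝓡 n; F, V⟯) x =
          ∑ a, (ρ x * t.localFrameCoeff (𝓡 n) b a x (u x)) • s a x := by
        rw [← ContMDiffSection.coeAddHom_apply, map_sum, Finset.sum_apply]
        rfl
      refine Eq.trans ?_ hsum.symm
      rw [mulSection_apply]
      by_cases hx : x ∈ tsupport ρ
      · have hxU := hρ hx
        refine (congrArg (ρ x • ·) (t.eq_sum_localFrameCoeff_smul (I := 𝓡 n) (b := b) (s := u)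
          hxU.2.1)).trans ?_
        simp only [Finset.smul_sum]
        refine Finset.sum_congr rfl fun a _ => ?_
        rw [hsx, hU x hxU.1, Pi.one_apply, one_smul, mul_smul]
      · simp [image_eq_zero_of_notMem_tsupport hx]

end Frame

/-! ### The local elliptic estimate -/

theorem abs_sum_sum_mul_le {α : Type*} [Fintype α] {B : ℝ} (h : α → α → ℝ)
    (hh : ∀ a b, |h a b| ≤ B) (w : α → ℝ) :
    |∑ a, ∑ b, w a * w b * h a b| ≤ B * Fintype.card α * ∑ a, w a ^ 2 := by
  have h1 : ∀ a b, |w a * w b * h a b| ≤ B / 2 * (w a ^ 2 + w b ^ 2) := fun a b => by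
    have hB : 0 ≤ B := (abs_nonneg _).trans (hh a b)
    rw [abs_mul, abs_mul]
    have h2 : |w a| * |w b| ≤ (w a ^ 2 + w b ^ 2) / 2 := by
      nlinarith [sq_nonneg (|w a| - |w b|), sq_abs (w a), sq_abs (w b)]
    calc |w a| * |w b| * |h a b| ≤ (w a ^ 2 + w b ^ 2) / 2 * B :=
          mul_le_mul h2 (hh a b) (abs_nonneg _) (by positivity)
      _ = _ := by ring
  calc |∑ a, ∑ b, w a * w b * h a b| ≤ ∑ a, ∑ b, |w a * w b * h a b| :=
        (Finset.abs_sum_le_sum_abs _ _).trans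
          (Finset.sum_le_sum fun a _ => Finset.abs_sum_le_sum_abs _ _)
    _ ≤ ∑ a, ∑ b, B / 2 * (w a ^ 2 + w b ^ 2) :=
        Finset.sum_le_sum fun a _ => Finset.sum_le_sum fun b _ => h1 a b
    _ = _ := by
        simp only [mul_add, Finset.sum_add_distrib, Finset.sum_const, Finset.card_univ,
          nsmul_eq_mul, ← Finset.mul_sum]
        ring

/-- Young's inequality with a small parameter: the first order terms cost at most half of the
principal part, plus a multiple of `∑ w a ^ 2`. The constant `C` depends only on `c`, `B` and the
index sets, so it serves all points of `M`. -/
theorem exists_lower_order_bound {α β : Type*} [Fintype α] [Fintype β] {c B : ℝ} (hc : 0 < c)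
    (hB : 0 ≤ B) : ∃ C : ℝ, 0 ≤ C ∧ ∀ (h : α → α → ℝ) (z : α → α → β → ℝ) (p : α × β → ℝ)
      (w : α → ℝ), (∀ a b, |h a b| ≤ B) → (∀ a b i, |z a b i| ≤ B) →
      -(c / 2 * ∑ q, p q ^ 2) - C * ∑ a, w a ^ 2 ≤
        ∑ a, ∑ b, (w a * w b * h a b + 1 / 2 * (w b * ∑ i, p (a, i) * z a b i)) := by
  set r : ℝ := (Fintype.card α : ℝ) with hr
  set m : ℝ := (Fintype.card β : ℝ) with hm
  have hr0 : 0 ≤ r := Nat.cast_nonneg _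
  have hm0 : 0 ≤ m := Nat.cast_nonneg _
  -- Each `p (a, i) ^ 2` is charged `ε / 4` once for each of the `r` values of `b`, and `ε r / 4 ≤ c
  -- / 2`; the `+ 1` covers an empty index set.
  set ε : ℝ := 2 * c / (r + 1) with hε
  have hε0 : 0 < ε := by positivity
  refine ⟨B * r + B ^ 2 / (4 * ε) * r * m, by positivity, fun h z p w hh hz => ?_⟩
  have h1 := (abs_le.1 (abs_sum_sum_mul_le h hh w)).1
  have h2 : ∀ a b i, -(ε / 4 * p (a, i) ^ 2 + B ^ 2 / (4 * ε) * w b ^ 2) ≤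
      1 / 2 * (w b * (p (a, i) * z a b i)) := fun a b i => by
    have h3 : |1 / 2 * (w b * (p (a, i) * z a b i))| ≤
        ε / 4 * p (a, i) ^ 2 + B ^ 2 / (4 * ε) * w b ^ 2 := by
      rw [abs_mul, abs_mul, abs_mul, abs_of_pos (by norm_num : (0 : ℝ) < 1 / 2)]
      have h4 : |w b| * (|p (a, i)| * |z a b i|) ≤ |w b| * (|p (a, i)| * B) := by
        gcongr
        exact hz a b i
      have h5 : ε / 4 * p (a, i) ^ 2 + B ^ 2 / (4 * ε) * w b ^ 2 -
          1 / 2 * (|w b| * (|p (a, i)| * B)) = (ε * |p (a, i)| - B * |w b|) ^ 2 / (4 * ε) := by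
        rw [← sq_abs (p (a, i)), ← sq_abs (w b)]
        field_simp
        ring
      have h6 : 0 ≤ (ε * |p (a, i)| - B * |w b|) ^ 2 / (4 * ε) := by positivity
      linarith
    exact (abs_le.1 h3).1
  have h7 : -(ε / 4 * r * ∑ q, p q ^ 2 + B ^ 2 / (4 * ε) * r * m * ∑ a, w a ^ 2) ≤
      ∑ a, ∑ b, 1 / 2 * (w b * ∑ i, p (a, i) * z a b i) := by
    have h8 := Finset.sum_le_sum fun a (_ : a ∈ Finset.univ) =>
      Finset.sum_le_sum fun b (_ : b ∈ Finset.univ) =>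
        Finset.sum_le_sum fun i (_ : i ∈ Finset.univ) => h2 a b i
    have h9 : ∑ a : α, ∑ b : α, ∑ i : β, -(ε / 4 * p (a, i) ^ 2 + B ^ 2 / (4 * ε) * w b ^ 2) =
        -(ε / 4 * r * ∑ q, p q ^ 2 + B ^ 2 / (4 * ε) * r * m * ∑ a, w a ^ 2) := by
      simp only [Finset.sum_neg_distrib, Finset.sum_add_distrib, Finset.sum_const,
        Finset.card_univ, nsmul_eq_mul, ← Finset.mul_sum, Fintype.sum_prod_type, hr, hm]
      ring
    rw [h9] at h8
    refine h8.trans (le_of_eq ?_)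
    refine Finset.sum_congr rfl fun a _ => Finset.sum_congr rfl fun b _ => ?_
    rw [Finset.mul_sum, Finset.mul_sum]
  have h10 : ε / 4 * r ≤ c / 2 := by
    have : ε * (r + 1) = 2 * c := by
      rw [hε]
      field_simp
    nlinarith
  have h11 : 0 ≤ ∑ q, p q ^ 2 := Finset.sum_nonneg fun _ _ => sq_nonneg _
  simp only [Finset.sum_add_distrib]
  nlinarith [mul_le_mul_of_nonneg_right h10 h11]

section Local

variable {n : ℕ} {M : Type*} [TopologicalSpace M] [ChartedSpace (EuclideanSpace ℝ (Fin n)) M]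
  [IsManifold (𝓡 n) ∞ M] [CompactSpace M] [T2Space M]
  {F : Type*} [NormedAddCommGroup F] [NormedSpace ℝ F]
  {V : M → Type*} [TopologicalSpace (TotalSpace F V)] [∀ x, NormedAddCommGroup (V x)]
  [∀ x, InnerProductSpace ℝ (V x)] [FiberBundle F V] [VectorBundle ℝ F V]
  {H : Cₛ^∞⟮𝓡 n; F, V⟯ →ₗ[ℝ] Cₛ^∞⟮𝓡 n; F, V⟯}
  {G : ∀ x : M, QuadraticForm ℝ (TangentSpace (𝓡 n) x →L[ℝ] ℝ)}

/-- The partial derivatives of a function in a chart. -/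
def chartPartial (x₀ : M) (f : M → ℝ) (i : Fin n) (y : EuclideanSpace ℝ (Fin n)) : ℝ :=
  fderiv ℝ (chartPush x₀ f) y (EuclideanSpace.single i 1)

theorem continuous_chartPartial {x₀ : M} (f : C^∞⟮𝓡 n, M; ℝ⟯)
    (hf : tsupport f ⊆ (chrt x₀ (n := n)).source) (i : Fin n) :
    Continuous (chartPartial x₀ f i) :=
  ((contDiff_chartPush f hf).continuous_fderiv (by simp)).clm_apply continuous_const

theorem hasCompactSupport_chartPartial {x₀ : M} {f : M → ℝ}
    (hf : tsupport f ⊆ (chrt x₀ (n := n)).source) (i : Fin n) :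
    HasCompactSupport (chartPartial x₀ f i) :=
  (hasCompactSupport_chartPush hf).fderiv_apply (𝕜 := ℝ) _

theorem chartPartial_mem {x₀ : M} {f : M → ℝ} (hf : tsupport f ⊆ (chrt x₀ (n := n)).source)
    {i : Fin n} {y : EuclideanSpace ℝ (Fin n)} (hy : chartPartial x₀ f i y ≠ 0) :
    y ∈ chrt x₀ '' tsupport f :=
  tsupport_chartPush hf (tsupport_fderiv_apply_subset ℝ _ (subset_tsupport _ hy))

theorem chartPull_chartPartial_eq_zero {x₀ x : M} {f : M → ℝ}
    (hf : tsupport f ⊆ (chrt x₀ (n := n)).source) (hx : x ∉ tsupport f) (i : Fin n) :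
    chartPull x₀ (chartPartial x₀ f i) x = 0 := by
  by_cases hxs : x ∈ (chrt x₀ (n := n)).source
  · rw [chartPull, indicator_of_mem hxs, Function.comp_apply]
    by_contra h
    obtain ⟨z, hz, hzx⟩ := chartPartial_mem hf h
    exact hx ((chrt x₀).injOn (hf hz) hxs hzx ▸ hz)
  · exact indicator_of_notMem hxs _

theorem differentialLin_eq_zero {x : M} {f : C^∞⟮𝓡 n, M; ℝ⟯} (hx : x ∉ tsupport f) :
    differentialLin x f = 0 := by
  have h : (f : M → ℝ) =ᶠ[nhds x] fun _ => 0 := notMem_tsupport_iff_eventuallyEq.1 hx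
  rw [differentialLin_apply, differential, h.mfderiv_eq]
  exact mfderiv_const

theorem cometric_eq_zero {x : M} {f : C^∞⟮𝓡 n, M; ℝ⟯} (hx : x ∉ tsupport f)
    (g : C^∞⟮𝓡 n, M; ℝ⟯) : cometric G x f g = 0 := by
  rw [cometric, differentialLin_eq_zero hx, map_zero, LinearMap.zero_apply]

theorem cometric_chart {x₀ : M} (χ : SmoothBumpFunction (𝓡 n) x₀) {x : M}
    (hx : x ∈ (chrt x₀ (n := n)).source) (hχ : χ =ᶠ[nhds x] 1) (f g : C^∞⟮𝓡 n, M; ℝ⟯)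
    (hf : tsupport f ⊆ (chrt x₀ (n := n)).source) (hg : tsupport g ⊆ (chrt x₀ (n := n)).source) :
    cometric G x f g = ∑ i, ∑ j, chartPull x₀ (chartPartial x₀ f i) x *
      chartPull x₀ (chartPartial x₀ g j) x * cometric G x (coordFun χ i) (coordFun χ j) := by
  have h := fun (f : C^∞⟮𝓡 n, M; ℝ⟯) hf =>
    derivation_chart χ (differentialLin x) (differentialLin_mul x) hx hχ f hf
  rw [cometric, h f hf, h g hg]
  simp only [map_sum, map_smul, LinearMap.sum_apply, LinearMap.smul_apply, smul_eq_mul,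
    chartPull, indicator_of_mem hx, Function.comp_apply, chartPartial, cometric, Finset.mul_sum]
  rw [Finset.sum_comm]
  refine Finset.sum_congr rfl fun i _ => Finset.sum_congr rfl fun j _ => ?_
  ring

theorem exists_bound_of_continuous {ι : Type*} [Finite ι] {φ : ι → M → ℝ}
    (h : ∀ i, Continuous (φ i)) : ∃ B : ℝ, 0 ≤ B ∧ ∀ i x, |φ i x| ≤ B := by
  have := Fintype.ofFinite ι
  have h1 : ∀ i, ∃ B, ∀ x, |φ i x| ≤ B := fun i => by
    obtain ⟨B, hB⟩ := isCompact_univ.exists_bound_of_continuousOn (h i).continuousOn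
    exact ⟨B, fun x => hB x (mem_univ x)⟩
  choose B hB using h1
  refine ⟨∑ i, |B i|, Finset.sum_nonneg fun _ _ => abs_nonneg _, fun i x => ?_⟩
  exact (hB i x).trans ((le_abs_self _).trans
    (Finset.single_le_sum (f := fun i => |B i|) (fun _ _ => abs_nonneg _) (Finset.mem_univ i)))

variable [MeasurableSpace M] [BorelSpace M] [IsContMDiffRiemannianBundle (𝓡 n) ∞ F V]
  {μ : Measure M} [IsFiniteMeasure μ]

theorem chartPull_sq (x₀ : M) (ψ : EuclideanSpace ℝ (Fin n) → ℝ) (x : M) :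
    chartPull x₀ ψ x ^ 2 = chartPull x₀ (fun y => ψ y ^ 2) x := by
  by_cases hx : x ∈ (chrt x₀ (n := n)).source <;> simp [chartPull, hx]

theorem integrable_chartPull_chartPartial_sq {x₀ : M} (f : C^∞⟮𝓡 n, M; ℝ⟯)
    (hf : tsupport f ⊆ (chrt x₀ (n := n)).source) (i : Fin n) :
    Integrable (fun x => chartPull x₀ (chartPartial x₀ f i) x ^ 2) μ := by
  simp only [chartPull_sq]
  exact integrable_chartPull μ x₀ ((continuous_chartPartial f hf i).pow 2)
    ((hasCompactSupport_chartPartial hf i).comp_left (g := fun t : ℝ => t ^ 2) (by simp))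

/-- At `x₀` the frame is orthonormal, so the form decouples into the sum over `a` of `G x₀` at the
covector with components `p (a, ·)`. -/
theorem symbol_posDef (hG : IsSymbol H G) {x₀ : M}
    (χ : SmoothBumpFunction (𝓡 n) x₀) {r : ℕ} (s : Fin r → Cₛ^∞⟮𝓡 n; F, V⟯)
    (hon : ∀ a b, ⟪s a x₀, s b x₀⟫_ℝ = if a = b then 1 else 0) (p : Fin r × Fin n → ℝ)
    (hp : p ≠ 0) :
    0 < ∑ q, ∑ q', cometric G x₀ (coordFun χ q.2) (coordFun χ q'.2) * ⟪s q.1 x₀, s q'.1 x₀⟫_ℝ *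
      (p q * p q') := by
  have h1 : ∑ q, ∑ q', cometric G x₀ (coordFun χ q.2) (coordFun χ q'.2) *
      ⟪s q.1 x₀, s q'.1 x₀⟫_ℝ * (p q * p q') =
      ∑ a, G x₀ (∑ i, p (a, i) • differentialLin x₀ (coordFun χ i)) := by
    simp only [Fintype.sum_prod_type, hon]
    refine Finset.sum_congr rfl fun a _ => ?_
    have h2 : G x₀ (∑ i, p (a, i) • differentialLin x₀ (coordFun χ i)) =
        ∑ i, ∑ j, cometric G x₀ (coordFun χ i) (coordFun χ j) * (p (a, i) * p (a, j)) := by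
      rw [← QuadraticMap.associated_eq_self_apply ℝ (G x₀)]
      simp only [map_sum, map_smul, LinearMap.sum_apply, LinearMap.smul_apply, smul_eq_mul,
        cometric, Finset.mul_sum]
      rw [Finset.sum_comm]
      refine Finset.sum_congr rfl fun i _ => Finset.sum_congr rfl fun j _ => ?_
      ring
    rw [h2]
    refine Finset.sum_congr rfl fun i _ => ?_
    rw [Finset.sum_eq_single a]
    · simp
    · intro b _ hb
      simp [hb.symm]
    · simp
  rw [h1]
  obtain ⟨⟨a, i⟩, hai⟩ := Function.ne_iff.1 hp
  refine Finset.sum_pos' (fun a _ => (hG.1 x₀).nonneg _) ⟨a, Finset.mem_univ a, hG.1 x₀ _ ?_⟩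
  intro h
  exact hai (congrFun (coordFun_linearIndependent χ _ h) i)

/-- Gårding's inequality for sections with small support, in terms of coefficients in a frame. -/
theorem exists_garding (hG : IsSymbol H G) (hs : ∀ u v, ip μ (H u) v = ip μ u (H v)) {x₀ : M}
    (χ : SmoothBumpFunction (𝓡 n) x₀) {r : ℕ} (s : Fin r → Cₛ^∞⟮𝓡 n; F, V⟯)
    (hon : ∀ a b, ⟪s a x₀, s b x₀⟫_ℝ = if a = b then 1 else 0) :
    ∃ c C : ℝ, 0 < c ∧ 0 ≤ C ∧ ∃ U ∈ nhds x₀, ∀ f : Fin r → C^∞⟮𝓡 n, M; ℝ⟯,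
      (∀ a, tsupport (f a) ⊆ U) → (∀ a, tsupport (f a) ⊆ (chrt x₀ (n := n)).source) →
      (∀ a, ∀ x ∈ tsupport (f a), χ =ᶠ[nhds x] 1) →
      c * ∑ a, ∑ i : Fin n, ∫ x, chartPull x₀ (chartPartial x₀ (f a) i) x ^ 2 ∂μ ≤
        ip μ (H (∑ a, mulSection (f a) (s a))) (∑ a, mulSection (f a) (s a)) +
          C * ∑ a, ∫ x, f a x ^ 2 ∂μ := by
  obtain ⟨c, hc, hU⟩ := eventually_quadratic_ge
    (Q := fun (q q' : Fin r × Fin n) x => cometric G x (coordFun χ q.2) (coordFun χ q'.2) *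
      ⟪s q.1 x, s q'.1 x⟫_ℝ)
    (fun q q' => continuous_cometric_inner hG _ _ _ _) (symbol_posDef hG χ s hon)
  obtain ⟨B₁, hB₁, hB₁'⟩ := exists_bound_of_continuous
    (φ := fun (q : Fin r × Fin r) x => ⟪H (s q.1) x, s q.2 x⟫_ℝ)
    (fun q => continuous_inner_section _ _)
  obtain ⟨B₂, hB₂, hB₂'⟩ := exists_bound_of_continuous
    (φ := fun (q : (Fin r × Fin r) × Fin n) x => connForm H (s q.1.1) (s q.1.2) x (coordFun χ q.2))
    (fun q => continuous_connForm _ _ _)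
  obtain ⟨C, hC, hlow⟩ := exists_lower_order_bound (α := Fin r) (β := Fin n) hc
    (hB₁.trans (le_max_left B₁ B₂))
  refine ⟨c / 2, C, half_pos hc, hC, _, hU, fun f hfU hfs hfχ => ?_⟩
  -- The inequality already holds pointwise. Where some `f a` is supported, positivity of the symbol
  -- beats the lower order terms; elsewhere every term vanishes.
  have hpt : ∀ x, c / 2 * ∑ a, ∑ i : Fin n, chartPull x₀ (chartPartial x₀ (f a) i) x ^ 2 ≤
      ∑ a, ∑ b, (f a x * f b x * ⟪H (s a) x, s b x⟫_ℝ +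
        1 / 2 * (f b x * connForm H (s a) (s b) x (f a)) +
        cometric G x (f a) (f b) * ⟪s a x, s b x⟫_ℝ) + C * ∑ a, f a x ^ 2 := by
    intro x
    by_cases hx : ∃ a, x ∈ tsupport (f a)
    · obtain ⟨a₀, ha₀⟩ := hx
      have hxs := hfs a₀ ha₀
      have hxχ := hfχ a₀ x ha₀
      set p : Fin r × Fin n → ℝ := fun q => chartPull x₀ (chartPartial x₀ (f q.1) q.2) x with hp
      have h1 := hfU a₀ ha₀ p
      have h2 := hlow (fun a b => ⟪H (s a) x, s b x⟫_ℝ)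
        (fun a b i => connForm H (s a) (s b) x (coordFun χ i)) p (fun a => f a x)
        (fun a b => (hB₁' (a, b) x).trans (le_max_left _ _))
        (fun a b i => (hB₂' ((a, b), i) x).trans (le_max_right _ _))
      have h3 : ∀ a b, connForm H (s a) (s b) x (f a) =
          ∑ i, p (a, i) * connForm H (s a) (s b) x (coordFun χ i) := fun a b => by
        rw [derivation_chart χ (connForm H (s a) (s b) x)
          (fun f g => connForm_mul hG (s a) (s b) x f g) hxs hxχ (f a) (hfs a)]
        simp only [hp, chartPull, indicator_of_mem hxs, Function.comp_apply, chartPartial,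
          smul_eq_mul]
      have h4 : ∑ a, ∑ b, cometric G x (f a) (f b) * ⟪s a x, s b x⟫_ℝ =
          ∑ q, ∑ q', cometric G x (coordFun χ q.2) (coordFun χ q'.2) * ⟪s q.1 x, s q'.1 x⟫_ℝ *
            (p q * p q') := by
        simp only [Fintype.sum_prod_type]
        refine Finset.sum_congr rfl fun a _ => ?_
        rw [Finset.sum_comm]
        refine Finset.sum_congr rfl fun b _ => ?_
        rw [cometric_chart χ hxs hxχ (f a) (f b) (hfs a) (hfs b), Finset.sum_mul]
        refine Finset.sum_congr rfl fun i _ => ?_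
        rw [Finset.sum_mul]
        refine Finset.sum_congr rfl fun j _ => ?_
        simp only [hp]
        ring
      have h5 : ∑ q, p q ^ 2 =
          ∑ a, ∑ i : Fin n, chartPull x₀ (chartPartial x₀ (f a) i) x ^ 2 := by
        rw [Fintype.sum_prod_type]
      simp only [← h3] at h2
      rw [← h4, h5] at h1
      rw [h5] at h2
      simp only [Finset.sum_add_distrib] at h2 ⊢
      linarith
    · push Not at hx
      have h1 : ∀ a, f a x = 0 := fun a => image_eq_zero_of_notMem_tsupport (hx a)
      simp [h1, cometric_eq_zero (hx _), chartPull_chartPartial_eq_zero (hfs _) (hx _)]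
  have hcf : ∀ a, Continuous (f a) := fun a => (f a).contMDiff.continuous
  have hcI : ∀ a b, Continuous fun x => f a x * f b x * ⟪H (s a) x, s b x⟫_ℝ +
        1 / 2 * (f b x * connForm H (s a) (s b) x (f a)) +
        cometric G x (f a) (f b) * ⟪s a x, s b x⟫_ℝ := fun a b =>
    ((((hcf a).mul (hcf b)).mul (continuous_inner_section _ _)).add
      (continuous_const.mul ((hcf b).mul (continuous_connForm _ _ _)))).add
      (continuous_cometric_inner hG _ _ _ _)
  have hip : ip μ (H (∑ a, mulSection (f a) (s a))) (∑ a, mulSection (f a) (s a)) =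
      ∫ x, ∑ a, ∑ b, (f a x * f b x * ⟪H (s a) x, s b x⟫_ℝ +
        1 / 2 * (f b x * connForm H (s a) (s b) x (f a)) +
        cometric G x (f a) (f b) * ⟪s a x, s b x⟫_ℝ) ∂μ := by
    rw [map_sum, ip_sum_left, integral_finsetSum _ fun a _ =>
      integrable_finsetSum _ fun b _ => integrable_of_continuous (hcI a b)]
    refine Finset.sum_congr rfl fun a _ => ?_
    rw [ip_sum_right, integral_finsetSum _ fun b _ => integrable_of_continuous (hcI a b)]
    exact Finset.sum_congr rfl fun b _ => ip_laplace_mulSection hG hs _ _ _ _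
  have hi1 : ∀ a (i : Fin n),
      Integrable (fun x => chartPull x₀ (chartPartial x₀ (f a) i) x ^ 2) μ :=
    fun a i => integrable_chartPull_chartPartial_sq (f a) (hfs a) i
  have hi2 : ∀ a, Integrable (fun x => f a x ^ 2) μ :=
    fun a => integrable_of_continuous ((hcf a).pow 2)
  have hi3 : Integrable (fun x => ∑ a, ∑ i : Fin n,
      chartPull x₀ (chartPartial x₀ (f a) i) x ^ 2) μ :=
    integrable_finsetSum _ fun a _ => integrable_finsetSum _ fun i _ => hi1 a i
  have hi4 : Integrable (fun x => ∑ a, f a x ^ 2) μ := integrable_finsetSum _ fun a _ => hi2 a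
  have hi5 : Integrable (fun x => ∑ a, ∑ b, (f a x * f b x * ⟪H (s a) x, s b x⟫_ℝ +
        1 / 2 * (f b x * connForm H (s a) (s b) x (f a)) +
        cometric G x (f a) (f b) * ⟪s a x, s b x⟫_ℝ)) μ :=
    integrable_finsetSum _ fun a _ => integrable_finsetSum _ fun b _ =>
      integrable_of_continuous (hcI a b)
  have hmono := integral_mono (hi3.const_mul (c / 2)) (hi5.add (hi4.const_mul C)) hpt
  rw [integral_const_mul, integral_add' hi5 (hi4.const_mul C), integral_const_mul] at hmono
  have e1 : ∫ x, ∑ a, ∑ i : Fin n, chartPull x₀ (chartPartial x₀ (f a) i) x ^ 2 ∂μ =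
      ∑ a, ∑ i : Fin n, ∫ x, chartPull x₀ (chartPartial x₀ (f a) i) x ^ 2 ∂μ := by
    rw [integral_finsetSum _ fun a _ => integrable_finsetSum _ fun i _ => hi1 a i]
    exact Finset.sum_congr rfl fun a _ => integral_finsetSum _ fun i _ => hi1 a i
  rw [← e1, hip, ← integral_finsetSum _ fun a _ => hi2 a]
  exact hmono

end Local

/-! ### Fourier coefficients of functions in a chart. -/

section LocalFourier

variable {n : ℕ} {M : Type*} [TopologicalSpace M] [ChartedSpace (EuclideanSpace ℝ (Fin n)) M]
  [IsManifold (𝓡 n) ∞ M] [CompactSpace M] [T2Space M]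

/-- The Fourier coefficients of a function in a chart. -/
def chartFourier (x₀ : M) (k : Fin n → ℤ) (f : M → ℝ) : ℂ :=
  ∫ y : EuclideanSpace ℝ (Fin n), cubeExp k y.ofLp * (chartPush x₀ f y : ℂ)

theorem continuous_cubeExp {n : ℕ} (k : Fin n → ℤ) : Continuous (cubeExp k) :=
  continuous_iff_continuousAt.2 fun x => (hasFDerivAt_cubeExp k x).continuousAt

theorem integrable_cubeExp_chartPush {x₀ : M} (k : Fin n → ℤ) (f : C^∞⟮𝓡 n, M; ℝ⟯)
    (hf : tsupport f ⊆ (chrt x₀ (n := n)).source) :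
    Integrable fun y : EuclideanSpace ℝ (Fin n) =>
      cubeExp k y.ofLp * (chartPush x₀ f y : ℂ) := by
  refine Continuous.integrable_of_hasCompactSupport ?_ ?_
  · exact ((continuous_cubeExp k).comp (PiLp.continuous_ofLp 2 _)).mul
      (Complex.continuous_ofReal.comp (contDiff_chartPush f hf).continuous)
  · exact ((hasCompactSupport_chartPush hf).comp_left (g := Complex.ofReal)
      Complex.ofReal_zero).mul_left

theorem chartFourier_add {x₀ : M} (k : Fin n → ℤ) (f g : C^∞⟮𝓡 n, M; ℝ⟯)
    (hf : tsupport f ⊆ (chrt x₀ (n := n)).source) (hg : tsupport g ⊆ (chrt x₀ (n := n)).source) :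
    chartFourier x₀ k (f + g : C^∞⟮𝓡 n, M; ℝ⟯) = chartFourier x₀ k f + chartFourier x₀ k g := by
  rw [chartFourier, chartFourier, chartFourier, ← integral_add
    (integrable_cubeExp_chartPush k f hf) (integrable_cubeExp_chartPush k g hg)]
  congr 1
  ext y
  rw [← mul_add, ← Complex.ofReal_add]
  congr 2
  exact congrFun (indicator_add _ _ _) y

theorem chartFourier_smul {x₀ : M} (k : Fin n → ℤ) (c : ℝ) (f : C^∞⟮𝓡 n, M; ℝ⟯) :
    chartFourier x₀ k (c • f : C^∞⟮𝓡 n, M; ℝ⟯) = c * chartFourier x₀ k f := by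
  rw [chartFourier, chartFourier, ← integral_const_mul]
  congr 1
  ext y
  rw [mul_left_comm, ← Complex.ofReal_mul]
  congr 2
  exact congrFun (indicator_const_smul _ c _) y

variable [MeasurableSpace M] [BorelSpace M] {μ : Measure M} [IsFiniteMeasure μ]

theorem chartPull_chartPush {x₀ : M} {f : M → ℝ} (hf : tsupport f ⊆ (chrt x₀ (n := n)).source) :
    chartPull (n := n) x₀ (chartPush x₀ f) = f := by
  ext x
  by_cases hx : x ∈ (chrt x₀ (n := n)).source
  · rw [chartPull, indicator_of_mem hx, Function.comp_apply, chartPush_apply hx]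
  · rw [chartPull, indicator_of_notMem hx]
    exact (image_eq_zero_of_notMem_tsupport fun h => hx (hf h)).symm

/-- The neighbourhood is so small that its image lies in a unit cube centred at the image of `x₀`
and the density is comparable to Lebesgue measure; then the estimates on the cube transfer to `μ`.
-/
theorem exists_fourier_estimate (hμ : IsSmoothDensity n μ) (x₀ : M) :
    ∃ C : ℝ, 0 ≤ C ∧ ∃ U ∈ nhds x₀, ∀ f : C^∞⟮𝓡 n, M; ℝ⟯, tsupport f ⊆ U →
      (∀ k : Fin n → ℤ, ‖chartFourier x₀ k f‖ ^ 2 ≤ C * ∫ x, f x ^ 2 ∂μ) ∧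
      ∀ N : ℕ, 0 < N → ∫ x, f x ^ 2 ∂μ ≤
        C * ∑ k ∈ Fintype.piFinset fun _ : Fin n => Finset.Icc (-(N : ℤ)) N,
          ‖chartFourier x₀ k f‖ ^ 2 +
        C / N ^ 2 * ∑ i : Fin n, ∫ x, chartPull x₀ (chartPartial x₀ f i) x ^ 2 ∂μ := by
  obtain ⟨c, C, hc, hC, U, hU, hUs, hb⟩ := exists_density_bounds μ hμ x₀
  set e := chrt (n := n) x₀
  let b : Fin n → ℝ := fun i => e x₀ i - 1 / 2
  have hcube : ∀ᶠ y in nhds (e x₀), ∀ i, y i ∈ Ioc (b i) (b i + 1) := by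
    refine Filter.eventually_all.2 fun i => ?_
    have : ContinuousAt (fun y : EuclideanSpace ℝ (Fin n) => y i) (e x₀) := by fun_prop
    exact this.eventually (Ioc_mem_nhds (by simp only [b]; linarith) (by simp only [b]; linarith))
  refine ⟨max (1 / c) (max C (C / c)), by positivity,
    U ∩ {x | ∀ i, e x i ∈ Ioc (b i) (b i + 1)},
    Filter.inter_mem hU ((e.continuousAt (mem_chart_source _ x₀)).eventually hcube),
    fun f hf => ?_⟩
  have hfs : tsupport f ⊆ e.source := fun x hx => hUs (hf hx).1
  have hsm := contDiff_chartPush f hfs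
  have hcs := hasCompactSupport_chartPush (n := n) hfs
  have hsupp : ∀ y ∈ tsupport (chartPush (n := n) x₀ f), ∀ i, y i ∈ Ioc (b i) (b i + 1) := by
    intro y hy
    obtain ⟨x, hx, rfl⟩ := tsupport_chartPush hfs hy
    exact (hf hx).2
  have h1 := hb (fun y => chartPush x₀ f y ^ 2) (hsm.continuous.pow 2)
    (hcs.comp_left (g := fun t : ℝ => t ^ 2) (by simp)) (fun y => sq_nonneg _) fun y hy => by
      have : chartPush x₀ f y ≠ 0 := fun h => hy (by simp [h])
      exact image_mono (fun x hx => (hf hx).1) (tsupport_chartPush hfs (subset_tsupport _ this))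
  simp only [← chartPull_sq, chartPull_chartPush hfs] at h1
  have h2 := fun i : Fin n => hb (fun y => chartPartial x₀ f i y ^ 2)
    ((continuous_chartPartial f hfs i).pow 2)
    ((hasCompactSupport_chartPartial hfs i).comp_left (g := fun t : ℝ => t ^ 2) (by simp))
    (fun y => sq_nonneg _) fun y hy => by
      have : chartPartial x₀ f i y ≠ 0 := fun h => hy (by simp [h])
      exact image_mono (fun x hx => (hf hx).1) (chartPartial_mem hfs this)
  simp only [← chartPull_sq] at h2
  have hf0 : 0 ≤ ∫ x, f x ^ 2 ∂μ := integral_nonneg fun _ => sq_nonneg _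
  have hcC : 1 / c ≤ max (1 / c) (max C (C / c)) := le_max_left _ _
  have hCC : C ≤ max (1 / c) (max C (C / c)) := (le_max_left _ _).trans (le_max_right _ _)
  have hCc : C / c ≤ max (1 / c) (max C (C / c)) := (le_max_right _ _).trans (le_max_right _ _)
  refine ⟨fun k => ?_, fun N hN => ?_⟩
  · have h3 := norm_sq_fourier_le b hsm.continuous hcs hsupp k
    refine (h3.trans ?_).trans (mul_le_mul_of_nonneg_right hcC hf0)
    rw [one_div, ← div_eq_inv_mul, le_div_iff₀ hc, mul_comm]
    exact h1.1
  · have h3 := integral_sq_le_fourier b (hsm.of_le (by simp)) hcs hsupp hN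
    refine h1.2.trans ((mul_le_mul_of_nonneg_left h3 hC.le).trans ?_)
    rw [mul_add]
    refine add_le_add (mul_le_mul_of_nonneg_right hCC (Finset.sum_nonneg fun _ _ => sq_nonneg _)) ?_
    have h4 : ∑ i : Fin n, ∫ y, fderiv ℝ (chartPush x₀ f) y (EuclideanSpace.single i 1) ^ 2 ≤
        1 / c * ∑ i : Fin n, ∫ x, chartPull x₀ (chartPartial x₀ f i) x ^ 2 ∂μ := by
      rw [Finset.mul_sum]
      refine Finset.sum_le_sum fun i _ => ?_
      rw [one_div, ← div_eq_inv_mul, le_div_iff₀ hc, mul_comm]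
      exact (h2 i).1
    have h5 : 0 ≤ ∑ i : Fin n, ∫ x, chartPull x₀ (chartPartial x₀ f i) x ^ 2 ∂μ :=
      Finset.sum_nonneg fun i _ => integral_nonneg fun _ => sq_nonneg _
    calc C * (1 / (N : ℝ) ^ 2 * _) ≤ C * (1 / (N : ℝ) ^ 2 * (1 / c * _)) := by gcongr
      _ = C / c / N ^ 2 * ∑ i : Fin n, ∫ x, chartPull x₀ (chartPartial x₀ f i) x ^ 2 ∂μ := by ring
      _ ≤ _ := by gcongr

end LocalFourier

/-! ### Local discretization of sections. -/

section LocalEstimate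

variable {n : ℕ} {M : Type*} [TopologicalSpace M] [ChartedSpace (EuclideanSpace ℝ (Fin n)) M]
  [IsManifold (𝓡 n) ∞ M] [CompactSpace M] [T2Space M]
  {F : Type*} [NormedAddCommGroup F] [NormedSpace ℝ F]
  {V : M → Type*} [TopologicalSpace (TotalSpace F V)] [∀ x, NormedAddCommGroup (V x)]
  [∀ x, InnerProductSpace ℝ (V x)] [FiberBundle F V] [VectorBundle ℝ F V]
  {H : Cₛ^∞⟮𝓡 n; F, V⟯ →ₗ[ℝ] Cₛ^∞⟮𝓡 n; F, V⟯}
  {G : ∀ x : M, QuadraticForm ℝ (TangentSpace (𝓡 n) x →L[ℝ] ℝ)}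
  [MeasurableSpace M] [BorelSpace M] [IsContMDiffRiemannianBundle (𝓡 n) ∞ F V]

theorem norm_sq_sum_smul {E : Type*} [NormedAddCommGroup E] [InnerProductSpace ℝ E] {r : ℕ}
    (w : Fin r → ℝ) (s : Fin r → E) :
    ‖∑ a, w a • s a‖ ^ 2 = ∑ a, ∑ b, w a * w b * ⟪s a, s b⟫_ℝ := by
  rw [← real_inner_self_eq_norm_sq, sum_inner]
  refine Finset.sum_congr rfl fun a _ => ?_
  rw [inner_sum]
  refine Finset.sum_congr rfl fun b _ => ?_
  rw [real_inner_smul_left, real_inner_smul_right]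
  ring

theorem exists_frame_bounds {x₀ : M} {r : ℕ} (s : Fin r → Cₛ^∞⟮𝓡 n; F, V⟯)
    (hon : ∀ a b, ⟪s a x₀, s b x₀⟫_ℝ = if a = b then 1 else 0) :
    ∃ c C : ℝ, 0 < c ∧ 0 ≤ C ∧ ∃ U ∈ nhds x₀, (∀ x ∈ U, ∀ w : Fin r → ℝ,
      c * ∑ a, w a ^ 2 ≤ ‖∑ a, w a • s a x‖ ^ 2) ∧
      ∀ x, ∀ w : Fin r → ℝ, ‖∑ a, w a • s a x‖ ^ 2 ≤ C * ∑ a, w a ^ 2 := by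
  obtain ⟨c, hc, hU⟩ := eventually_quadratic_ge (x₀ := x₀) (Q := fun a b x => ⟪s a x, s b x⟫_ℝ)
    (fun a b => continuous_inner_section _ _) (fun p hp => by
      obtain ⟨a, ha⟩ := Function.ne_iff.1 hp
      simp only [hon, ite_mul, one_mul, zero_mul, Finset.sum_ite_eq, Finset.mem_univ, if_true]
      exact Finset.sum_pos' (fun a _ => mul_self_nonneg _)
        ⟨a, Finset.mem_univ a, mul_self_pos.2 ha⟩)
  obtain ⟨B, hB, hB'⟩ := exists_bound_of_continuous
    (φ := fun (q : Fin r × Fin r) x => ⟪s q.1 x, s q.2 x⟫_ℝ)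
    (fun q => continuous_inner_section _ _)
  refine ⟨c, B * Fintype.card (Fin r), hc, by positivity, _, hU, fun x hx w => ?_, fun x w => ?_⟩
  · rw [norm_sq_sum_smul]
    refine (hx w).trans (le_of_eq ?_)
    exact Finset.sum_congr rfl fun a _ => Finset.sum_congr rfl fun b _ => mul_comm _ _
  · rw [norm_sq_sum_smul]
    exact (le_abs_self _).trans (abs_sum_sum_mul_le _ (fun a b => hB' (a, b) x) w)

/-- Expanding in coordinates and in the frame leaves only the continuous products of `cometric` with
`⟪s a, s b⟫`, bounded by compactness. The factor `‖v‖ ^ 2` stays on both sides since nothing bounds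
`G` over a zero fibre. -/
theorem exists_symbol_bound (hG : IsSymbol H G) {x₀ : M} (χ : SmoothBumpFunction (𝓡 n) x₀)
    {r : ℕ} (s : Fin r → Cₛ^∞⟮𝓡 n; F, V⟯) {c : ℝ} (hc : 0 < c) (ρ : C^∞⟮𝓡 n, M; ℝ⟯)
    (hρs : tsupport ρ ⊆ (chrt x₀ (n := n)).source) (hχ : ∀ x ∈ tsupport ρ, χ =ᶠ[nhds x] 1)
    (hgen : ∀ x ∈ tsupport ρ, ∀ v : V x, ∃ w : Fin r → ℝ, v = ∑ a, w a • s a x)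
    (hlow : ∀ x ∈ tsupport ρ, ∀ w : Fin r → ℝ, c * ∑ a, w a ^ 2 ≤ ‖∑ a, w a • s a x‖ ^ 2) :
    ∃ C : ℝ, 0 ≤ C ∧ ∀ (x : M) (v : V x), cometric G x ρ ρ * ‖v‖ ^ 2 ≤ C * ‖v‖ ^ 2 := by
  obtain ⟨B, hB, hB'⟩ := exists_bound_of_continuous
    (φ := fun (q : (Fin r × Fin r) × (Fin n × Fin n)) x =>
      cometric G x (coordFun χ q.2.1) (coordFun χ q.2.2) * ⟪s q.1.1 x, s q.1.2 x⟫_ℝ)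
    (fun q => continuous_cometric_inner hG _ _ _ _)
  have hP : ∀ i : Fin n, ∃ P : ℝ, 0 ≤ P ∧ ∀ x, |chartPull x₀ (chartPartial x₀ ρ i) x| ≤ P :=
    fun i => by
      obtain ⟨P, hP⟩ := (continuous_chartPartial ρ hρs i).bounded_above_of_compact_support
        (hasCompactSupport_chartPartial hρs i)
      exact ⟨P, (norm_nonneg _).trans (hP 0),
        fun x => (norm_indicator_le_norm_self (chartPartial x₀ ρ i ∘ chrt x₀) x).trans (hP _)⟩
  choose P hP0 hP using hP
  set D : ℝ := ∑ i, ∑ j, P i * P j * B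
  have hD : 0 ≤ D := Finset.sum_nonneg fun i _ => Finset.sum_nonneg fun j _ =>
    mul_nonneg (mul_nonneg (hP0 i) (hP0 j)) hB
  refine ⟨D * Fintype.card (Fin r) / c, by positivity, fun x v => ?_⟩
  by_cases hx : x ∈ tsupport ρ
  · obtain ⟨w, rfl⟩ := hgen x hx v
    have h1 := hlow x hx w
    have h2 : cometric G x ρ ρ * ‖∑ a, w a • s a x‖ ^ 2 =
        ∑ a, ∑ b, w a * w b * ∑ i, ∑ j, chartPull x₀ (chartPartial x₀ ρ i) x *
          chartPull x₀ (chartPartial x₀ ρ j) x *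
            (cometric G x (coordFun χ i) (coordFun χ j) * ⟪s a x, s b x⟫_ℝ) := by
      rw [norm_sq_sum_smul, cometric_chart χ (hρs hx) (hχ x hx) ρ ρ hρs hρs, Finset.mul_sum]
      refine Finset.sum_congr rfl fun a _ => ?_
      rw [Finset.mul_sum]
      refine Finset.sum_congr rfl fun b _ => ?_
      rw [mul_left_comm]
      congr 1
      rw [Finset.sum_mul]
      refine Finset.sum_congr rfl fun i _ => ?_
      rw [Finset.sum_mul]
      exact Finset.sum_congr rfl fun j _ => mul_assoc _ _ _
    rw [h2]
    refine ((le_abs_self _).trans (abs_sum_sum_mul_le (B := D) _ (fun a b => ?_) w)).trans ?_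
    · refine (Finset.abs_sum_le_sum_abs _ _).trans (Finset.sum_le_sum fun i _ => ?_)
      refine (Finset.abs_sum_le_sum_abs _ _).trans (Finset.sum_le_sum fun j _ => ?_)
      rw [abs_mul, abs_mul]
      exact mul_le_mul (mul_le_mul (hP i x) (hP j x) (abs_nonneg _) (hP0 i))
        (hB' ((a, b), (i, j)) x) (abs_nonneg _) (mul_nonneg (hP0 i) (hP0 j))
    · rw [div_mul_eq_mul_div, le_div_iff₀ hc, mul_assoc, mul_comm (∑ a, w a ^ 2)]
      exact mul_le_mul_of_nonneg_left h1 (by positivity)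
  · rw [cometric_eq_zero hx, zero_mul]
    positivity

end LocalEstimate

section LocalEstimate

variable {n : ℕ} {M : Type*} [TopologicalSpace M] [ChartedSpace (EuclideanSpace ℝ (Fin n)) M]
  [IsManifold (𝓡 n) ∞ M] [CompactSpace M] [T2Space M]
  {F : Type*} [NormedAddCommGroup F] [NormedSpace ℝ F] [FiniteDimensional ℝ F]
  {V : M → Type*} [TopologicalSpace (TotalSpace F V)] [∀ x, NormedAddCommGroup (V x)]
  [∀ x, InnerProductSpace ℝ (V x)] [FiberBundle F V] [VectorBundle ℝ F V]
  {H : Cₛ^∞⟮𝓡 n; F, V⟯ →ₗ[ℝ] Cₛ^∞⟮𝓡 n; F, V⟯}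
  {G : ∀ x : M, QuadraticForm ℝ (TangentSpace (𝓡 n) x →L[ℝ] ℝ)}
  [MeasurableSpace M] [BorelSpace M] [IsContMDiffRiemannianBundle (𝓡 n) ∞ F V]
  [ContMDiffVectorBundle ∞ F V (𝓡 n)]
  {μ : Measure M} [IsFiniteMeasure μ]

theorem ip_self_eq (u : Cₛ^∞⟮𝓡 n; F, V⟯) : ip μ u u = ∫ x, ‖u x‖ ^ 2 ∂μ := by
  simp only [ip, real_inner_self_eq_norm_sq]

theorem integrable_norm_sq (u : Cₛ^∞⟮𝓡 n; F, V⟯) : Integrable (fun x => ‖u x‖ ^ 2) μ := by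
  simpa only [real_inner_self_eq_norm_sq] using integrable_inner_section μ u u

theorem ip_mulSection_self_le (ρ : C^∞⟮𝓡 n, M; ℝ⟯) : ∃ c : ℝ, 0 ≤ c ∧
    ∀ u : Cₛ^∞⟮𝓡 n; F, V⟯, ip μ (mulSection ρ u) (mulSection ρ u) ≤ c * ip μ u u := by
  obtain ⟨B, hB, hB'⟩ := exists_bound_of_continuous (φ := fun (_ : Unit) => (ρ : M → ℝ))
    (fun _ => ρ.contMDiff.continuous)
  refine ⟨B ^ 2, sq_nonneg _, fun u => ?_⟩
  rw [ip_self_eq, ip_self_eq, ← integral_const_mul]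
  refine integral_mono (integrable_norm_sq _) ((integrable_norm_sq u).const_mul _) fun x => ?_
  simp only [mulSection_apply, norm_smul, mul_pow, Real.norm_eq_abs]
  exact mul_le_mul_of_nonneg_right (pow_le_pow_left₀ (abs_nonneg _) (hB' () x) 2) (sq_nonneg _)

theorem card_frequencies_le {N : ℕ} (hN : 0 < N) :
    ((Fintype.piFinset fun _ : Fin n => Finset.Icc (-(N : ℤ)) N).card : ℝ) ≤ 3 ^ n * N ^ n := by
  rw [Fintype.card_piFinset_const, Int.card_Icc, ← mul_pow]
  have h1 : ((N : ℤ) + 1 - -N).toNat = 2 * N + 1 := by omega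
  rw [h1]
  push_cast
  have : (1 : ℝ) ≤ N := by exact_mod_cast hN
  gcongr
  linarith

theorem section_sum_apply {ι : Type*} (t : Finset ι) (u : ι → Cₛ^∞⟮𝓡 n; F, V⟯) (x : M) :
    (∑ a ∈ t, u a) x = ∑ a ∈ t, u a x := by
  rw [← ContMDiffSection.coeAddHom_apply, map_sum, Finset.sum_apply]
  rfl

/-- The real or imaginary part of a Fourier coefficient of a coefficient function, as a functional
on sections. -/
def fourierFunctional (x₀ : M) (c : Cₛ^∞⟮𝓡 n; F, V⟯ →ₗ[ℝ] C^∞⟮𝓡 n, M; ℝ⟯)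
    (hc : ∀ u, tsupport (c u) ⊆ (chrt x₀ (n := n)).source) (k : Fin n → ℤ) (re : Bool) :
    Cₛ^∞⟮𝓡 n; F, V⟯ →ₗ[ℝ] ℝ where
  toFun u := bif re then (chartFourier x₀ k (c u)).re else (chartFourier x₀ k (c u)).im
  map_add' u v := by
    rw [map_add, chartFourier_add k _ _ (hc u) (hc v)]
    cases re <;> simp
  map_smul' t u := by
    rw [map_smul, chartFourier_smul]
    cases re <;> simp

theorem sum_fourierFunctional_sq (x₀ : M) (c : Cₛ^∞⟮𝓡 n; F, V⟯ →ₗ[ℝ] C^∞⟮𝓡 n, M; ℝ⟯)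
    (hc : ∀ u, tsupport (c u) ⊆ (chrt x₀ (n := n)).source) (k : Fin n → ℤ)
    (u : Cₛ^∞⟮𝓡 n; F, V⟯) :
    ∑ re, fourierFunctional x₀ c hc k re u ^ 2 = ‖chartFourier x₀ k (c u)‖ ^ 2 := by
  rw [Fintype.sum_bool, ← Complex.normSq_eq_norm_sq, Complex.normSq_apply, sq, sq]
  rfl

/-- The norm of `ρ u` is comparable to that of its frame coefficients. Low frequencies of the
coefficients are the functionals; high frequencies cost `1 / N²` times the gradient, which Gårding's
inequality bounds by the quadratic form of `H`. -/
theorem exists_local_estimate (hG : IsSymbol H G) (hs : ∀ u v, ip μ (H u) v = ip μ u (H v))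
    (hμ : IsSmoothDensity n μ) (x₀ : M) :
    ∃ U ∈ nhds x₀, ∀ ρ : C^∞⟮𝓡 n, M; ℝ⟯, tsupport ρ ⊆ U →
      (∃ C : ℝ, 0 ≤ C ∧ ∀ (x : M) (v : V x), cometric G x ρ ρ * ‖v‖ ^ 2 ≤ C * ‖v‖ ^ 2) ∧
      ∃ C : ℝ, 0 ≤ C ∧ ∀ N : ℕ, 0 < N → ∃ (κ : Type) (_ : Fintype κ)
        (l : κ → Cₛ^∞⟮𝓡 n; F, V⟯ →ₗ[ℝ] ℝ), (Fintype.card κ : ℝ) ≤ C * N ^ n ∧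
        (∀ k, ∃ c : ℝ, ∀ u, l k u ^ 2 ≤ c * ip μ u u) ∧
        ∀ u, ip μ (mulSection ρ u) (mulSection ρ u) ≤ C * ∑ k, l k u ^ 2 +
          C / N ^ 2 * (ip μ (H (mulSection ρ u)) (mulSection ρ u) +
            C * ip μ (mulSection ρ u) (mulSection ρ u)) := by
  obtain ⟨r, χ, s, hon, U₁, hU₁, hU₁s, hU₁χ, hgen, hfr⟩ := exists_smooth_frame (n := n) F V x₀
  obtain ⟨c₁, C₁, hc₁, hC₁, U₂, hU₂, hgard⟩ := exists_garding hG hs χ s hon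
  obtain ⟨C₂, hC₂, U₃, hU₃, hfour⟩ := exists_fourier_estimate hμ x₀
  obtain ⟨c₃, C₃, hc₃, hC₃, U₄, hU₄, hlow, hup⟩ := exists_frame_bounds s hon
  refine ⟨U₁ ∩ U₂ ∩ (U₃ ∩ U₄), Filter.inter_mem (Filter.inter_mem hU₁ hU₂)
    (Filter.inter_mem hU₃ hU₄), fun ρ hρ => ⟨?_, ?_⟩⟩
  · exact exists_symbol_bound hG χ s hc₃ ρ (fun x hx => hU₁s (hρ hx).1.1)
      (fun x hx => hU₁χ x (hρ hx).1.1) (fun x hx => hgen x (hρ hx).1.1)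
      (fun x hx => hlow x (hρ hx).2.2)
  obtain ⟨q, hqs, hq⟩ := hfr ρ fun x hx => (hρ hx).1.1
  have hqsrc : ∀ a u, tsupport (q a u) ⊆ (chrt x₀ (n := n)).source :=
    fun a u x hx => hU₁s (hρ (hqs a u hx)).1.1
  -- comparison of the norm of `ρ u` with the norms of the coefficients
  have hup' : ∀ u, ip μ (mulSection ρ u) (mulSection ρ u) ≤ C₃ * ∑ a, ∫ x, q a u x ^ 2 ∂μ := by
    intro u
    have hi : ∀ a, Integrable (fun x => q a u x ^ 2) μ :=
      fun a => integrable_of_continuous ((q a u).contMDiff.continuous.pow 2)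
    rw [ip_self_eq, ← integral_finsetSum _ fun a _ => hi a, ← integral_const_mul]
    refine integral_mono (integrable_norm_sq _)
      ((integrable_finsetSum _ fun a _ => hi a).const_mul _) fun x => ?_
    rw [hq u, section_sum_apply]
    exact hup x fun a => q a u x
  have hlow' : ∀ u, c₃ * ∑ a, ∫ x, q a u x ^ 2 ∂μ ≤ ip μ (mulSection ρ u) (mulSection ρ u) := by
    intro u
    have hi : ∀ a, Integrable (fun x => q a u x ^ 2) μ :=
      fun a => integrable_of_continuous ((q a u).contMDiff.continuous.pow 2)
    rw [ip_self_eq, ← integral_finsetSum _ fun a _ => hi a, ← integral_const_mul]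
    refine integral_mono ((integrable_finsetSum _ fun a _ => hi a).const_mul _)
      (integrable_norm_sq _) fun x => ?_
    by_cases hx : x ∈ tsupport ρ
    · rw [hq u, section_sum_apply]
      exact hlow x (hρ hx).2.2 fun a => q a u x
    · have : ∀ a, q a u x = 0 :=
        fun a => image_eq_zero_of_notMem_tsupport fun h => hx (hqs a u h)
      simp [this]
  have hgard' : ∀ u, c₁ * ∑ a, ∑ i : Fin n,
      ∫ x, chartPull x₀ (chartPartial x₀ (q a u) i) x ^ 2 ∂μ ≤
      ip μ (H (mulSection ρ u)) (mulSection ρ u) + C₁ * ∑ a, ∫ x, q a u x ^ 2 ∂μ := by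
    intro u
    rw [hq u]
    exact hgard (fun a => q a u) (fun a x hx => (hρ (hqs a u hx)).1.2) (fun a => hqsrc a u)
      (fun a x hx => hU₁χ x (hρ (hqs a u hx)).1.1)
  obtain ⟨cρ, hcρ, hρb⟩ := ip_mulSection_self_le (F := F) (V := V) (μ := μ) ρ
  -- One summand for each use: the number of functionals (frame index, at most `(3 N)^n`
  -- frequencies, real and imaginary part), the two coefficients of the Fourier estimate, and the
  -- zeroth order term of Gårding's inequality.
  set C : ℝ := 2 * r * 3 ^ n + C₃ * C₂ + C₃ * C₂ / c₁ + C₁ / c₃ with hC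
  refine ⟨C, by positivity, fun N hN => ?_⟩
  set K := Fintype.piFinset fun _ : Fin n => Finset.Icc (-(N : ℤ)) N
  refine ⟨Fin r × K × Bool, inferInstance,
    fun j => fourierFunctional x₀ (q j.1) (hqsrc j.1) j.2.1 j.2.2, ?_, fun j => ?_, fun u => ?_⟩
  · have h1 := card_frequencies_le (n := n) hN
    rw [Fintype.card_prod, Fintype.card_prod, Fintype.card_fin, Fintype.card_bool,
      Fintype.card_coe]
    push_cast
    have h2 : 2 * (r : ℝ) * 3 ^ n ≤ C := by
      rw [hC]
      have : 0 ≤ C₃ * C₂ + C₃ * C₂ / c₁ + C₁ / c₃ := by positivity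
      linarith
    calc (r : ℝ) * (K.card * 2) ≤ r * (3 ^ n * N ^ n * 2) := by gcongr
      _ = 2 * r * 3 ^ n * N ^ n := by ring
      _ ≤ C * N ^ n := by gcongr
  · obtain ⟨a, k, re⟩ := j
    refine ⟨C₂ * (1 / c₃ * cρ), fun u => ?_⟩
    have h1 : fourierFunctional x₀ (q a) (hqsrc a) k re u ^ 2 ≤
        ‖chartFourier x₀ (k : Fin n → ℤ) (q a u)‖ ^ 2 := by
      rw [← sum_fourierFunctional_sq x₀ (q a) (hqsrc a) k u]
      exact Finset.single_le_sum
        (f := fun re => fourierFunctional x₀ (q a) (hqsrc a) k re u ^ 2)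
        (fun _ _ => sq_nonneg _) (Finset.mem_univ re)
    have h2 := (hfour (q a u) fun x hx => (hρ (hqs a u hx)).2.1).1 k
    have h3 : ∫ x, q a u x ^ 2 ∂μ ≤ ∑ a, ∫ x, q a u x ^ 2 ∂μ :=
      Finset.single_le_sum (f := fun a => ∫ x, q a u x ^ 2 ∂μ)
        (fun _ _ => integral_nonneg fun _ => sq_nonneg _) (Finset.mem_univ a)
    have h4 : ∑ a, ∫ x, q a u x ^ 2 ∂μ ≤ 1 / c₃ * (cρ * ip μ u u) := by
      rw [one_div, ← div_eq_inv_mul, le_div_iff₀ hc₃, mul_comm]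
      exact (hlow' u).trans (hρb u)
    refine h1.trans (h2.trans ?_)
    rw [mul_assoc, mul_assoc]
    exact mul_le_mul_of_nonneg_left (h3.trans h4) hC₂
  · set X := ∑ a, ∫ x, q a u x ^ 2 ∂μ
    set Y := ∑ a, ∑ i : Fin n, ∫ x, chartPull x₀ (chartPartial x₀ (q a u) i) x ^ 2 ∂μ with hY
    set I := ip μ (mulSection ρ u) (mulSection ρ u)
    set J := ip μ (H (mulSection ρ u)) (mulSection ρ u)
    have hY0 : 0 ≤ Y := Finset.sum_nonneg fun a _ => Finset.sum_nonneg fun i _ =>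
      integral_nonneg fun _ => sq_nonneg _
    have hI0 : 0 ≤ I := ip_self_nonneg μ _
    set S := ∑ j : Fin r × K × Bool,
      fourierFunctional x₀ (q j.1) (hqsrc j.1) j.2.1 j.2.2 u ^ 2 with hS
    have hS0 : 0 ≤ S := Finset.sum_nonneg fun _ _ => sq_nonneg _
    have h1 : X ≤ C₂ * S + C₂ / N ^ 2 * Y := by
      rw [hS, hY, Finset.mul_sum Finset.univ _ (C₂ / (N : ℝ) ^ 2), Fintype.sum_prod_type,
        Finset.mul_sum, ← Finset.sum_add_distrib]
      refine Finset.sum_le_sum fun a _ => ?_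
      have h2 := (hfour (q a u) fun x hx => (hρ (hqs a u hx)).2.1).2 N hN
      refine h2.trans (le_of_eq ?_)
      congr 2
      rw [Fintype.sum_prod_type, ← Finset.sum_coe_sort]
      exact Finset.sum_congr rfl fun k _ => (sum_fourierFunctional_sq x₀ (q a) (hqsrc a) k u).symm
    have h2 : Y ≤ 1 / c₁ * (J + C₁ / c₃ * I) := by
      rw [one_div, ← div_eq_inv_mul, le_div_iff₀ hc₁, mul_comm]
      refine (hgard' u).trans (add_le_add le_rfl ?_)
      rw [div_mul_eq_mul_div, le_div_iff₀ hc₃, mul_assoc, mul_comm X]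
      exact mul_le_mul_of_nonneg_left (hlow' u) hC₁
    have hN2 : (0 : ℝ) < (N : ℝ) ^ 2 := by positivity
    -- `H` itself need not be positive; this follows from `0 ≤ Y` and Gårding's inequality.
    have hJ0 : 0 ≤ J + C₁ / c₃ * I := by
      have := hY0.trans h2
      exact nonneg_of_mul_nonneg_right this (by positivity)
    have hp1 : 0 ≤ C₃ * C₂ := by positivity
    have hp2 : 0 ≤ C₃ * C₂ / c₁ := by positivity
    have hp3 : 0 ≤ C₁ / c₃ := by positivity
    have hp4 : (0 : ℝ) ≤ 2 * r * 3 ^ n := by positivity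
    calc I ≤ C₃ * X := hup' u
      _ ≤ C₃ * (C₂ * S + C₂ / N ^ 2 * (1 / c₁ * (J + C₁ / c₃ * I))) :=
        mul_le_mul_of_nonneg_left (h1.trans (by gcongr)) hC₃
      _ = C₃ * C₂ * S + C₃ * C₂ / c₁ / N ^ 2 * (J + C₁ / c₃ * I) := by ring
      _ ≤ C * S + C / N ^ 2 * (J + C * I) := by
        refine add_le_add (mul_le_mul_of_nonneg_right (by linarith) hS0) ?_
        refine mul_le_mul (div_le_div_of_nonneg_right (by linarith) hN2.le) ?_ hJ0 (by positivity)
        have : C₁ / c₃ * I ≤ C * I := mul_le_mul_of_nonneg_right (by linarith) hI0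
        linarith

end LocalEstimate

/-! ### Localization by a partition of unity. -/

section GlobalEstimate

variable {n : ℕ} {M : Type*} [TopologicalSpace M] [ChartedSpace (EuclideanSpace ℝ (Fin n)) M]
  [IsManifold (𝓡 n) ∞ M] [CompactSpace M] [T2Space M]
  {F : Type*} [NormedAddCommGroup F] [NormedSpace ℝ F] [FiniteDimensional ℝ F]
  {V : M → Type*} [TopologicalSpace (TotalSpace F V)] [∀ x, NormedAddCommGroup (V x)]
  [∀ x, InnerProductSpace ℝ (V x)] [FiberBundle F V] [VectorBundle ℝ F V]
  {H A : Cₛ^∞⟮𝓡 n; F, V⟯ →ₗ[ℝ] Cₛ^∞⟮𝓡 n; F, V⟯}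
  {G : ∀ x : M, QuadraticForm ℝ (TangentSpace (𝓡 n) x →L[ℝ] ℝ)}
  [MeasurableSpace M] [BorelSpace M] [IsContMDiffRiemannianBundle (𝓡 n) ∞ F V]
  [ContMDiffVectorBundle ∞ F V (𝓡 n)]
  {μ : Measure M} [IsFiniteMeasure μ]

variable (n M) in
theorem exists_finite_partition {U : M → Set M} (hU : ∀ x, U x ∈ nhds x) :
    ∃ (J : ℕ) (y : Fin J → M) (ρ : Fin J → C^∞⟮𝓡 n, M; ℝ⟯), (∀ j, tsupport (ρ j) ⊆ U (y j)) ∧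
      ∀ x, ∑ j, ρ j x = 1 := by
  obtain ⟨t, ht⟩ := CompactSpace.elim_nhds_subcover (fun x => interior (U x))
    (fun x => interior_mem_nhds.2 (hU x))
  have hcov : (univ : Set M) ⊆ ⋃ j : Fin t.card, interior (U (t.equivFin.symm j)) := by
    intro x _
    have hx : x ∈ ⋃ x ∈ t, interior (U x) := by rw [ht]; trivial
    obtain ⟨z, hz, hxz⟩ := mem_iUnion₂.1 hx
    refine mem_iUnion.2 ⟨t.equivFin ⟨z, hz⟩, ?_⟩
    simpa using hxz
  obtain ⟨f, hf⟩ := SmoothPartitionOfUnity.exists_isSubordinate (𝓡 n) isClosed_univ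
    (fun j : Fin t.card => interior (U (t.equivFin.symm j))) (fun j => isOpen_interior) hcov
  refine ⟨t.card, fun j => t.equivFin.symm j, fun j => f j,
    fun j => (hf j).trans interior_subset, fun x => ?_⟩
  rw [← finsum_eq_sum_of_fintype]
  exact f.sum_eq_one (mem_univ x)

/-- Pointwise Cauchy–Schwarz: `1 = (∑ ρ j)² ≤ J ∑ (ρ j)²`. -/
theorem ip_self_le_sum {J : ℕ} {ρ : Fin J → C^∞⟮𝓡 n, M; ℝ⟯} (hρ : ∀ x, ∑ j, ρ j x = 1)
    (u : Cₛ^∞⟮𝓡 n; F, V⟯) :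
    ip μ u u ≤ J * ∑ j, ip μ (mulSection (ρ j) u) (mulSection (ρ j) u) := by
  simp only [ip_self_eq]
  rw [← integral_finsetSum _ fun j _ => integrable_norm_sq _, ← integral_const_mul]
  refine integral_mono (integrable_norm_sq _)
    ((integrable_finsetSum _ fun j _ => integrable_norm_sq _).const_mul _) fun x => ?_
  simp only [mulSection_apply, norm_smul, mul_pow, Real.norm_eq_abs, sq_abs]
  rw [← Finset.sum_mul, ← mul_assoc]
  refine le_mul_of_one_le_left (sq_nonneg _) ?_
  have := sq_sum_le_card_mul_sum_sq (s := Finset.univ) (f := fun j => ρ j x)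
  rwa [hρ, one_pow, Finset.card_univ, Fintype.card_fin] at this

theorem two_mul_ip_le (u v : Cₛ^∞⟮𝓡 n; F, V⟯) : 2 * ip μ u v ≤ ip μ u u + ip μ v v := by
  have h := ip_self_nonneg μ (u - v)
  rw [ip_sub_left, ip_sub_right, ip_sub_right, ip_comm μ v u] at h
  linarith

theorem ip_add_self_le (u v : Cₛ^∞⟮𝓡 n; F, V⟯) :
    ip μ (u + v) (u + v) ≤ 2 * (ip μ u u + ip μ v v) := by
  have h := two_mul_ip_le (μ := μ) u v
  rw [ip_add_left, ip_add_right, ip_add_right, ip_comm μ v u]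
  linarith

theorem neg_ip_doubleBracket_le (hG : IsSymbol H G) {ρ : C^∞⟮𝓡 n, M; ℝ⟯} {C : ℝ}
    (hC : ∀ (x : M) (v : V x), cometric G x ρ ρ * ‖v‖ ^ 2 ≤ C * ‖v‖ ^ 2)
    (u : Cₛ^∞⟮𝓡 n; F, V⟯) : -ip μ u (bracket (bracket H ρ) ρ u) ≤ 2 * C * ip μ u u := by
  rw [ip_self_eq, ip, ← integral_neg, ← integral_const_mul]
  refine integral_mono (integrable_inner_section μ _ _).neg
    ((integrable_norm_sq u).const_mul _) fun x => ?_
  have := hC x (u x)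
  simp only [doubleBracket_apply hG, real_inner_smul_right, real_inner_self_eq_norm_sq]
  linarith

/-- IMS localization. Since `[H, ρ]` is antisymmetric, `2 ([H, ρ] u, ρ u) = -(u, [[H, ρ], ρ] u)`,
which is of order zero; no derivatives of `u` remain. -/
theorem exists_laplace_localization (hG : IsSymbol H G)
    (hs : ∀ u v, ip μ (H u) v = ip μ u (H v)) {ρ : C^∞⟮𝓡 n, M; ℝ⟯} {C : ℝ} (hC0 : 0 ≤ C)
    (hC : ∀ (x : M) (v : V x), cometric G x ρ ρ * ‖v‖ ^ 2 ≤ C * ‖v‖ ^ 2) :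
    ∃ D : ℝ, 0 ≤ D ∧ ∀ u, ip μ (H (mulSection ρ u)) (mulSection ρ u) ≤
      D * (ip μ (H u) (H u) + ip μ u u) := by
  obtain ⟨c, hc, hc'⟩ := ip_mulSection_self_le (F := F) (V := V) (μ := μ) ρ
  refine ⟨c + C, by positivity, fun u => ?_⟩
  have h1 : ip μ (H (mulSection ρ u)) (mulSection ρ u) =
      ip μ (mulSection ρ (H u)) (mulSection ρ u) + ip μ (bracket H ρ u) (mulSection ρ u) := by
    rw [bracket_apply, ip_sub_left]
    ring
  have h2 : 2 * ip μ (bracket H ρ u) (mulSection ρ u) =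
      -ip μ u (bracket (bracket H ρ) ρ u) := by
    rw [bracket_apply (bracket H ρ), ip_sub_right, ← ip_mulSection μ ρ u,
      ip_comm μ (mulSection ρ u)]
    have := ip_bracket hs ρ u (mulSection ρ u)
    linarith
  have h3 := neg_ip_doubleBracket_le (μ := μ) hG hC u
  have h4 := two_mul_ip_le (μ := μ) (mulSection ρ (H u)) (mulSection ρ u)
  have h5 := hc' u
  have h6 := hc' (H u)
  have h7 : 0 ≤ C * ip μ (H u) (H u) := mul_nonneg hC0 (ip_self_nonneg μ _)
  have h8 := ip_self_nonneg μ (mulSection ρ u)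
  have h9 := ip_self_nonneg μ (mulSection ρ (H u))
  linarith

/-- `[A, ρ]` commutes with `ρ` because `A` is of first order, so the terms with `[[A, ρ], ρ]`
disappear. -/
theorem doubleBracket_comp_self (hA : IsDiracType A) (ρ : C^∞⟮𝓡 n, M; ℝ⟯)
    (u : Cₛ^∞⟮𝓡 n; F, V⟯) :
    bracket (bracket (A ∘ₗ A) ρ) ρ u = (2 : ℝ) • bracket A ρ (bracket A ρ u) := by
  have key : ∀ v, A (mulSection ρ (mulSection ρ v)) =
      (2 : ℝ) • mulSection ρ (A (mulSection ρ v)) - mulSection ρ (mulSection ρ (A v)) := by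
    intro v
    ext x
    have h := hA.1 ρ ρ v x
    change _ = (2 : ℝ) • ρ x • A (mulSection ρ v) x - ρ x • ρ x • A v x
    linear_combination (norm := module) h
  have hsub : ∀ v w : Cₛ^∞⟮𝓡 n; F, V⟯, mulSection ρ (v - w) = mulSection ρ v - mulSection ρ w := by
    intro v w
    ext x
    exact smul_sub _ _ _
  have k1 := congrArg A (key u)
  have k2 := key (A u)
  simp only [bracket_apply, LinearMap.comp_apply, map_sub, map_smul, hsub] at k1 k2 ⊢
  linear_combination (norm := module) k1 + k2

/-- Here `A ρ u = ρ A u + [A, ρ] u`, and `‖[A, ρ] u‖² = -(u, [A, ρ]² u)` is controlled by the symbol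
of `A²`. The bound involves only `‖A u‖`, as the graph norm of `A` requires. -/
theorem exists_dirac_localization (hA : IsDiracType A) (hG : IsSymbol (A ∘ₗ A) G)
    (hs : ∀ u v, ip μ (A u) v = ip μ u (A v)) {ρ : C^∞⟮𝓡 n, M; ℝ⟯} {C : ℝ} (hC0 : 0 ≤ C)
    (hC : ∀ (x : M) (v : V x), cometric G x ρ ρ * ‖v‖ ^ 2 ≤ C * ‖v‖ ^ 2) :
    ∃ D : ℝ, 0 ≤ D ∧ ∀ u, ip μ ((A ∘ₗ A) (mulSection ρ u)) (mulSection ρ u) ≤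
      D * (ip μ (A u) (A u) + ip μ u u) := by
  obtain ⟨c, hc, hc'⟩ := ip_mulSection_self_le (F := F) (V := V) (μ := μ) ρ
  refine ⟨2 * c + 2 * C, by positivity, fun u => ?_⟩
  have h1 : A (mulSection ρ u) = mulSection ρ (A u) + bracket A ρ u := by
    rw [bracket_apply]
    abel
  have h2 : ip μ (bracket A ρ u) (bracket A ρ u) ≤ C * ip μ u u := by
    have := neg_ip_doubleBracket_le (μ := μ) hG hC u
    rw [doubleBracket_comp_self hA, ip_comm, ip_smul_left, ip_comm] at this
    rw [ip_bracket hs]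
    linarith
  have h3 := ip_add_self_le (μ := μ) (mulSection ρ (A u)) (bracket A ρ u)
  have h4 := hc' (A u)
  have h5 := mul_nonneg hC0 (ip_self_nonneg μ (A u))
  have h6 := mul_nonneg hc (ip_self_nonneg μ u)
  rw [LinearMap.comp_apply, hs, h1]
  linarith

/-- A Sobolev-type inequality on the manifold, with finitely many correction functionals. -/
theorem exists_global_estimate (hG : IsSymbol H G) (hs : ∀ u v, ip μ (H u) v = ip μ u (H v))
    (hμ : IsSmoothDensity n μ)
    (hloc : ∀ (ρ : C^∞⟮𝓡 n, M; ℝ⟯) (C : ℝ), 0 ≤ C →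
      (∀ (x : M) (v : V x), cometric G x ρ ρ * ‖v‖ ^ 2 ≤ C * ‖v‖ ^ 2) →
      ∃ D : ℝ, 0 ≤ D ∧ ∀ u, ip μ (H (mulSection ρ u)) (mulSection ρ u) ≤
        D * (ip μ (A u) (A u) + ip μ u u)) :
    ∃ C : ℝ, 0 ≤ C ∧ ∀ N : ℕ, 0 < N → ∃ (K : ℕ) (l : Fin K → Cₛ^∞⟮𝓡 n; F, V⟯ →ₗ[ℝ] ℝ),
      (K : ℝ) ≤ C * N ^ n ∧ (∀ k, ∃ c : ℝ, ∀ u, l k u ^ 2 ≤ c * ip μ u u) ∧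
      ∀ u, ip μ u u ≤ C * ∑ k, l k u ^ 2 + C / N ^ 2 * (ip μ (A u) (A u) + ip μ u u) := by
  choose U hU hest using exists_local_estimate hG hs hμ
  obtain ⟨J, y, ρ, hρU, hρ⟩ := exists_finite_partition n M hU
  choose hsym B hB hfun using fun j => hest (y j) (ρ j) (hρU j)
  choose S hS hsym' using hsym
  choose D hD hD' using fun j => hloc (ρ j) (S j) (hS j) (hsym' j)
  choose c hc hc' using fun j => ip_mulSection_self_le (F := F) (V := V) (μ := μ) (ρ j)
  -- This majorizes `B j` as well as the coefficient `B j (D j + B j c j)` of the remainder once the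
  -- localization bound is inserted.
  have hE : ∀ j, 0 ≤ B j * (1 + D j + B j * c j) := fun j => by
    have := hB j; have := hD j; have := hc j; positivity
  have hBE : ∀ j, B j ≤ B j * (1 + D j + B j * c j) := fun j => by
    have h1 := hB j
    have h2 := hD j
    have h3 := hc j
    refine le_mul_of_one_le_right h1 ?_
    have : 0 ≤ B j * c j := by positivity
    linarith
  have hEC : ∀ j, B j * (1 + D j + B j * c j) ≤ ∑ j, B j * (1 + D j + B j * c j) := fun j =>
    Finset.single_le_sum (f := fun j => B j * (1 + D j + B j * c j)) (fun j _ => hE j)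
      (Finset.mem_univ j)
  have hE0 : 0 ≤ ∑ j, B j * (1 + D j + B j * c j) := Finset.sum_nonneg fun j _ => hE j
  set E := ∑ j, B j * (1 + D j + B j * c j) with hEdef
  -- One `J` comes from Cauchy–Schwarz, the other from adding `J` equal remainders; `J² + 1`
  -- dominates `1`, `J` and `J²`.
  refine ⟨(J * J + 1) * E, by positivity, fun N hN => ?_⟩
  choose κ hκ l hcard hbd hmain using fun j => hfun j N hN
  have hN2 : (0 : ℝ) < (N : ℝ) ^ 2 := by positivity
  let e := Fintype.equivFin (Σ j, κ j)
  refine ⟨Fintype.card (Σ j, κ j), fun k => l (e.symm k).1 (e.symm k).2, ?_,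
    fun k => hbd _ _, fun u => ?_⟩
  · rw [Fintype.card_sigma]
    push_cast
    calc ∑ j, (Fintype.card (κ j) : ℝ) ≤ ∑ j, B j * (1 + D j + B j * c j) * (N : ℝ) ^ n := by
          refine Finset.sum_le_sum fun j _ => (hcard j).trans ?_
          exact mul_le_mul_of_nonneg_right (hBE j) (by positivity)
      _ = 1 * E * (N : ℝ) ^ n := by rw [← Finset.sum_mul, one_mul]
      _ ≤ (J * J + 1) * E * (N : ℝ) ^ n := by
          gcongr
          have : (0 : ℝ) ≤ J * J := by positivity
          linarith
  · have hsum : ∑ k, l (e.symm k).1 (e.symm k).2 u ^ 2 = ∑ j, ∑ k, l j k u ^ 2 := by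
      rw [e.symm.sum_comp fun p : Σ j, κ j => l p.1 p.2 u ^ 2, Fintype.sum_sigma]
    rw [hsum]
    set I := ip μ (A u) (A u) + ip μ u u with hI
    have hA0 := ip_self_nonneg μ (A u)
    have hu0 := ip_self_nonneg μ u
    have hS0 : ∀ j, 0 ≤ ∑ k, l j k u ^ 2 := fun j => Finset.sum_nonneg fun _ _ => sq_nonneg _
    have hj : ∀ j, ip μ (mulSection (ρ j) u) (mulSection (ρ j) u) ≤
        E * ∑ k, l j k u ^ 2 + E / N ^ 2 * I := by
      intro j
      refine (hmain j u).trans (add_le_add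
        (mul_le_mul_of_nonneg_right ((hBE j).trans (hEC j)) (hS0 j)) ?_)
      rw [div_mul_eq_mul_div, div_mul_eq_mul_div]
      refine div_le_div_of_nonneg_right ?_ hN2.le
      refine le_trans ?_ (mul_le_mul_of_nonneg_right (hEC j) (by positivity))
      rw [mul_assoc]
      refine mul_le_mul_of_nonneg_left ?_ (hB j)
      have h1 := hD' j u
      have h2 := mul_le_mul_of_nonneg_left (hc' j u) (hB j)
      have h3 : 0 ≤ B j * c j * ip μ (A u) (A u) :=
        mul_nonneg (mul_nonneg (hB j) (hc j)) hA0
      rw [← hI] at h1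
      have h4 : B j * c j * I = B j * c j * ip μ (A u) (A u) + B j * (c j * ip μ u u) := by
        rw [hI]; ring
      have h5 : 0 ≤ I := by positivity
      rw [add_mul, add_mul]
      linarith
    have hSS : 0 ≤ ∑ j, ∑ k, l j k u ^ 2 := Finset.sum_nonneg fun j _ => hS0 j
    have hI0 : 0 ≤ I := by positivity
    calc ip μ u u ≤ J * ∑ j, ip μ (mulSection (ρ j) u) (mulSection (ρ j) u) := ip_self_le_sum hρ u
      _ ≤ J * ∑ j : Fin J, (E * ∑ k, l j k u ^ 2 + E / N ^ 2 * I) := by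
          gcongr with j
          exact hj j
      _ = J * E * ∑ j, ∑ k, l j k u ^ 2 + J * J * E / N ^ 2 * I := by
          rw [Finset.sum_add_distrib, ← Finset.mul_sum, Finset.sum_const, Finset.card_univ,
            Fintype.card_fin, nsmul_eq_mul]
          ring
      _ ≤ (J * J + 1) * E * ∑ j, ∑ k, l j k u ^ 2 + (J * J + 1) * E / N ^ 2 * I := by
          have hJ : (J : ℝ) ≤ J * J + 1 := by nlinarith [sq_nonneg ((J : ℝ) - 1)]
          gcongr
          linarith

theorem exists_laplace_estimate (hH : IsLaplaceType H) (hs : ∀ u v, ip μ (H u) v = ip μ u (H v))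
    (hμ : IsSmoothDensity n μ) :
    ∃ C : ℝ, 0 ≤ C ∧ ∀ N : ℕ, 0 < N → ∃ (K : ℕ) (l : Fin K → Cₛ^∞⟮𝓡 n; F, V⟯ →ₗ[ℝ] ℝ),
      (K : ℝ) ≤ C * N ^ n ∧ (∀ k, ∃ c : ℝ, ∀ u, l k u ^ 2 ≤ c * ip μ u u) ∧
      ∀ u, ip μ u u ≤ C * ∑ k, l k u ^ 2 + C / N ^ 2 * (ip μ (H u) (H u) + ip μ u u) := by
  obtain ⟨G, hG⟩ := hH
  have hG : IsSymbol H G := hG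
  exact exists_global_estimate hG hs hμ fun ρ C => exists_laplace_localization hG hs

theorem exists_dirac_estimate (hA : IsDiracType A) (hs : ∀ u v, ip μ (A u) v = ip μ u (A v))
    (hμ : IsSmoothDensity n μ) :
    ∃ C : ℝ, 0 ≤ C ∧ ∀ N : ℕ, 0 < N → ∃ (K : ℕ) (l : Fin K → Cₛ^∞⟮𝓡 n; F, V⟯ →ₗ[ℝ] ℝ),
      (K : ℝ) ≤ C * N ^ n ∧ (∀ k, ∃ c : ℝ, ∀ u, l k u ^ 2 ≤ c * ip μ u u) ∧
      ∀ u, ip μ u u ≤ C * ∑ k, l k u ^ 2 + C / N ^ 2 * (ip μ (A u) (A u) + ip μ u u) := by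
  obtain ⟨G, hG⟩ := hA.2
  have hG : IsSymbol (A ∘ₗ A) G := hG
  refine exists_global_estimate hG (fun u v => ?_) hμ
    fun ρ C => exists_dirac_localization hA hG hs
  rw [LinearMap.comp_apply, hs, hs]
  rfl

end GlobalEstimate

universe u v

/-! ### Passage to the closures in `L²` and their eigenbases. -/

section Closure

variable {n : ℕ} {M : Type u} [TopologicalSpace M] [ChartedSpace (EuclideanSpace ℝ (Fin n)) M]
  [IsManifold (𝓡 n) ∞ M] [CompactSpace M] [T2Space M]
  {F : Type*} [NormedAddCommGroup F] [NormedSpace ℝ F] [FiniteDimensional ℝ F]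
  {V : M → Type v} [TopologicalSpace (TotalSpace F V)] [∀ x, NormedAddCommGroup (V x)]
  [∀ x, InnerProductSpace ℝ (V x)] [FiberBundle F V] [VectorBundle ℝ F V]
  {H A : Cₛ^∞⟮𝓡 n; F, V⟯ →ₗ[ℝ] Cₛ^∞⟮𝓡 n; F, V⟯}
  [MeasurableSpace M] [BorelSpace M] [IsContMDiffRiemannianBundle (𝓡 n) ∞ F V]
  [ContMDiffVectorBundle ∞ F V (𝓡 n)]
  {μ : Measure M} [IsFiniteMeasure μ]

theorem isOpenPosMeasure_of_isSmoothDensity (hμ : IsSmoothDensity n μ) :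
    μ.IsOpenPosMeasure := by
  refine ⟨fun U hU ⟨x, hx⟩ h0 => ?_⟩
  obtain ⟨ρ, hρ, hρ0, hmap⟩ := hμ (chrt x) (chart_mem_atlas _ x)
  set e := chrt (n := n) x
  have hW : IsOpen (e.target ∩ e.symm ⁻¹' U) := e.isOpen_inter_preimage_symm hU
  have hxW : e x ∈ e.target ∩ e.symm ⁻¹' U := by
    have hxs : x ∈ e.source := mem_chart_source _ x
    exact ⟨e.map_source hxs, by rwa [mem_preimage, e.left_inv hxs]⟩
  have hae : AEMeasurable e (μ.restrict e.source) :=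
    e.continuousOn.aemeasurable e.open_source.measurableSet
  have h1 : (μ.restrict e.source).map e (e.target ∩ e.symm ⁻¹' U) = 0 := by
    rw [Measure.map_apply_of_aemeasurable hae hW.measurableSet,
      Measure.restrict_apply' e.open_source.measurableSet]
    refine measure_mono_null (fun z hz => ?_) h0
    have := hz.1.2
    rwa [mem_preimage, e.left_inv hz.2] at this
  rw [hmap, withDensity_apply _ hW.measurableSet, Measure.restrict_restrict hW.measurableSet,
    inter_right_comm, inter_self] at h1
  have hm : AEMeasurable (fun y => ENNReal.ofReal (ρ y))
      (volume.restrict (e.target ∩ e.symm ⁻¹' U)) :=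
    ((hρ.continuousOn.mono inter_subset_left).aemeasurable hW.measurableSet).ennreal_ofReal
  rw [lintegral_eq_zero_iff' hm, Filter.EventuallyEq, ae_restrict_iff' hW.measurableSet] at h1
  refine (hW.measure_pos volume ⟨_, hxW⟩).ne' (measure_mono_null (fun y hy => ?_) h1)
  simp only [mem_compl_iff, mem_ofPred_eq, Pi.zero_apply, ENNReal.ofReal_eq_zero, not_forall, not_le]
  exact ⟨hy, hρ0 y hy.1⟩

theorem inner_toL2_eq_ip (u v : Cₛ^∞⟮𝓡 n; F, V⟯) : ⟪toL2 μ u, toL2 μ v⟫_ℝ = ip μ u v :=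
  inner_toL2 μ u v

theorem norm_toL2_sq (u : Cₛ^∞⟮𝓡 n; F, V⟯) : ‖toL2 μ u‖ ^ 2 = ip μ u u := by
  rw [← real_inner_self_eq_norm_sq, inner_toL2_eq_ip]

/-- A smooth positive density charges every nonempty open set, so a continuous section of norm zero
vanishes. Hence the pairs `(u, H u)` form the graph of an operator in `L²`. -/
theorem eq_zero_of_toL2_eq_zero (hμ : IsSmoothDensity n μ) {u : Cₛ^∞⟮𝓡 n; F, V⟯}
    (hu : toL2 μ u = 0) : u = 0 := by
  have := isOpenPosMeasure_of_isSmoothDensity hμ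
  have h1 : ∫ x, ⟪u x, u x⟫_ℝ ∂μ = 0 := by rw [← inner_toL2, hu, inner_zero_left]
  rw [integral_eq_zero_iff_of_nonneg (fun x => real_inner_self_nonneg)
    (integrable_inner_section μ u u)] at h1
  have h2 := (continuous_inner_section u u).ae_eq_iff_eq μ continuous_zero |>.1 h1
  ext x
  exact inner_self_eq_zero.1 (congrFun h2 x)

theorem denseRange_toL2 : DenseRange (toL2 μ : Cₛ^∞⟮𝓡 n; F, V⟯ → L2Sections n F V μ) :=
  UniformSpace.Completion.denseRange_coe (α := PreL2 n F V μ)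

theorem mem_graph_l2Closure (hμ : IsSmoothDensity n μ) (u : Cₛ^∞⟮𝓡 n; F, V⟯) :
    (toL2 μ u, toL2 μ (H u)) ∈ (l2Closure μ H).graph := by
  refine LinearPMap.le_graph_of_le (LinearPMap.le_closure _) ?_
  rw [Submodule.toLinearPMap_graph_eq]
  · exact ⟨u, rfl⟩
  · rintro _ ⟨v, rfl⟩ hv
    have : v = 0 := eq_zero_of_toL2_eq_zero hμ hv
    rw [this, map_zero]
    rfl

/-- If the operator were not closable, `LinearPMap.closure` would return it unchanged, and the
inclusion still holds. -/
theorem graph_l2Closure_subset (hμ : IsSmoothDensity n μ) :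
    ((l2Closure μ H).graph : Set _) ⊆
      closure (range fun u : Cₛ^∞⟮𝓡 n; F, V⟯ => (toL2 μ u, toL2 μ (H u))) := by
  have hg : (LinearMap.range ((toL2 μ).prod (toL2 μ ∘ₗ H))).toLinearPMap.graph =
      LinearMap.range ((toL2 μ).prod (toL2 μ ∘ₗ H)) := by
    refine Submodule.toLinearPMap_graph_eq _ ?_
    rintro _ ⟨v, rfl⟩ hv
    have : v = 0 := eq_zero_of_toL2_eq_zero hμ hv
    rw [this, map_zero]
    rfl
  by_cases hc : (LinearMap.range ((toL2 μ).prod (toL2 μ ∘ₗ H))).toLinearPMap.IsClosable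
  · rw [l2Closure, ← hc.graph_closure_eq_closure_graph, hg, Submodule.topologicalClosure_coe]
    exact closure_mono (by rintro _ ⟨u, rfl⟩; exact ⟨u, rfl⟩)
  · rw [l2Closure, LinearPMap.closure_def' hc, hg]
    refine subset_trans ?_ subset_closure
    rintro _ ⟨u, rfl⟩
    exact ⟨u, rfl⟩

theorem ip_symm_of_isSelfAdjoint (hμ : IsSmoothDensity n μ) (hH : IsSelfAdjoint (l2Closure μ H))
    (u v : Cₛ^∞⟮𝓡 n; F, V⟯) : ip μ (H u) v = ip μ u (H v) := by
  rw [← inner_toL2_eq_ip, ← inner_toL2_eq_ip]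
  exact isSelfAdjoint_inner_graph hH (mem_graph_l2Closure hμ u) (mem_graph_l2Closure hμ v)

theorem exists_extension (l : Cₛ^∞⟮𝓡 n; F, V⟯ →ₗ[ℝ] ℝ) {c : ℝ}
    (hl : ∀ u, l u ^ 2 ≤ c * ip μ u u) :
    ∃ f : L2Sections n F V μ →L[ℝ] ℝ, ∀ u, f (toL2 μ u) = l u := by
  refine ⟨l.extendOfNorm (toL2 μ), LinearMap.extendOfNorm_eq denseRange_toL2 ⟨√|c|, fun u => ?_⟩⟩
  rw [← Real.sqrt_sq (norm_nonneg (toL2 μ u)), ← Real.sqrt_mul (abs_nonneg c), Real.norm_eq_abs,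
    norm_toL2_sq]
  exact Real.abs_le_sqrt ((hl u).trans
    (mul_le_mul_of_nonneg_right (le_abs_self c) (ip_self_nonneg μ u)))

/-- The functionals are `L²` bounded, so they extend to the completion. The inequality then defines
a closed set of pairs and passes from smooth sections to the graph of the closure. -/
theorem isDiscretizable_l2Closure (hμ : IsSmoothDensity n μ)
    (h : ∃ C : ℝ, 0 ≤ C ∧ ∀ N : ℕ, 0 < N → ∃ (K : ℕ) (l : Fin K → Cₛ^∞⟮𝓡 n; F, V⟯ →ₗ[ℝ] ℝ),
      (K : ℝ) ≤ C * N ^ n ∧ (∀ k, ∃ c : ℝ, ∀ u, l k u ^ 2 ≤ c * ip μ u u) ∧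
      ∀ u, ip μ u u ≤ C * ∑ k, l k u ^ 2 + C / N ^ 2 * (ip μ (H u) (H u) + ip μ u u)) :
    IsDiscretizable (l2Closure μ H) n := by
  obtain ⟨C, hC, h⟩ := h
  refine ⟨C, hC, fun N hN => ?_⟩
  obtain ⟨K, l, hK, hl, hu⟩ := h N hN
  choose c hc using hl
  choose f hf using fun k => exists_extension (l k) (hc k)
  refine ⟨K, f, C, hK, fun x x' hx => ?_⟩
  have hclosed : IsClosed {p : L2Sections n F V μ × L2Sections n F V μ |
      ‖p.1‖ ^ 2 ≤ C * ∑ k, f k p.1 ^ 2 + C / N ^ 2 * (‖p.2‖ ^ 2 + ‖p.1‖ ^ 2)} :=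
    isClosed_le (by fun_prop) (by fun_prop)
  refine hclosed.closure_subset_iff.2 ?_ (graph_l2Closure_subset hμ hx)
  rintro _ ⟨u, rfl⟩
  simpa only [mem_ofPred_eq, norm_toL2_sq, hf] using hu u

theorem exists_isEigenbasis_laplace (hμ : IsSmoothDensity n μ) (hH : IsLaplaceType H)
    (hs : IsSelfAdjoint (l2Closure μ H)) {m : ℝ}
    (hm : ∀ u : (l2Closure μ H).domain, u ≠ 0 →
      0 < ⟪l2Closure μ H u, (u : L2Sections n F V μ)⟫_ℝ
        + m ^ 2 * ‖(u : L2Sections n F V μ)‖ ^ 2) :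
    ∃ (ι : Type (max u v)) (b : HilbertBasis ι ℝ (L2Sections n F V μ)) (l : ι → ℝ), Countable ι ∧
      IsEigenbasis (l2Closure μ H) b l ∧ (∀ i, 0 < l i + m ^ 2) ∧
      HasPartition fun i => √(l i + m ^ 2) := by
  obtain ⟨ι, b, l, hb, hι, hsum⟩ := exists_isEigenbasis_summable hs (isDiscretizable_l2Closure hμ
    (exists_laplace_estimate hH (ip_symm_of_isSelfAdjoint hμ hs) hμ))
  -- Positivity of `H + m²` is tested on the unit eigenvectors.
  have hpos : ∀ i, 0 < l i + m ^ 2 := by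
    intro i
    obtain ⟨u, hu, hu'⟩ := (LinearPMap.mem_graph_iff _).1 (hb.mem i)
    have hn : ‖b i‖ = 1 := b.orthonormal.1 i
    simp only at hu hu'
    have h0 : u ≠ 0 := by
      rintro rfl
      rw [← hu] at hn
      simp at hn
    have := hm u h0
    rw [hu, hu', real_inner_smul_left, real_inner_self_eq_norm_sq, hn] at this
    linarith
  refine ⟨ι, b, l, hι, hb, hpos, hasPartition_of_summable_inv_pow
    (fun i => Real.sqrt_pos.2 (hpos i)) (q := n + 1) (b := m ^ 2) ?_⟩
  convert! hsum using 4 with i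
  rw [Real.sq_sqrt (hpos i).le]
  ring

theorem exists_isEigenbasis_dirac (hμ : IsSmoothDensity n μ) (hA : IsDiracType A)
    (hs : IsSelfAdjoint (l2Closure μ A)) {m : ℝ} (hm : 0 < m) :
    ∃ (ι : Type (max u v)) (b : HilbertBasis ι ℝ (L2Sections n F V μ)) (a : ι → ℝ), Countable ι ∧
      IsEigenbasis (l2Closure μ A) b a ∧ HasPartition fun i => √(a i ^ 2 + m ^ 2) := by
  obtain ⟨ι, b, a, hb, hι, hsum⟩ := exists_isEigenbasis_summable hs (isDiscretizable_l2Closure hμ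
    (exists_dirac_estimate hA (ip_symm_of_isSelfAdjoint hμ hs) hμ))
  have hpos : ∀ i, 0 < a i ^ 2 + m ^ 2 := fun i => by positivity
  refine ⟨ι, b, a, hι, hb, hasPartition_of_summable_inv_pow
    (fun i => Real.sqrt_pos.2 (hpos i)) (q := n + 1) (b := m ^ 2) ?_⟩
  -- The squared operator has eigenvalues `a²`, and `1 + a² ≤ 2 (1 + a⁴)`.
  refine (hsum.mul_left (2 ^ (n + 2))).of_nonneg_of_le (fun i => by positivity) fun i => ?_
  rw [Real.sq_sqrt (hpos i).le, add_sub_cancel_right, ← div_eq_mul_inv, ← one_div,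
    div_le_div_iff₀ (by positivity) (by positivity), one_mul, ← mul_pow]
  refine pow_le_pow_left₀ (by positivity) ?_ _
  nlinarith [sq_nonneg (a i ^ 2), sq_nonneg (a i ^ 2 - 1)]

end Closure

end Bogolyubov
end

/-! ### Conclusion: the eigenbases inserted in the trace formulas. -/

theorem mainTheorem4
    {n : ℕ} {M : Type*} [TopologicalSpace M] [ChartedSpace (EuclideanSpace ℝ (Fin n)) M]
    [IsManifold (𝓡 n) ∞ M] [CompactSpace M] [T2Space M] [MeasurableSpace M] [BorelSpace M]
    {F : Type*} [NormedAddCommGroup F] [NormedSpace ℝ F] [FiniteDimensional ℝ F]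
    {V : M → Type*} [TopologicalSpace (TotalSpace F V)] [∀ x, NormedAddCommGroup (V x)]
    [∀ x, InnerProductSpace ℝ (V x)] [FiberBundle F V] [VectorBundle ℝ F V]
    [ContMDiffVectorBundle ∞ F V (𝓡 n)] [IsContMDiffRiemannianBundle (𝓡 n) ∞ F V]
    (μ : Measure M) [IsFiniteMeasure μ] (hμ : Bogolyubov.IsSmoothDensity n μ) :
    -- the kernels are the inverse Laplace transforms of the Fermi and Bose functions
    (Bogolyubov.IsLaplaceKernel Bogolyubov.hf Bogolyubov.fermi ∧
      Bogolyubov.IsLaplaceKernel Bogolyubov.hb Bogolyubov.bose ∧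
      Bogolyubov.IsLaplaceKernel Bogolyubov.h0 Bogolyubov.fermiBoseMean) ∧
    -- bosons
    (∀ Hp Hm : Cₛ^∞⟮𝓡 n; F, V⟯ →ₗ[ℝ] Cₛ^∞⟮𝓡 n; F, V⟯,
      Bogolyubov.IsLaplaceType Hp → Bogolyubov.IsLaplaceType Hm →
      IsSelfAdjoint (Bogolyubov.l2Closure μ Hp) → IsSelfAdjoint (Bogolyubov.l2Closure μ Hm) →
      ∀ m : ℝ, 0 < m →
      (∀ u : (Bogolyubov.l2Closure μ Hp).domain, u ≠ 0 →
        0 < ⟪Bogolyubov.l2Closure μ Hp u, (u : Bogolyubov.L2Sections n F V μ)⟫_ℝ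
          + m ^ 2 * ‖(u : Bogolyubov.L2Sections n F V μ)‖ ^ 2) →
      (∀ u : (Bogolyubov.l2Closure μ Hm).domain, u ≠ 0 →
        0 < ⟪Bogolyubov.l2Closure μ Hm u, (u : Bogolyubov.L2Sections n F V μ)⟫_ℝ
          + m ^ 2 * ‖(u : Bogolyubov.L2Sections n F V μ)‖ ^ 2) →
      (∀ t s : ℝ, 0 < t → 0 < s → Bogolyubov.IsTraceClass
        (Bogolyubov.relHeatOp (Bogolyubov.l2Closure μ Hp) (Bogolyubov.l2Closure μ Hm) t s)) ∧
      ∀ β : ℝ, 0 < β →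
        Bogolyubov.IsTraceClass
          (Bogolyubov.bosonicOp (Bogolyubov.l2Closure μ Hp) (Bogolyubov.l2Closure μ Hm) m β) ∧
        IntegrableOn (fun p : ℝ × ℝ => Bogolyubov.hf p.1 * Bogolyubov.hb p.2
          * Real.exp (-m ^ 2 * β ^ 2 * (p.2 + p.1))
          * Bogolyubov.relHeatTrace (Bogolyubov.l2Closure μ Hp) (Bogolyubov.l2Closure μ Hm)
              (β ^ 2 * p.1) (β ^ 2 * p.2)) (Ioi 0 ×ˢ Ioi 0) ∧
        Bogolyubov.bosonicInvariant (Bogolyubov.l2Closure μ Hp) (Bogolyubov.l2Closure μ Hm) m β =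
          ∫ t in Ioi (0 : ℝ), ∫ s in Ioi (0 : ℝ), Bogolyubov.hf t * Bogolyubov.hb s
            * Real.exp (-m ^ 2 * β ^ 2 * (s + t))
            * Bogolyubov.relHeatTrace (Bogolyubov.l2Closure μ Hp) (Bogolyubov.l2Closure μ Hm)
                (β ^ 2 * t) (β ^ 2 * s)) ∧
    -- fermions
    (∀ Ap Am : Cₛ^∞⟮𝓡 n; F, V⟯ →ₗ[ℝ] Cₛ^∞⟮𝓡 n; F, V⟯,
      Bogolyubov.IsDiracType Ap → Bogolyubov.IsDiracType Am →
      IsSelfAdjoint (Bogolyubov.l2Closure μ Ap) → IsSelfAdjoint (Bogolyubov.l2Closure μ Am) →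
      ∀ m : ℝ, 0 < m →
      (∀ t s : ℝ, 0 < t → 0 < s →
        Bogolyubov.IsTraceClass (Bogolyubov.relHeatOp
          (Bogolyubov.sqOp (Bogolyubov.l2Closure μ Ap))
          (Bogolyubov.sqOp (Bogolyubov.l2Closure μ Am)) t s) ∧
        Bogolyubov.IsTraceClass (Bogolyubov.relDiracHeatOp
          (Bogolyubov.l2Closure μ Ap) (Bogolyubov.l2Closure μ Am) t s)) ∧
      ∀ β : ℝ, 0 < β →
        Bogolyubov.IsTraceClass
          (Bogolyubov.fermionicOp (Bogolyubov.l2Closure μ Ap) (Bogolyubov.l2Closure μ Am) m β) ∧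
        IntegrableOn (fun p : ℝ × ℝ => Bogolyubov.h0 p.2 * Bogolyubov.h0 p.1
          * Real.exp (-m ^ 2 * β ^ 2 * (p.2 + p.1))
          * (β ^ 2 * (Bogolyubov.relDiracHeatTrace
                (Bogolyubov.l2Closure μ Ap) (Bogolyubov.l2Closure μ Am)
                (β ^ 2 * p.1) (β ^ 2 * p.2)
              + m ^ 2 * Bogolyubov.relHeatTrace
                (Bogolyubov.sqOp (Bogolyubov.l2Closure μ Ap))
                (Bogolyubov.sqOp (Bogolyubov.l2Closure μ Am))
                (β ^ 2 * p.1) (β ^ 2 * p.2)))) (Ioi 0 ×ˢ Ioi 0) ∧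
        Bogolyubov.fermionicInvariant (Bogolyubov.l2Closure μ Ap) (Bogolyubov.l2Closure μ Am) m β =
          ∫ t in Ioi (0 : ℝ), ∫ s in Ioi (0 : ℝ), Bogolyubov.h0 s * Bogolyubov.h0 t
            * Real.exp (-m ^ 2 * β ^ 2 * (s + t))
            * (β ^ 2 * (Bogolyubov.relDiracHeatTrace
                  (Bogolyubov.l2Closure μ Ap) (Bogolyubov.l2Closure μ Am)
                  (β ^ 2 * t) (β ^ 2 * s)
                + m ^ 2 * Bogolyubov.relHeatTrace
                  (Bogolyubov.sqOp (Bogolyubov.l2Closure μ Ap))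
                  (Bogolyubov.sqOp (Bogolyubov.l2Closure μ Am))
                  (β ^ 2 * t) (β ^ 2 * s)))) := by
  refine ⟨⟨Bogolyubov.isLaplaceKernel_hf, Bogolyubov.isLaplaceKernel_hb,
    Bogolyubov.isLaplaceKernel_h0⟩, ?_, ?_⟩
  · intro Hp Hm hp hm hsp hsm m _ hposp hposm
    obtain ⟨ι, b, l, hι, hb, hl, hy⟩ :=
      Bogolyubov.exists_isEigenbasis_laplace hμ hp hsp hposp
    obtain ⟨ι', b', l', hι', hb', hl', hy'⟩ :=
      Bogolyubov.exists_isEigenbasis_laplace hμ hm hsm hposm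
    exact Bogolyubov.boson_of_isEigenbasis hb hb' hl hl' hy hy'
  · intro Ap Am hp hm hsp hsm m hm0
    obtain ⟨ι, b, a, hι, hb, hy⟩ := Bogolyubov.exists_isEigenbasis_dirac hμ hp hsp hm0
    obtain ⟨ι', b', a', hι', hb', hy'⟩ := Bogolyubov.exists_isEigenbasis_dirac hμ hm hsm hm0
    exact Bogolyubov.fermion_of_isEigenbasis hb hb' hm0 hy hy'
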